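/- Let $H$ be a real separable Hilbert space. Let $C_b(H)$ be the Banach space of bounded uniformly continuous functions $H\to\mathbb R$ with the supremum norm $\|\cdot\|$, and let $C_b^1(H)$ be the set of those $\varphi\in C_b(H)$ that are Fréchet differentiable with bounded, uniformly continuous differential $D\varphi:H\to H$ (where $H$ is identified with its dual). Assume: (i) $A:D(A)\subset H\to H$ is the infinitesimal generator of a strongly continuous semigroup $(e^{tA})_{t\ge0}$ on $H$, and for some $\omega\in\mathbb R$ one has $\|e^{tA}\|\le e^{\omega t}$ for all $t\ge0$; (ii) $Q$ is a bounded self-adjoint operator on $H$ with $\langle Qx,x\rangle\ge0$ for all $x\in H$; (iii) for every $t>0$ the operator $Q_tx=\int_0^te^{sA}Qe^{sA^*}x\,ds$, $x\in H$, is of trace class; (iv) $F:H\to H$ is bounded and Fréchet differentiable, with bounded and uniformly continuous differential $DF:H\to\mathcal L(H)$. For $\varphi\in C_b(H)$ let $R_t\varphi(x)=\int_H\varphi(e^{tA}x+y)\,N_{Q_t}(dy)$ be the Ornstein–Uhlenbeck semigroup, where $N_{Q_t}$ is the Gaussian measure on $H$ with mean $0$ and covariance operator $Q_t$. Let $L$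 be its infinitesimal generator in the following sense: $\varphi\in D(L)$ and $L\varphi=g$ if and only if $\varphi,g\in C_b(H)$, $\lim_{t\to0^+}\frac{R_t\varphi(x)-\varphi(x)}t=g(x)$ for every $x\in H$, and $\sup_{t\in(0,1)}\big\|\frac{R_t\varphi-\varphi}t\big\|<\infty$. Let $$N_0\varphi=L\varphi+\langle D\varphi,F\rangle,\qquad \varphi\in D(N_0)=D(L)\cap C_b^1(H).$$ Then: (a) $N_0$ is dissipative in $C_b(H)$: $\|\lambda\varphi-N_0\varphi\|\ge\lambda\|\varphi\|$ for all $\lambda>0$ and $\varphi\in D(N_0)$; (b) for every $\lambda>0$ the range $(\lambda-N_0)(D(N_0))$ is dense in $C_b(H)$; (c) $N_0$ is closable in $C_b(H)$, and its closure $\overline{N_0}$ is $m$-dissipative, that is, $\overline{N_0}$ is dissipative and $\lambda-\overline{N_0}$ maps $D(\overline{N_0})$ onto $C_b(H)$ for every $\lambda>0$. -/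

import Mathlib

open Filter Topology MeasureTheory ProbabilityTheory Set
open scoped RealInnerProductSpace BoundedContinuousFunction

namespace OUPerturbation

section Spaces

variable (H : Type*) [NormedAddCommGroup H] [InnerProductSpace ℝ H]

/-- `C_b(H)`: uniformly continuous and bounded functions `H → ℝ`, with the supremum norm
(inherited from the bounded continuous functions). -/
def Cb : Submodule ℝ (H →ᵇ ℝ) where
  carrier := {f | UniformContinuous f}
  add_mem' hf hg := UniformContinuous.add hf hg
  zero_mem' := uniformContinuous_const
  smul_mem' c _ hf := UniformContinuous.const_smul hf c

variable {H}

theorem Cb.differentiable_fderiv_add {φ ψ : Cb H}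
    (hφ : Differentiable ℝ (φ : H →ᵇ ℝ)) (hψ : Differentiable ℝ (ψ : H →ᵇ ℝ)) :
    fderiv ℝ ((φ + ψ : Cb H) : H →ᵇ ℝ) =
      fderiv ℝ (φ : H →ᵇ ℝ) + fderiv ℝ (ψ : H →ᵇ ℝ) := by
  ext1 x
  exact ((hφ x).hasFDerivAt.add (hψ x).hasFDerivAt).fderiv

theorem Cb.differentiable_fderiv_smul (c : ℝ) {φ : Cb H}
    (hφ : Differentiable ℝ (φ : H →ᵇ ℝ)) :
    fderiv ℝ ((c • φ : Cb H) : H →ᵇ ℝ) = c • fderiv ℝ (φ : H →ᵇ ℝ) := by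
  ext1 x
  exact ((hφ x).hasFDerivAt.const_smul c).fderiv

variable (H)

/-- `C_b^1(H)`: the `f ∈ C_b(H)` that are Fréchet differentiable with uniformly continuous and
bounded differential. (`H` is identified with its dual, so the differential is `fderiv ℝ f`.) -/
def CbOne : Submodule ℝ (Cb H) where
  carrier := {φ | Differentiable ℝ (φ : H →ᵇ ℝ) ∧
    UniformContinuous (fderiv ℝ (φ : H →ᵇ ℝ)) ∧
    ∃ C : ℝ, ∀ x, ‖fderiv ℝ (φ : H →ᵇ ℝ) x‖ ≤ C}
  add_mem' := by
    rintro φ ψ ⟨hφ, hφu, C, hC⟩ ⟨hψ, hψu, D, hD⟩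
    refine ⟨hφ.add hψ, ?_, C + D, fun x => ?_⟩
    · rw [Cb.differentiable_fderiv_add hφ hψ]
      exact hφu.add hψu
    · rw [Cb.differentiable_fderiv_add hφ hψ]
      exact (norm_add_le _ _).trans (add_le_add (hC x) (hD x))
  zero_mem' := by
    have h : fderiv ℝ ((0 : Cb H) : H →ᵇ ℝ) = fun _ => 0 := by
      ext1 x
      exact (hasFDerivAt_const (0 : ℝ) x).fderiv
    refine ⟨differentiable_const (0 : ℝ), ?_, 0, fun x => ?_⟩
    · rw [h]
      exact uniformContinuous_const
    · rw [h]
      simp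
  smul_mem' := by
    rintro c φ ⟨hφ, hφu, C, hC⟩
    refine ⟨hφ.const_smul c, ?_, ‖c‖ * C, fun x => ?_⟩
    · rw [Cb.differentiable_fderiv_smul c hφ]
      exact hφu.const_smul c
    · rw [Cb.differentiable_fderiv_smul c hφ, Pi.smul_apply, norm_smul]
      exact mul_le_mul_of_nonneg_left (hC x) (norm_nonneg c)

variable {H}

/-- `F ∈ C_b^1(H; H)`: `F : H → H` is bounded and Fréchet differentiable, with uniformly continuous
and bounded differential `DF : H → L(H)`. -/
structure IsCbOneField (F : H → H) : Prop where
  bounded : ∃ C : ℝ, ∀ x, ‖F x‖ ≤ C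
  differentiable : Differentiable ℝ F
  uniformContinuous_fderiv : UniformContinuous (fderiv ℝ F)
  bounded_fderiv : ∃ C : ℝ, ∀ x, ‖fderiv ℝ F x‖ ≤ C

theorem IsCbOneField.uniformContinuous {F : H → H} (hF : IsCbOneField F) :
    UniformContinuous F := by
  obtain ⟨C, hC⟩ := hF.bounded_fderiv
  have hC0 : 0 ≤ C := (norm_nonneg _).trans (hC 0)
  have : LipschitzWith ⟨C, hC0⟩ F :=
    lipschitzWith_of_nnnorm_fderiv_le hF.differentiable fun x => hC x
  exact this.uniformContinuous

theorem uniformContinuous_drift {F : H → H} (hF : IsCbOneField F) {φ : Cb H}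
    (hφ : φ ∈ CbOne H) :
    UniformContinuous fun x => fderiv ℝ (φ : H →ᵇ ℝ) x (F x) := by
  obtain ⟨-, hu, C, hC⟩ := hφ
  obtain ⟨M, hM⟩ := hF.bounded
  have hC0 : 0 ≤ C := (norm_nonneg _).trans (hC 0)
  have hM0 : 0 ≤ M := (norm_nonneg _).trans (hM 0)
  rw [Metric.uniformContinuous_iff]
  intro ε hε
  obtain ⟨δ₁, h₁, H₁⟩ := Metric.uniformContinuous_iff.1 hu (ε / (2 * (M + 1))) (by positivity)
  obtain ⟨δ₂, h₂, H₂⟩ := Metric.uniformContinuous_iff.1 hF.uniformContinuous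
    (ε / (2 * (C + 1))) (by positivity)
  refine ⟨min δ₁ δ₂, lt_min h₁ h₂, fun {x y} hxy => ?_⟩
  have e₁ := H₁ (hxy.trans_le (min_le_left _ _))
  have e₂ := H₂ (hxy.trans_le (min_le_right _ _))
  rw [dist_eq_norm] at e₁ e₂ ⊢
  set Dx := fderiv ℝ (φ : H →ᵇ ℝ) x
  set Dy := fderiv ℝ (φ : H →ᵇ ℝ) y
  have split : Dx (F x) - Dy (F y) = (Dx - Dy) (F x) + Dy (F x - F y) := by
    simp
  have b₁ : ‖(Dx - Dy) (F x)‖ ≤ ‖Dx - Dy‖ * M :=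
    ((Dx - Dy).le_opNorm _).trans (mul_le_mul_of_nonneg_left (hM x) (norm_nonneg _))
  have b₂ : ‖Dy (F x - F y)‖ ≤ C * ‖F x - F y‖ :=
    (Dy.le_opNorm _).trans (mul_le_mul_of_nonneg_right (hC y) (norm_nonneg _))
  have c₁ : ‖Dx - Dy‖ * (2 * (M + 1)) < ε := (lt_div_iff₀ (by positivity)).1 e₁
  have c₂ : ‖F x - F y‖ * (2 * (C + 1)) < ε := (lt_div_iff₀ (by positivity)).1 e₂
  rw [split]
  refine (norm_add_le _ _).trans_lt ?_
  nlinarith [norm_nonneg (Dx - Dy), norm_nonneg (F x - F y)]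

theorem exists_bound_drift {F : H → H} (hF : IsCbOneField F) {φ : Cb H} (hφ : φ ∈ CbOne H) :
    ∃ C : ℝ, ∀ x, ‖fderiv ℝ (φ : H →ᵇ ℝ) x (F x)‖ ≤ C := by
  obtain ⟨-, -, C, hC⟩ := hφ
  obtain ⟨M, hM⟩ := hF.bounded
  have hC0 : 0 ≤ C := (norm_nonneg _).trans (hC 0)
  exact ⟨C * M, fun x => (ContinuousLinearMap.le_opNorm _ _).trans
    (mul_le_mul (hC x) (hM x) (norm_nonneg _) hC0)⟩

/-- The first order operator `φ ↦ ⟨Dφ(·), F(·)⟩` in `C_b(H)`, with domain `C_b^1(H)`. -/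
noncomputable def drift (F : H → H) (hF : IsCbOneField F) : Cb H →ₗ.[ℝ] Cb H where
  domain := CbOne H
  toFun :=
    { toFun := fun φ =>
        ⟨BoundedContinuousFunction.ofNormedAddCommGroup
            (fun x => fderiv ℝ ((φ : Cb H) : H →ᵇ ℝ) x (F x))
            (uniformContinuous_drift hF φ.2).continuous
            (exists_bound_drift hF φ.2).choose (exists_bound_drift hF φ.2).choose_spec,
          uniformContinuous_drift hF φ.2⟩
      map_add' := fun φ ψ => by
        ext x
        exact DFunLike.congr_fun
          (congrFun (Cb.differentiable_fderiv_add φ.2.1 ψ.2.1) x) (F x)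
      map_smul' := fun c φ => by
        ext x
        exact DFunLike.congr_fun
          (congrFun (Cb.differentiable_fderiv_smul c φ.2.1) x) (F x) }

theorem drift_apply (F : H → H) (hF : IsCbOneField F) (φ : CbOne H) (x : H) :
    ((drift F hF φ : Cb H) : H →ᵇ ℝ) x = fderiv ℝ ((φ : Cb H) : H →ᵇ ℝ) x (F x) := rfl

end Spaces

section Semigroups

variable {H : Type*} [NormedAddCommGroup H] [InnerProductSpace ℝ H]

/-- `(S t)`, `t ≥ 0`, is a strongly continuous semigroup of bounded linear operators
(the values at `t < 0` are irrelevant). -/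
structure IsStronglyContinuousSemigroup (S : ℝ → H →L[ℝ] H) : Prop where
  zero : S 0 = ContinuousLinearMap.id ℝ H
  add : ∀ s t : ℝ, 0 ≤ s → 0 ≤ t → S (s + t) = (S s).comp (S t)
  continuousOn : ∀ x : H, ContinuousOn (fun t => S t x) (Ici 0)

/-- `A : D(A) ⊆ H → H` is the infinitesimal generator of `S`: `x ∈ D(A)` and `A x = y` if and only
if `(S t x - x) / t → y` as `t → 0⁺`. -/
def IsInfinitesimalGenerator (A : H →ₗ.[ℝ] H) (S : ℝ → H →L[ℝ] H) : Prop :=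
  ∀ x y : H, (x, y) ∈ A.graph ↔ Tendsto (fun t : ℝ => t⁻¹ • (S t x - x)) (𝓝[>] 0) (𝓝 y)

/-- `T : H → H` is a trace class operator: `T x = ∑ₙ ⟨aₙ, x⟩ bₙ` with `∑ₙ |aₙ| |bₙ| < ∞`
(such a `T` is automatically linear and bounded). -/
def IsTraceClass (T : H → H) : Prop :=
  ∃ a b : ℕ → H, Summable (fun n => ‖a n‖ * ‖b n‖) ∧
    ∀ x : H, HasSum (fun n => ⟪a n, x⟫ • b n) (T x)

/-- The operator `Q_t x = ∫₀ᵗ e^{sA} Q e^{sA*} x ds`, where `S s = e^{sA}`. -/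
noncomputable def covOp [CompleteSpace H] (S : ℝ → H →L[ℝ] H) (Q : H →L[ℝ] H) (t : ℝ) (x : H) : H :=
  ∫ s in (0 : ℝ)..t, S s (Q (ContinuousLinearMap.adjoint (S s) x))

end Semigroups

section OrnsteinUhlenbeck

variable {H : Type*} [NormedAddCommGroup H] [InnerProductSpace ℝ H] [CompleteSpace H]
  [MeasurableSpace H] [BorelSpace H]

/-- `μ` is a Gaussian measure on `H` with mean `0` and covariance operator `T`. -/
structure IsCenteredGaussian (μ : Measure H) (T : H → H) : Prop where
  isGaussian : IsGaussian μ
  mean_zero : ∫ y, y ∂μ = 0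
  covariance : ∀ h : H, covarianceOperator μ h = T h

open Classical in
/-- The Gaussian measure `N_T` of mean `0` and covariance operator `T` (it is unique, and it
exists when `T` is symmetric, nonnegative and of trace class; a Dirac mass if there is none). -/
noncomputable def gaussianMeasure (T : H → H) : Measure H :=
  if h : ∃ μ : Measure H, IsCenteredGaussian μ T then h.choose else Measure.dirac 0

theorem gaussianMeasure_spec {T : H → H} (h : ∃ μ : Measure H, IsCenteredGaussian μ T) :
    IsCenteredGaussian (gaussianMeasure T) T := by
  rw [gaussianMeasure, dif_pos h]
  exact h.choose_spec

instance (T : H → H) : IsProbabilityMeasure (gaussianMeasure T) := by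
  by_cases h : ∃ μ : Measure H, IsCenteredGaussian μ T
  · have := (gaussianMeasure_spec h).isGaussian
    infer_instance
  · rw [gaussianMeasure, dif_neg h]
    infer_instance

/-- The Ornstein-Uhlenbeck semigroup `R_t φ(x) = ∫ φ(e^{tA} x + y) N_{Q_t}(dy)`. -/
noncomputable def ouSemigroup (S : ℝ → H →L[ℝ] H) (Q : H →L[ℝ] H) (t : ℝ) (φ : Cb H) (x : H) : ℝ :=
  ∫ y, (φ : H →ᵇ ℝ) (S t x + y) ∂(gaussianMeasure (covOp S Q t))

theorem ouSemigroup_integrable (S : ℝ → H →L[ℝ] H) (Q : H →L[ℝ] H) (t : ℝ) (φ : Cb H) (x : H) :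
    Integrable (fun y => (φ : H →ᵇ ℝ) (S t x + y)) (gaussianMeasure (covOp S Q t)) :=
  (((φ : H →ᵇ ℝ).compContinuous ⟨fun y => S t x + y, by fun_prop⟩).integrable _)

theorem ouSemigroup_add (S : ℝ → H →L[ℝ] H) (Q : H →L[ℝ] H) (t : ℝ) (φ ψ : Cb H) (x : H) :
    ouSemigroup S Q t (φ + ψ) x = ouSemigroup S Q t φ x + ouSemigroup S Q t ψ x :=
  integral_add (ouSemigroup_integrable S Q t φ x) (ouSemigroup_integrable S Q t ψ x)

theorem ouSemigroup_smul (S : ℝ → H →L[ℝ] H) (Q : H →L[ℝ] H) (t c : ℝ) (φ : Cb H) (x : H) :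
    ouSemigroup S Q t (c • φ) x = c * ouSemigroup S Q t φ x :=
  integral_const_mul c _

/-- The graph of the infinitesimal generator `L` of the Ornstein-Uhlenbeck semigroup: the pairs
`(φ, g)` in `C_b(H)` such that `(R_t φ(x) - φ(x)) / t → g(x)` as `t → 0⁺` for every `x`, and
`sup_{t ∈ (0,1)} ‖(R_t φ - φ) / t‖ < ∞`. -/
def ouGraph (S : ℝ → H →L[ℝ] H) (Q : H →L[ℝ] H) : Submodule ℝ (Cb H × Cb H) where
  carrier := {p |
    (∀ x, Tendsto (fun t : ℝ => (ouSemigroup S Q t p.1 x - (p.1 : H →ᵇ ℝ) x) / t)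
      (𝓝[>] 0) (𝓝 ((p.2 : H →ᵇ ℝ) x))) ∧
    ∃ C : ℝ, ∀ t ∈ Ioo (0 : ℝ) 1, ∀ x,
      |(ouSemigroup S Q t p.1 x - (p.1 : H →ᵇ ℝ) x) / t| ≤ C}
  add_mem' := by
    rintro ⟨φ, g⟩ ⟨ψ, k⟩ ⟨h₁, C, hC⟩ ⟨h₂, D, hD⟩
    have key : ∀ t x, (ouSemigroup S Q t (φ + ψ) x - ((φ + ψ : Cb H) : H →ᵇ ℝ) x) / t =
        (ouSemigroup S Q t φ x - (φ : H →ᵇ ℝ) x) / t +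
          (ouSemigroup S Q t ψ x - (ψ : H →ᵇ ℝ) x) / t := by
      intro t x
      have e : ((φ + ψ : Cb H) : H →ᵇ ℝ) x = (φ : H →ᵇ ℝ) x + (ψ : H →ᵇ ℝ) x := rfl
      rw [ouSemigroup_add, e]
      ring
    refine ⟨fun x => ?_, C + D, fun t ht x => ?_⟩
    · exact ((h₁ x).add (h₂ x)).congr fun t => (key t x).symm
    · refine (congrArg abs (key t x)).trans_le ?_
      exact (abs_add_le _ _).trans (add_le_add (hC t ht x) (hD t ht x))
  zero_mem' := by
    have key : ∀ t x, (ouSemigroup S Q t 0 x - ((0 : Cb H) : H →ᵇ ℝ) x) / t = 0 := by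
      intro t x
      simp [ouSemigroup]
    refine ⟨fun x => ?_, 0, fun t _ x => ?_⟩
    · exact tendsto_const_nhds.congr fun t => (key t x).symm
    · exact (congrArg abs (key t x)).trans_le (by simp)
  smul_mem' := by
    rintro c ⟨φ, g⟩ ⟨h₁, C, hC⟩
    have key : ∀ t x, (ouSemigroup S Q t (c • φ) x - ((c • φ : Cb H) : H →ᵇ ℝ) x) / t =
        c * ((ouSemigroup S Q t φ x - (φ : H →ᵇ ℝ) x) / t) := by
      intro t x
      have e : ((c • φ : Cb H) : H →ᵇ ℝ) x = c * (φ : H →ᵇ ℝ) x := rfl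
      rw [ouSemigroup_smul, e]
      ring
    refine ⟨fun x => ?_, |c| * C, fun t ht x => ?_⟩
    · exact ((h₁ x).const_mul c).congr fun t => (key t x).symm
    · refine (congrArg abs (key t x)).trans_le ?_
      rw [abs_mul]
      exact mul_le_mul_of_nonneg_left (hC t ht x) (abs_nonneg c)

/-- The infinitesimal generator `L : D(L) ⊆ C_b(H) → C_b(H)` of the Ornstein-Uhlenbeck
semigroup. -/
noncomputable def ouGenerator (S : ℝ → H →L[ℝ] H) (Q : H →L[ℝ] H) : Cb H →ₗ.[ℝ] Cb H :=
  (ouGraph S Q).toLinearPMap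

theorem ouGenerator_graph (S : ℝ → H →L[ℝ] H) (Q : H →L[ℝ] H) :
    (ouGenerator S Q).graph = ouGraph S Q := by
  refine Submodule.toLinearPMap_graph_eq _ ?_
  rintro ⟨φ, g⟩ ⟨h, -⟩ (rfl : φ = 0)
  ext x
  refine tendsto_nhds_unique (h x) (tendsto_const_nhds.congr fun t => ?_)
  simp [ouSemigroup]

/-- `N₀ φ = L φ + ⟨Dφ, F⟩` with domain `D(L) ∩ C_b^1(H)`. (The sum of two partially defined
linear operators has the intersection of the domains as its domain.) -/
noncomputable def N₀ (S : ℝ → H →L[ℝ] H) (Q : H →L[ℝ] H) (F : H → H) (hF : IsCbOneField F) :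
    Cb H →ₗ.[ℝ] Cb H :=
  ouGenerator S Q + drift F hF

end OrnsteinUhlenbeck

section Dissipative

variable {E : Type*} [NormedAddCommGroup E] [NormedSpace ℝ E]

/-- `B : D(B) ⊆ E → E` is dissipative: `‖l u - B u‖ ≥ l ‖u‖` for all `l > 0` and `u ∈ D(B)`. -/
def IsDissipative (B : E →ₗ.[ℝ] E) : Prop :=
  ∀ l : ℝ, 0 < l → ∀ u : B.domain, l * ‖(u : E)‖ ≤ ‖l • (u : E) - B u‖

/-- `B` is m-dissipative: it is dissipative and `l - B` maps `D(B)` onto `E` for all `l > 0`. -/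
def IsMDissipative (B : E →ₗ.[ℝ] E) : Prop :=
  IsDissipative B ∧
    ∀ l : ℝ, 0 < l → Function.Surjective fun u : B.domain => l • (u : E) - B u

end Dissipative

end OUPerturbation

/-!
# m-dissipativity of a perturbed Ornstein-Uhlenbeck operator

The operator `N₀ = L + ⟨D·, F⟩` is dissipative because, on `D(L) ∩ C_b^1(H)`, it is the strong limit
(in the supremum norm) of the operators `L + (T_h - 1) / h`, where `T_h φ(x) = φ(x + h F(x))` is an Euler step along `F`; the
operator `L` is dissipative by differentiating `t ↦ e^{-λt} R_t φ(x)`, and `T_h` is a contraction of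
`C_b(H)` (`IsGeneratorValue.le`, `IsGeneratorValue.le_perturbed`).

For the range condition one solves `λφ - Lφ - (T_h φ - φ) / h = f` with `f ∈ C_b^1(H)` approximately, by
iterating the contraction `φ ↦ (λ + 1/h - L)⁻¹ (f + T_h φ / h)`. The point is that, for `λ` larger than
a constant that depends only on `ω` and `sup ‖DF‖`, the iterates satisfy `C_b^1` bounds independent of
`h`: a bound on the differential and a modulus of continuity of the differential. The modulus is what
makes the replacement of `(T_h φ - φ) / h` by `⟨Dφ, F⟩` uniform. Moduli are encoded by affine families
`r ↦ C (ε + K(ε) r)`, `ε > 0` (`HasCOneBound`): composition with Lipschitz maps and integration only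
change the constant `C`. The resolvent of `L` on `C_b^1(H)` is the Laplace transform of `R_t`, for which
the same bounds are obtained by differentiating under the integral sign
(`IsMehlerFamily.exists_resolvent`). As `C_b^1(H)` is dense in `C_b(H)` by Lasry-Lions regularization
(`exists_cbOne_close`), the range of `λ - N₀` is dense for one `λ`, hence the closure is m-dissipative,
and then the range is dense for all `λ > 0` (`IsDissipative.isMDissipative_closure`).

Closability is not automatic, since `D(N₀)` need not be dense in the supremum norm. If `φₙ → 0` and
`N₀ φₙ → g`, dissipativity shows that solutions of `λφ - N₀ φ ≈ f`, `f ∈ C_b^1(H)` close to `g`, have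
`λ ‖φ‖` small. The bound on `Dφ` is of order `1 / λ`, so that `λφ` is close to `λ (λ - L)⁻¹ f`, which
tends pointwise to `f` as `λ → ∞`. Thus `f` and `g` are small (`IsMehlerFamily.isClosable_N₀`).

All that is used of the Ornstein-Uhlenbeck semigroup is collected in `IsMehlerFamily`: the flow
identity `N_{Q_{s+t}} = N_{Q_s} ∗ e^{sA} N_{Q_t}`, which gives the semigroup law, and the convergence of
the second moments of `N_{Q_t}` to `0`, which gives continuity in time. They are deduced from the
existence of Gaussian measures with symmetric nonnegative covariance operator of trace class
(`exists_isCenteredGaussian`), constructed as the law of a random series, from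
`Q_{s+t} = Q_s + e^{sA} Q_t e^{sA*}`, and from the convergence of the traces.
-/

set_option linter.unusedSectionVars false

namespace OUPerturbation

/-! ### Density of `C_b^1(H)` in `C_b(H)` by inf-sup-convolution -/

section QuadraticDefect

variable {E : Type*} [NormedAddCommGroup E] [NormedSpace ℝ E]

/-- A real function that is simultaneously semiconvex and semiconcave with constant `C`: along
segments it deviates from its chord by at most `C t (1 - t) ‖x - y‖²`. -/
def HasQuadraticDefect (u : E → ℝ) (C : ℝ) : Prop :=
  ∀ x y : E, ∀ t ∈ Icc (0 : ℝ) 1,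
    |u ((1 - t) • x + t • y) - ((1 - t) * u x + t * u y)| ≤ C * (t * (1 - t)) * ‖x - y‖ ^ 2

theorem HasQuadraticDefect.chord {u : E → ℝ} {C : ℝ} (hC : 0 ≤ C) (hu : HasQuadraticDefect u C)
    (x h : E) {s : ℝ} (hs : s ∈ Icc (0 : ℝ) 1) :
    |u (x + s • h) - u x - s * (u (x + h) - u x)| ≤ C * s * ‖h‖ ^ 2 := by
  have := hu x (x + h) s hs
  have e : (1 - s) • x + s • (x + h) = x + s • h := by module
  have e2 : x - (x + h) = -h := by abel
  rw [e, e2, norm_neg] at this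
  calc _ = |u (x + s • h) - ((1 - s) * u x + s * u (x + h))| := by congr 1; ring
    _ ≤ C * (s * (1 - s)) * ‖h‖ ^ 2 := this
    _ ≤ C * s * ‖h‖ ^ 2 := by
      have : 0 ≤ C * s * s * ‖h‖ ^ 2 := by have := hs.1; positivity
      nlinarith

theorem HasQuadraticDefect.lipschitz_unit {u : E → ℝ} {B C : ℝ} (hC : 0 ≤ C)
    (hB : ∀ x, |u x| ≤ B) (hu : HasQuadraticDefect u C) (x h : E) (hh : ‖h‖ ≤ 1) :
    |u (x + h) - u x| ≤ (2 * B + C) * ‖h‖ := by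
  rcases eq_or_ne h 0 with rfl | h0
  · simp
  have hn : 0 < ‖h‖ := norm_pos_iff.2 h0
  have key := hu.chord hC x (‖h‖⁻¹ • h) (s := ‖h‖) ⟨hn.le, hh⟩
  rw [smul_smul, mul_inv_cancel₀ hn.ne', one_smul, norm_smul, norm_inv, norm_norm,
    inv_mul_cancel₀ hn.ne'] at key
  have a1 := abs_le.1 (hB (x + ‖h‖⁻¹ • h))
  have a2 := abs_le.1 (hB x)
  rw [abs_le] at key ⊢
  constructor <;> nlinarith

/-- The differential is the limit of the dyadic difference quotients, and the chord inequality
survives in the limit as a second order Taylor bound. -/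
theorem HasQuadraticDefect.exists_differential {u : E → ℝ} {B C : ℝ} (hC : 0 ≤ C)
    (hB : ∀ x, |u x| ≤ B) (hu : HasQuadraticDefect u C) (x : E) :
    ∃ D : E →L[ℝ] ℝ, ∀ h, |u (x + h) - u x - D h| ≤ C * ‖h‖ ^ 2 := by
  let q : ℕ → E → ℝ := fun n h => 2 ^ n * (u (x + ((2 : ℝ) ^ n)⁻¹ • h) - u x)
  have hq : ∀ (n m : ℕ) (h : E), |q (n + m) h - q n h| ≤ C * ‖h‖ ^ 2 * ((2 : ℝ) ^ n)⁻¹ := by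
    intro n m h
    have hm : (1 : ℝ) ≤ 2 ^ m := one_le_pow₀ (by norm_num)
    have key := hu.chord hC x (((2 : ℝ) ^ n)⁻¹ • h) (s := ((2 : ℝ) ^ m)⁻¹)
      ⟨by positivity, inv_le_one_of_one_le₀ hm⟩
    have e : ((2 : ℝ) ^ m)⁻¹ • ((2 : ℝ) ^ n)⁻¹ • h = ((2 : ℝ) ^ (n + m))⁻¹ • h := by
      rw [smul_smul, pow_add, mul_inv_rev]
    rw [e, norm_smul, Real.norm_of_nonneg (by positivity)] at key
    have e3 : q (n + m) h - q n h = 2 ^ (n + m) * (u (x + ((2 : ℝ) ^ (n + m))⁻¹ • h) - u x -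
        ((2 : ℝ) ^ m)⁻¹ * (u (x + ((2 : ℝ) ^ n)⁻¹ • h) - u x)) := by
      simp only [q, pow_add]
      field_simp
    rw [e3, abs_mul, abs_of_pos (by positivity)]
    refine (mul_le_mul_of_nonneg_left key (by positivity)).trans (le_of_eq ?_)
    rw [pow_add]
    field_simp
  have hcau : ∀ h, CauchySeq fun n => q n h := by
    intro h
    refine cauchySeq_of_le_geometric (1 / 2) (C * ‖h‖ ^ 2) (by norm_num) fun n => ?_
    rw [dist_comm, Real.dist_eq, one_div, inv_pow]
    exact hq n 1 h
  choose d hd using fun h => cauchySeq_tendsto_of_complete (hcau h)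
  have htaylor : ∀ h, |u (x + h) - u x - d h| ≤ C * ‖h‖ ^ 2 := by
    intro h
    have h0 : ∀ n, |q n h - (u (x + h) - u x)| ≤ C * ‖h‖ ^ 2 := by
      intro n
      have := hq 0 n h
      simpa [q] using this
    have := le_of_tendsto ((hd h).sub_const _).abs (Eventually.of_forall h0)
    rwa [abs_sub_comm] at this
  have htwo : ∀ h, d ((2 : ℝ) • h) = 2 * d h := by
    intro h
    refine tendsto_nhds_unique ((tendsto_add_atTop_iff_nat 1).2 (hd ((2 : ℝ) • h))) ?_
    refine ((hd h).const_mul 2).congr fun n => ?_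
    have e : ((2 : ℝ) ^ (n + 1))⁻¹ • (2 : ℝ) • h = ((2 : ℝ) ^ n)⁻¹ • h := by
      rw [smul_smul, pow_succ]
      congr 1
      field_simp
    simp only [q, e]
    ring
  have hadd : ∀ h k, d (h + k) = d h + d k := by
    intro h k
    have hz : Tendsto (fun n => q n (h + k) - (q n ((2 : ℝ) • h) + q n ((2 : ℝ) • k)) / 2)
        atTop (𝓝 0) := by
      have hlim : Tendsto (fun n : ℕ => C * ‖h - k‖ ^ 2 * ((2 : ℝ) ^ n)⁻¹) atTop (𝓝 0) := by
        have := (tendsto_pow_atTop_nhds_zero_of_lt_one (r := (1 / 2 : ℝ)) (by norm_num)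
          (by norm_num)).const_mul (C * ‖h - k‖ ^ 2)
        simpa [inv_pow] using this
      refine squeeze_zero_norm (fun n => ?_) hlim
      have key := hu (x + ((2 : ℝ) ^ n)⁻¹ • (2 : ℝ) • h) (x + ((2 : ℝ) ^ n)⁻¹ • (2 : ℝ) • k)
        (1 / 2) ⟨by norm_num, by norm_num⟩
      have e1 : (1 - 1 / 2 : ℝ) • (x + ((2 : ℝ) ^ n)⁻¹ • (2 : ℝ) • h) +
          (1 / 2 : ℝ) • (x + ((2 : ℝ) ^ n)⁻¹ • (2 : ℝ) • k) = x + ((2 : ℝ) ^ n)⁻¹ • (h + k) := by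
        module
      have e2 : x + ((2 : ℝ) ^ n)⁻¹ • (2 : ℝ) • h - (x + ((2 : ℝ) ^ n)⁻¹ • (2 : ℝ) • k) =
          (((2 : ℝ) ^ n)⁻¹ * 2) • (h - k) := by
        module
      rw [e1, e2, norm_smul, Real.norm_of_nonneg (by positivity)] at key
      have e3 : q n (h + k) - (q n ((2 : ℝ) • h) + q n ((2 : ℝ) • k)) / 2 =
          2 ^ n * (u (x + ((2 : ℝ) ^ n)⁻¹ • (h + k)) -
            ((1 - 1 / 2) * u (x + ((2 : ℝ) ^ n)⁻¹ • (2 : ℝ) • h) +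
              1 / 2 * u (x + ((2 : ℝ) ^ n)⁻¹ • (2 : ℝ) • k))) := by
        simp only [q]
        ring
      rw [e3, Real.norm_eq_abs, abs_mul, abs_of_pos (by positivity)]
      refine (mul_le_mul_of_nonneg_left key (by positivity)).trans (le_of_eq ?_)
      field_simp
      ring
    have hl := (hd (h + k)).sub (((hd ((2 : ℝ) • h)).add (hd ((2 : ℝ) • k))).div_const 2)
    have := tendsto_nhds_unique hl hz
    rw [htwo, htwo] at this
    linarith
  let D₀ : E →+ ℝ := AddMonoidHom.mk' d hadd
  have hcont : Continuous D₀ := by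
    refine continuous_of_continuousAt_zero D₀ ?_
    rw [ContinuousAt, map_zero]
    have hlim : Tendsto (fun h : E => (2 * B + C) * ‖h‖ + C * ‖h‖ ^ 2) (𝓝 0) (𝓝 0) := by
      have : Continuous fun h : E => (2 * B + C) * ‖h‖ + C * ‖h‖ ^ 2 := by fun_prop
      simpa using this.tendsto 0
    refine squeeze_zero_norm' ?_ hlim
    filter_upwards [Metric.ball_mem_nhds (0 : E) one_pos] with h hh
    have h1 := hu.lipschitz_unit hC hB x h (by simpa using (mem_ball_zero_iff.1 hh).le)
    have h2 := htaylor h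
    change |d h| ≤ _
    rw [abs_le] at h1 h2 ⊢
    constructor <;> linarith
  exact ⟨D₀.toRealLinearMap hcont, htaylor⟩

/-- A bounded function with quadratic defect is of class `C^{1,1}`. -/
theorem HasQuadraticDefect.differentiable {u : E → ℝ} {B C : ℝ} (hC : 0 ≤ C)
    (hB : ∀ x, |u x| ≤ B) (hu : HasQuadraticDefect u C) :
    Differentiable ℝ u ∧ (∀ x, ‖fderiv ℝ u x‖ ≤ 2 * B + C) ∧
      ∀ x y, ‖fderiv ℝ u x - fderiv ℝ u y‖ ≤ 6 * C * ‖x - y‖ := by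
  have hB0 : 0 ≤ B := (abs_nonneg _).trans (hB 0)
  choose D hD using hu.exists_differential hC hB
  have hder : ∀ x, HasFDerivAt u (D x) x := by
    intro x
    rw [hasFDerivAt_iff_isLittleO_nhds_zero]
    have h1 : (fun h => u (x + h) - u x - D x h) =O[𝓝 0] fun h : E => ‖h‖ ^ 2 := by
      refine Asymptotics.IsBigO.of_bound C (Eventually.of_forall fun h => ?_)
      rw [Real.norm_eq_abs, Real.norm_of_nonneg (by positivity)]
      exact hD x h
    refine h1.trans_isLittleO ?_
    simpa using Asymptotics.isLittleO_norm_pow_id (E' := E) (n := 2) (by norm_num)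
  have hf : fderiv ℝ u = D := funext fun x => (hder x).fderiv
  refine ⟨fun x => (hder x).differentiableAt, fun x => ?_, fun x y => ?_⟩
  · rw [hf]
    refine ContinuousLinearMap.opNorm_le_of_unit_norm (by positivity) fun h hh => ?_
    have h2 := hD x h
    have h3 := abs_le.1 (hB (x + h))
    have h4 := abs_le.1 (hB x)
    rw [hh] at h2
    rw [Real.norm_eq_abs]
    rw [abs_le] at h2 ⊢
    constructor <;> nlinarith
  · rw [hf]
    rcases eq_or_ne x y with rfl | hxy
    · simp
    set r := ‖x - y‖ with hr
    have hr0 : 0 < r := norm_pos_iff.2 (sub_ne_zero.2 hxy)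
    refine ContinuousLinearMap.opNorm_le_of_unit_norm (by positivity) fun h hh => ?_
    -- the Taylor bounds at `x` and `y` are compared on an increment of length `‖x - y‖`
    have n1 : ‖y - x‖ = r := by rw [norm_sub_rev]
    have n2 : ‖r • h‖ = r := by rw [norm_smul, hh, Real.norm_of_nonneg hr0.le, mul_one]
    have n3 : ‖y - x + r • h‖ ≤ 2 * r := (norm_add_le _ _).trans (by rw [n1, n2]; linarith)
    have t1 := hD x (y - x + r • h)
    have t2 := hD x (y - x)
    have t3 := hD y (r • h)
    rw [show x + (y - x + r • h) = y + r • h by abel, map_add] at t1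
    rw [show x + (y - x) = y by abel, n1] at t2
    rw [n2] at t3
    have t1' : C * ‖y - x + r • h‖ ^ 2 ≤ C * (2 * r) ^ 2 := by gcongr
    have hb : |D x (r • h) - D y (r • h)| ≤ 6 * C * r * r := by
      rw [abs_le] at t1 t2 t3 ⊢
      constructor <;> nlinarith
    rw [map_smul, map_smul, smul_eq_mul, smul_eq_mul, ← mul_sub, abs_mul, abs_of_pos hr0] at hb
    rw [sub_apply, Real.norm_eq_abs]
    nlinarith

end QuadraticDefect

section Cb

variable {H : Type*} [NormedAddCommGroup H]

theorem exists_quadratic_modulus {f : H → ℝ} {B : ℝ} (hB : ∀ x, |f x| ≤ B)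
    (hf : UniformContinuous f) {ε : ℝ} (hε : 0 < ε) :
    ∃ K, 0 ≤ K ∧ ∀ x z, |f x - f z| ≤ ε + K * ‖x - z‖ ^ 2 := by
  have hB0 : 0 ≤ B := (abs_nonneg _).trans (hB 0)
  obtain ⟨δ, hδ, hfδ⟩ := Metric.uniformContinuous_iff.1 hf ε hε
  have hKδ : 2 * B / δ ^ 2 * δ ^ 2 = 2 * B := by field_simp
  set K := 2 * B / δ ^ 2
  have hK : 0 ≤ K := by positivity
  refine ⟨K, hK, fun x z => ?_⟩
  have h0 : 0 ≤ K * ‖x - z‖ ^ 2 := by positivity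
  rcases lt_or_ge ‖x - z‖ δ with h | h
  · have := hfδ (a := x) (b := z) (by rwa [dist_eq_norm])
    rw [Real.dist_eq] at this
    linarith
  · have h1 : K * δ ^ 2 ≤ K * ‖x - z‖ ^ 2 := by gcongr
    have h2 := abs_sub (f x) (f z)
    linarith [hB x, hB z]

theorem abs_apply_le_norm (φ : Cb H) (x : H) : |(φ : H →ᵇ ℝ) x| ≤ ‖φ‖ :=
  (φ : H →ᵇ ℝ).norm_coe_le_norm x

theorem norm_le_of_forall_abs_le {φ : Cb H} {C : ℝ} (hC : 0 ≤ C)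
    (h : ∀ x, |(φ : H →ᵇ ℝ) x| ≤ C) : ‖φ‖ ≤ C :=
  (BoundedContinuousFunction.norm_le hC).2 h

/-- An element of `C_b(H)` from a uniformly continuous function with an explicit bound. -/
noncomputable def Cb.mk (u : H → ℝ) (hu : UniformContinuous u) (C : ℝ) (hC : ∀ x, |u x| ≤ C) :
    Cb H :=
  ⟨BoundedContinuousFunction.ofNormedAddCommGroup u hu.continuous C hC, hu⟩

end Cb

section LasryLions

variable {H : Type*} [NormedAddCommGroup H] [InnerProductSpace ℝ H]

theorem norm_sq_convex_combination (a b : H) (t : ℝ) :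
    ‖(1 - t) • a + t • b‖ ^ 2 =
      (1 - t) * ‖a‖ ^ 2 + t * ‖b‖ ^ 2 - t * (1 - t) * ‖a - b‖ ^ 2 := by
  rw [norm_add_sq_real, norm_sub_sq_real, norm_smul, norm_smul, inner_smul_left, inner_smul_right,
    mul_pow, mul_pow, Real.norm_eq_abs, Real.norm_eq_abs, sq_abs, sq_abs]
  simp
  ring

/-- The inf-convolution `x ↦ inf_z (f z + K ‖x - z‖²)`. -/
noncomputable def infConv (f : H → ℝ) (K : ℝ) (x : H) : ℝ := ⨅ z, (f z + K * ‖x - z‖ ^ 2)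

/-- The Lasry–Lions regularization: the inf-convolution with parameter `K` followed by the
sup-convolution with parameter `2K`. -/
noncomputable def lasryLions (f : H → ℝ) (K : ℝ) (x : H) : ℝ :=
  ⨆ z, (infConv f K z - 2 * K * ‖x - z‖ ^ 2)

variable {f : H → ℝ} {B K : ℝ}

theorem infConv_bddBelow (hB : ∀ x, |f x| ≤ B) (hK : 0 ≤ K) (x : H) :
    BddBelow (range fun z => f z + K * ‖x - z‖ ^ 2) := by
  refine ⟨-B, ?_⟩
  rintro _ ⟨z, rfl⟩
  have := (abs_le.1 (hB z)).1
  have : 0 ≤ K * ‖x - z‖ ^ 2 := by positivity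
  simp only
  linarith

theorem infConv_le (hB : ∀ x, |f x| ≤ B) (hK : 0 ≤ K) (x z : H) :
    infConv f K x ≤ f z + K * ‖x - z‖ ^ 2 :=
  ciInf_le (infConv_bddBelow hB hK x) z

theorem infConv_le_self (hB : ∀ x, |f x| ≤ B) (hK : 0 ≤ K) (x : H) : infConv f K x ≤ f x := by
  simpa using infConv_le hB hK x x

theorem infConv_semiconcave (hB : ∀ x, |f x| ≤ B) (hK : 0 ≤ K) (x y : H) {t : ℝ}
    (ht : t ∈ Icc (0 : ℝ) 1) :
    (1 - t) * infConv f K x + t * infConv f K y - K * (t * (1 - t)) * ‖x - y‖ ^ 2 ≤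
      infConv f K ((1 - t) • x + t • y) := by
  refine le_ciInf fun z => ?_
  have e : (1 - t) • x + t • y - z = (1 - t) • (x - z) + t • (y - z) := by module
  rw [e, norm_sq_convex_combination, show x - z - (y - z) = x - y by abel]
  have h1 := mul_le_mul_of_nonneg_left (infConv_le hB hK x z) (sub_nonneg.2 ht.2)
  have h2 := mul_le_mul_of_nonneg_left (infConv_le hB hK y z) ht.1
  linarith

theorem lasryLions_bddAbove (hB : ∀ x, |f x| ≤ B) (hK : 0 ≤ K) (x : H) :
    BddAbove (range fun z => infConv f K z - 2 * K * ‖x - z‖ ^ 2) := by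
  refine ⟨B, ?_⟩
  rintro _ ⟨z, rfl⟩
  have h1 := (abs_le.1 (hB z)).2
  have h2 := infConv_le_self hB hK z
  have : 0 ≤ 2 * K * ‖x - z‖ ^ 2 := by positivity
  simp only
  linarith

theorem le_lasryLions (hB : ∀ x, |f x| ≤ B) (hK : 0 ≤ K) (x z : H) :
    infConv f K z - 2 * K * ‖x - z‖ ^ 2 ≤ lasryLions f K x :=
  le_ciSup (lasryLions_bddAbove hB hK x) z

theorem lasryLions_hasQuadraticDefect (hB : ∀ x, |f x| ≤ B) (hK : 0 ≤ K) :
    HasQuadraticDefect (lasryLions f K) (2 * K) := by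
  intro x y t ht
  have ht1 : 0 ≤ 1 - t := sub_nonneg.2 ht.2
  have ht0 := ht.1
  have hupper : lasryLions f K ((1 - t) • x + t • y) ≤ (1 - t) * lasryLions f K x +
      t * lasryLions f K y + 2 * K * (t * (1 - t)) * ‖x - y‖ ^ 2 := by
    refine ciSup_le fun z => ?_
    have e : (1 - t) • x + t • y - z = (1 - t) • (x - z) + t • (y - z) := by module
    rw [e, norm_sq_convex_combination, show x - z - (y - z) = x - y by abel]
    have h1 := mul_le_mul_of_nonneg_left (le_lasryLions hB hK x z) ht1
    have h2 := mul_le_mul_of_nonneg_left (le_lasryLions hB hK y z) ht.1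
    linarith
  have hlower : (1 - t) * lasryLions f K x + t * lasryLions f K y ≤
      lasryLions f K ((1 - t) • x + t • y) + 2 * K * (t * (1 - t)) * ‖x - y‖ ^ 2 := by
    refine le_of_forall_pos_le_add fun ε hε => ?_
    obtain ⟨z₁, h₁⟩ := exists_lt_of_lt_ciSup (sub_lt_self (lasryLions f K x) hε)
    obtain ⟨z₂, h₂⟩ := exists_lt_of_lt_ciSup (sub_lt_self (lasryLions f K y) hε)
    have hw := le_lasryLions hB hK ((1 - t) • x + t • y) ((1 - t) • z₁ + t • z₂)
    have hv := infConv_semiconcave hB hK z₁ z₂ ht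
    have e : (1 - t) • x + t • y - ((1 - t) • z₁ + t • z₂) =
        (1 - t) • (x - z₁) + t • (y - z₂) := by module
    rw [e, norm_sq_convex_combination] at hw
    have e2 : x - z₁ - (y - z₂) = (x - y) - (z₁ - z₂) := by abel
    rw [e2] at hw
    -- `2 ‖p - q‖² - ‖q‖² + 2 ‖p‖² = ‖q - 2 p‖² ≥ 0`, where the factor 2 of the sup-convolution enters
    have hsq : 0 ≤ 2 * ‖(x - y) - (z₁ - z₂)‖ ^ 2 - ‖z₁ - z₂‖ ^ 2 + 2 * ‖x - y‖ ^ 2 := by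
      have h0 := sq_nonneg ‖(z₁ - z₂) - (2 : ℝ) • (x - y)‖
      rw [norm_sub_sq_real, norm_smul, inner_smul_right, real_inner_comm] at h0
      rw [norm_sub_sq_real]
      norm_num at h0
      nlinarith
    have hsq' := mul_nonneg (mul_nonneg hK (mul_nonneg ht0 ht1)) hsq
    have m₁ := mul_le_mul_of_nonneg_left h₁.le ht1
    have m₂ := mul_le_mul_of_nonneg_left h₂.le ht0
    nlinarith
  rw [abs_le]
  constructor <;> linarith

/-- The Lasry–Lions regularizations of a bounded uniformly continuous function converge to it
uniformly. -/
theorem exists_lasryLions_close (hB : ∀ x, |f x| ≤ B) (hf : UniformContinuous f) {ε : ℝ}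
    (hε : 0 < ε) : ∃ K, 0 ≤ K ∧ ∀ x, |lasryLions f K x - f x| ≤ ε := by
  obtain ⟨K, hK, key⟩ := exists_quadratic_modulus hB hf hε
  refine ⟨K, hK, fun x => ?_⟩
  have hlow : f x - ε ≤ infConv f K x := le_ciInf fun z => by
    have := (abs_le.1 (key x z)).2
    linarith
  have hlow' := le_lasryLions hB hK x x
  have hup : lasryLions f K x ≤ f x + ε := ciSup_le fun z => by
    have h1 := infConv_le_self hB hK z
    have h2 := (abs_le.1 (key x z)).1
    have h3 : 0 ≤ K * ‖x - z‖ ^ 2 := by positivity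
    linarith
  simp only [sub_self, norm_zero] at hlow'
  rw [abs_le]
  constructor <;> linarith

theorem uniformContinuous_of_fderiv_bound {u : H → ℝ} (hu : Differentiable ℝ u) {C : ℝ}
    (hC : ∀ x, ‖fderiv ℝ u x‖ ≤ C) : UniformContinuous u := by
  have hC0 : 0 ≤ C := (norm_nonneg _).trans (hC 0)
  have : LipschitzWith ⟨C, hC0⟩ u := lipschitzWith_of_nnnorm_fderiv_le hu fun x => hC x
  exact this.uniformContinuous

/-- `C_b^1(H)` is dense in `C_b(H)`. -/
theorem exists_cbOne_close (φ : Cb H) {ε : ℝ} (hε : 0 < ε) : ∃ ψ ∈ CbOne H, ‖ψ - φ‖ ≤ ε := by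
  obtain ⟨K, hK, hclose⟩ := exists_lasryLions_close (abs_apply_le_norm φ) φ.2 hε
  set w : H → ℝ := lasryLions (φ : H →ᵇ ℝ) K
  have hbd : ∀ x, |w x| ≤ ‖φ‖ + ε := fun x => by
    have h1 := abs_apply_le_norm φ x
    have h2 := hclose x
    rw [abs_le] at h1 h2 ⊢
    constructor <;> linarith
  obtain ⟨h1, h2, h3⟩ := (lasryLions_hasQuadraticDefect (abs_apply_le_norm φ) hK).differentiable
    (by positivity) hbd
  have hlip : LipschitzWith ⟨6 * (2 * K), by positivity⟩ (fderiv ℝ w) :=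
    LipschitzWith.of_dist_le_mul fun x y => by
      rw [dist_eq_norm, dist_eq_norm]
      exact h3 x y
  exact ⟨Cb.mk w (uniformContinuous_of_fderiv_bound h1 h2) _ hbd,
    ⟨h1, hlip.uniformContinuous, _, h2⟩, norm_le_of_forall_abs_le hε.le hclose⟩

end LasryLions

/-! ### Dissipative operators -/

section DissipativeLemmas

variable {E : Type*} [NormedAddCommGroup E] [NormedSpace ℝ E] {B : E →ₗ.[ℝ] E}

theorem IsDissipative.le_of_mem_graph (hB : IsDissipative B) {l : ℝ} (hl : 0 < l) {u v : E}
    (h : (u, v) ∈ B.graph) : l * ‖u‖ ≤ ‖l • u - v‖ := by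
  obtain ⟨y, rfl, rfl⟩ := (LinearPMap.mem_graph_iff _).1 h
  exact hB l hl y

theorem IsDissipative.norm_sub_le (hB : IsDissipative B) {l : ℝ} (hl : 0 < l) (u v : B.domain) :
    ‖(u : E) - v‖ ≤ l⁻¹ * ‖(l • (u : E) - B u) - (l • (v : E) - B v)‖ := by
  have := hB l hl (u - v)
  rw [LinearPMap.map_sub, Submodule.coe_sub, smul_sub, sub_sub_sub_comm] at this
  rwa [inv_mul_eq_div, le_div_iff₀' hl]

/-- Closability in terms of sequences of the graph converging to `(0, g)`. -/
theorem isClosable_of_forall_closure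
    (h : ∀ g : E, ((0 : E), g) ∈ B.graph.topologicalClosure → g = 0) : B.IsClosable := by
  refine ⟨B.graph.topologicalClosure.toLinearPMap, ?_⟩
  rw [Submodule.toLinearPMap_graph_eq]
  rintro ⟨u, g⟩ hx (rfl : u = 0)
  exact h g hx

theorem IsDissipative.le_of_mem_closure_graph (hB : IsDissipative B) {l : ℝ} (hl : 0 < l) {u v : E}
    (h : (u, v) ∈ B.graph.topologicalClosure) : l * ‖u‖ ≤ ‖l • u - v‖ := by
  have hcl : IsClosed {p : E × E | l * ‖p.1‖ ≤ ‖l • p.1 - p.2‖} :=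
    isClosed_le (by fun_prop) (by fun_prop)
  exact closure_minimal (fun p hp => hB.le_of_mem_graph hl hp) hcl h

/-- If `(0, g)` is a limit of elements of the graph, then a solution `u` of `l u - B u ≈ g` is
small. -/
theorem IsDissipative.mul_norm_le_of_zero_mem_closure (hB : IsDissipative B) {l : ℝ} (hl : 0 < l)
    {u v f g : E} (huv : (u, v) ∈ B.graph) (hg : ((0 : E), g) ∈ B.graph.topologicalClosure) :
    l * ‖u‖ ≤ ‖l • u - v - f‖ + ‖f - g‖ := by
  have h := hB.le_of_mem_closure_graph hl
    (Submodule.add_mem _ (Submodule.le_topologicalClosure _ huv) hg)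
  rw [add_zero, ← sub_sub, ← sub_add_sub_cancel (l • u - v) f g] at h
  exact h.trans (norm_add_le _ _)

theorem dense_range_of_forall_approx {l : ℝ}
    (h : ∀ g : E, ∀ ε > 0, ∃ u v, (u, v) ∈ B.graph ∧ ‖l • u - v - g‖ < ε) :
    Dense (range fun u : B.domain => l • (u : E) - B u) := by
  refine fun g => Metric.mem_closure_iff.2 fun ε hε => ?_
  obtain ⟨u, v, huv, he⟩ := h g ε hε
  obtain ⟨y, rfl, rfl⟩ := (LinearPMap.mem_graph_iff _).1 huv
  exact ⟨_, mem_range_self y, by rwa [dist_comm, dist_eq_norm]⟩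

theorem IsDissipative.closure (hB : IsDissipative B) (hc : B.IsClosable) :
    IsDissipative B.closure := by
  intro l hl u
  have hmem := B.closure.mem_graph u
  rw [← hc.graph_closure_eq_closure_graph] at hmem
  exact hB.le_of_mem_closure_graph hl hmem

/-- For a dissipative operator with closed graph in a Banach space, a dense range of `l - B` is the
whole space. -/
theorem IsDissipative.surjective_of_dense [CompleteSpace E] (hB : IsDissipative B)
    (hcl : B.IsClosed) {l : ℝ} (hl : 0 < l)
    (hd : Dense (range fun u : B.domain => l • (u : E) - B u)) :
    Function.Surjective fun u : B.domain => l • (u : E) - B u := by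
  intro f
  obtain ⟨w, hw, hlim⟩ := mem_closure_iff_seq_limit.1 (hd f)
  choose u hu using hw
  have hlip : ∀ m n, dist (u m : E) (u n) ≤ l⁻¹ * dist (w m) (w n) := by
    intro m n
    rw [dist_eq_norm, dist_eq_norm, ← hu m, ← hu n]
    exact hB.norm_sub_le hl _ _
  have hcau : CauchySeq fun n => (u n : E) := by
    have hwc := hlim.cauchySeq
    rw [Metric.cauchySeq_iff] at hwc ⊢
    intro ε hε
    obtain ⟨N, hN⟩ := hwc (l * ε) (by positivity)
    refine ⟨N, fun m hm n hn => (hlip m n).trans_lt ?_⟩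
    have := hN m hm n hn
    rwa [inv_mul_lt_iff₀ hl]
  obtain ⟨v, hv⟩ := cauchySeq_tendsto_of_complete hcau
  have hBv : Tendsto (fun n => B (u n)) atTop (𝓝 (l • v - f)) := by
    refine ((hv.const_smul l).sub hlim).congr fun n => ?_
    rw [← hu n]
    simp
  have hmem : (v, l • v - f) ∈ B.graph := by
    have h2 : Tendsto (fun n => ((u n : E), B (u n))) atTop (𝓝 (v, l • v - f)) :=
      hv.prodMk_nhds hBv
    exact hcl.mem_of_tendsto h2 (Eventually.of_forall fun n => B.mem_graph (u n))
  obtain ⟨y, hy1, hy2⟩ := (LinearPMap.mem_graph_iff _).1 hmem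
  refine ⟨y, ?_⟩
  simp only at hy1 hy2 ⊢
  rw [hy2, hy1]
  abel

/-- The range condition at `l₀` propagates to all `l < 2 l₀`, because there
`l - B = (1 - (l₀ - l) (l₀ - B)⁻¹) (l₀ - B)` is solvable by the contraction principle. -/
theorem IsDissipative.surjective_of_lt [CompleteSpace E] (hB : IsDissipative B) {l₀ l : ℝ}
    (hl₀ : 0 < l₀) (hl : 0 < l) (hlt : l < 2 * l₀)
    (hs : Function.Surjective fun u : B.domain => l₀ • (u : E) - B u) :
    Function.Surjective fun u : B.domain => l • (u : E) - B u := by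
  choose J hJ using hs
  simp only at hJ
  have hJlip : ∀ a b, ‖(J a : E) - J b‖ ≤ l₀⁻¹ * ‖a - b‖ := by
    intro a b
    have := hB.norm_sub_le hl₀ (J a) (J b)
    rwa [hJ, hJ] at this
  intro f
  have hk : |l₀ - l| * l₀⁻¹ < 1 := by
    rw [← div_eq_mul_inv, div_lt_one hl₀, abs_lt]
    constructor <;> linarith
  let Φ : E → E := fun g => f + (l₀ - l) • (J g : E)
  have hΦ : ContractingWith ⟨|l₀ - l| * l₀⁻¹, by positivity⟩ Φ := by
    refine ⟨hk, LipschitzWith.of_dist_le_mul fun a b => ?_⟩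
    rw [dist_eq_norm, dist_eq_norm]
    simp only [Φ, add_sub_add_left_eq_sub, ← smul_sub, norm_smul, Real.norm_eq_abs]
    change _ ≤ |l₀ - l| * l₀⁻¹ * ‖a - b‖
    rw [mul_assoc]
    exact mul_le_mul_of_nonneg_left (hJlip a b) (abs_nonneg _)
  obtain ⟨g, hg, -⟩ := hΦ.exists_fixedPoint f (edist_ne_top _ _)
  refine ⟨J g, ?_⟩
  have h1 := hJ g
  have h2 : f + (l₀ - l) • (J g : E) = g := hg
  have e : l • (J g : E) - B (J g) = (l₀ • (J g : E) - B (J g)) - (l₀ - l) • (J g : E) := by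
    rw [sub_smul]
    abel
  simp only
  rw [e, h1, sub_eq_iff_eq_add, h2]

theorem IsDissipative.surjective_of_pos [CompleteSpace E] (hB : IsDissipative B) {l₀ : ℝ}
    (hl₀ : 0 < l₀) (hs : Function.Surjective fun u : B.domain => l₀ • (u : E) - B u) {l : ℝ}
    (hl : 0 < l) : Function.Surjective fun u : B.domain => l • (u : E) - B u := by
  have hstep : ∀ n : ℕ, Function.Surjective
      fun u : B.domain => ((3 / 2 : ℝ) ^ n * l₀) • (u : E) - B u := by
    intro n
    induction n with
    | zero => simpa using hs
    | succ n ih =>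
      have : 0 < (3 / 2 : ℝ) ^ n * l₀ := by positivity
      refine hB.surjective_of_lt this (by positivity) ?_ ih
      rw [pow_succ]
      linarith
  obtain ⟨n, hn⟩ := pow_unbounded_of_one_lt (l / l₀) (by norm_num : (1 : ℝ) < 3 / 2)
  rw [div_lt_iff₀ hl₀] at hn
  exact hB.surjective_of_lt (by positivity) hl (by linarith) (hstep n)

/-- A closable dissipative operator with dense range condition at one `l₀ > 0` has m-dissipative
closure, and then satisfies the dense range condition at every `l > 0`. -/
theorem IsDissipative.isMDissipative_closure [CompleteSpace E] (hB : IsDissipative B)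
    (hc : B.IsClosable) {l₀ : ℝ} (hl₀ : 0 < l₀)
    (hd : Dense (range fun u : B.domain => l₀ • (u : E) - B u)) :
    IsMDissipative B.closure ∧
      ∀ l : ℝ, 0 < l → Dense (range fun u : B.domain => l • (u : E) - B u) := by
  have hBc := hB.closure hc
  have hd' : Dense (range fun u : B.closure.domain => l₀ • (u : E) - B.closure u) := by
    refine hd.mono ?_
    rintro _ ⟨u, rfl⟩
    have := LinearPMap.le_graph_of_le B.le_closure (B.mem_graph u)
    obtain ⟨y, hy1, hy2⟩ := (LinearPMap.mem_graph_iff _).1 this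
    exact ⟨y, by simp only at hy1 hy2 ⊢; rw [hy1, hy2]⟩
  have hs := hBc.surjective_of_dense hc.closure_isClosed hl₀ hd'
  have hall := fun l (hl : (0 : ℝ) < l) => hBc.surjective_of_pos hl₀ hs hl
  refine ⟨⟨hBc, hall⟩, fun l hl f => ?_⟩
  obtain ⟨u, rfl⟩ := hall l hl f
  have hmem : ((u : E), B.closure u) ∈ _root_.closure (B.graph : Set (E × E)) := by
    have := B.closure.mem_graph u
    rw [← hc.graph_closure_eq_closure_graph] at this
    exact this
  have hcont : Continuous fun p : E × E => l • p.1 - p.2 := by fun_prop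
  refine closure_mono ?_ (image_closure_subset_closure_image hcont ⟨_, hmem, rfl⟩)
  rintro _ ⟨⟨a, b⟩, hab, rfl⟩
  obtain ⟨y, hy1, hy2⟩ := (LinearPMap.mem_graph_iff _).1 hab
  exact ⟨y, by simp only at hy1 hy2 ⊢; rw [hy1, hy2]⟩

end DissipativeLemmas

section Complete

variable {H : Type*} [NormedAddCommGroup H]

theorem isClosed_cb : IsClosed (Cb H : Set (H →ᵇ ℝ)) := by
  rw [← isSeqClosed_iff_isClosed]
  intro u f hu hlim
  have := BoundedContinuousFunction.tendsto_iff_tendstoUniformly.1 hlim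
  exact this.uniformContinuous (Frequently.of_forall hu)

instance : CompleteSpace (Cb H) := isClosed_cb.completeSpace_coe

end Complete

/-! ### Factorization of positive operators of finite trace -/

section Factorization

universe u

variable {H : Type u} [NormedAddCommGroup H] [InnerProductSpace ℝ H]

/-- A copy of `H`, to carry the semi-inner product `⟪T x, y⟫` of a positive operator `T`. -/
def EnergySpace (_T : H →L[ℝ] H) : Type u := H

noncomputable instance (T : H →L[ℝ] H) : AddCommGroup (EnergySpace T) :=
  inferInstanceAs (AddCommGroup H)

noncomputable instance (T : H →L[ℝ] H) : Module ℝ (EnergySpace T) :=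
  inferInstanceAs (Module ℝ H)

/-- The semi-inner product `⟪T x, y⟫` of a positive operator `T`. -/
@[reducible]
noncomputable def energyCore (T : H →L[ℝ] H) (hT : T.IsPositive) :
    PreInnerProductSpace.Core ℝ (EnergySpace T) where
  inner x y := (⟪T (x : H), (y : H)⟫ : ℝ)
  conj_inner_symm x y := by
    have h1 := hT.1 (x : H) (y : H)
    simp only [conj_trivial]
    exact (real_inner_comm _ _).trans h1.symm
  re_inner_nonneg x := hT.2 (x : H)
  add_left x y z := by
    exact (congrArg (fun u : H => (⟪u, (z : H)⟫ : ℝ)) (T.map_add (x : H) (y : H))).trans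
      (inner_add_left _ _ _)
  smul_left x y r := by
    exact (congrArg (fun u : H => (⟪u, (y : H)⟫ : ℝ)) (T.map_smul r (x : H))).trans
      (inner_smul_left _ _ _)

/-- A positive operator is of the form `J* J`, where `J` maps `H` to the completion of `H` for the
semi-inner product `⟪T x, y⟫`. -/
theorem exists_energy_factorization (T : H →L[ℝ] H) (hT : T.IsPositive) :
    ∃ (K : Type u) (_ : NormedAddCommGroup K) (_ : InnerProductSpace ℝ K) (_ : CompleteSpace K)
      (J : H →L[ℝ] K), ∀ x y, (⟪J x, J y⟫ : ℝ) = ⟪T x, y⟫ := by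
  let c := energyCore T hT
  let : SeminormedAddCommGroup (EnergySpace T) :=
    InnerProductSpace.Core.toSeminormedAddCommGroup (𝕜 := ℝ)
  let : InnerProductSpace ℝ (EnergySpace T) := InnerProductSpace.ofCore c
  let J₀ : H →ₗ[ℝ] UniformSpace.Completion (EnergySpace T) :=
    { toFun := fun x => ((show EnergySpace T from x : EnergySpace T) :
        UniformSpace.Completion (EnergySpace T))
      map_add' := fun x y => UniformSpace.Completion.coe_add (α := EnergySpace T) x y
      map_smul' := fun r x => UniformSpace.Completion.coe_smul (X := EnergySpace T) r x }
  have hJ : ∀ x y, (⟪J₀ x, J₀ y⟫ : ℝ) = ⟪T x, y⟫ := fun x y =>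
    UniformSpace.Completion.inner_coe (𝕜 := ℝ) (E := EnergySpace T) x y
  refine ⟨_, inferInstance, inferInstance, inferInstance,
    J₀.mkContinuous (Real.sqrt ‖T‖) fun x => ?_, hJ⟩
  have h1 : ‖J₀ x‖ ^ 2 ≤ (Real.sqrt ‖T‖ * ‖x‖) ^ 2 := by
    rw [← real_inner_self_eq_norm_sq, hJ, mul_pow, Real.sq_sqrt (norm_nonneg _)]
    calc _ ≤ ‖T x‖ * ‖x‖ := real_inner_le_norm _ _
      _ ≤ ‖T‖ * ‖x‖ * ‖x‖ := by gcongr; exact T.le_opNorm x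
      _ = _ := by ring
  exact le_of_sq_le_sq h1 (by positivity)

/-- A positive operator of finite trace is a sum `∑ᵢ ⟪vᵢ, ·⟫ vᵢ` with `∑ᵢ ‖vᵢ‖² < ∞`. -/
theorem exists_rank_one_decomposition [CompleteSpace H] (T : H →L[ℝ] H) (hT : T.IsPositive)
    {ι : Type*} (b : HilbertBasis ι ℝ H) (htr : Summable fun i => ⟪T (b i), b i⟫) :
    ∃ (κ : Type u) (v : κ → H), (Summable fun k => ‖v k‖ ^ 2) ∧
      ∀ x, HasSum (fun k => ⟪v k, x⟫ ^ 2) ⟪T x, x⟫ := by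
  obtain ⟨K, _, _, _, J, hJ⟩ := exists_energy_factorization T hT
  obtain ⟨w, f, -⟩ := exists_hilbertBasis ℝ K
  have hadj : ∀ k x, (⟪ContinuousLinearMap.adjoint J (f k), x⟫ : ℝ) = ⟪f k, J x⟫ := fun k x =>
    ContinuousLinearMap.adjoint_inner_left J x (f k)
  refine ⟨w, fun k => ContinuousLinearMap.adjoint J (f k), ?_, fun x => ?_⟩
  · have hn : ∀ k, HasSum (fun i => (⟪f k, J (b i)⟫ : ℝ) ^ 2)
        (‖ContinuousLinearMap.adjoint J (f k)‖ ^ 2) := by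
      intro k
      have := b.hasSum_inner_mul_inner (ContinuousLinearMap.adjoint J (f k))
        (ContinuousLinearMap.adjoint J (f k))
      rw [real_inner_self_eq_norm_sq] at this
      refine this.congr_fun fun i => ?_
      rw [real_inner_comm _ (b i), hadj, sq]
    refine summable_of_sum_le (c := ∑' i, ⟪T (b i), b i⟫) (fun k => by positivity) fun F => ?_
    have h1 : HasSum (fun i => ∑ k ∈ F, (⟪f k, J (b i)⟫ : ℝ) ^ 2)
        (∑ k ∈ F, ‖ContinuousLinearMap.adjoint J (f k)‖ ^ 2) := hasSum_sum fun k _ => hn k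
    refine hasSum_le (fun i => ?_) h1 htr.hasSum
    rw [← hJ, real_inner_self_eq_norm_sq]
    have := f.orthonormal.sum_inner_products_le (J (b i)) (s := F)
    simpa only [Real.norm_eq_abs, sq_abs] using this
  · have := f.hasSum_inner_mul_inner (J x) (J x)
    rw [hJ] at this
    refine this.congr_fun fun k => ?_
    rw [hadj, real_inner_comm (f k) (J x), sq]

end Factorization

/-! ### Existence of centred Gaussian measures -/

section Gaussian

variable {H : Type*} [NormedAddCommGroup H] [InnerProductSpace ℝ H] [CompleteSpace H]
  [MeasurableSpace H] [BorelSpace H] [SecondCountableTopology H]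

theorem isCenteredGaussian_of_charFun {μ : Measure H} [IsProbabilityMeasure μ] {T : H →L[ℝ] H}
    (hT : T.IsPositive)
    (h : ∀ t, charFun μ t = Complex.exp (-((⟪T t, t⟫ : ℝ) : ℂ) / 2)) :
    IsCenteredGaussian μ T := by
  let f : H →L[ℝ] H →L[ℝ] ℝ := (innerSL ℝ).comp T
  have hf : ∀ x y, f x y = ⟪T x, y⟫ := fun x y => rfl
  have hpos : f.toBilinForm.IsPosSemidef := by
    refine ⟨⟨fun x y => ?_⟩, ⟨fun x => ?_⟩⟩
    · have := hT.1 x y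
      change (⟪T x, y⟫ : ℝ) = ⟪T y, x⟫
      exact this.trans (real_inner_comm _ _)
    · exact hT.2 x
  have h' : ∀ t, charFun μ t = Complex.exp (⟪t, (0 : H)⟫ * Complex.I - f t t / 2) := by
    intro t
    rw [h, hf, inner_zero_right]
    congr 1
    push_cast
    ring
  have hG : IsGaussian μ := isGaussian_iff_gaussian_charFun.2 ⟨0, f, hpos, h'⟩
  obtain ⟨hm, hc⟩ := gaussian_charFun_congr 0 f hpos h'
  refine ⟨hG, hm.symm, fun x => ?_⟩
  refine ext_inner_right ℝ fun y => ?_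
  have hL2 : MemLp id 2 μ := IsGaussian.memLp_two_id
  rw [covarianceOperator_inner hL2, ← hf, hc, covarianceBilin_apply hL2]
  simp [← hm]

theorem IsCenteredGaussian.integral_inner_mul_inner {μ : Measure H} {T : H → H}
    (h : IsCenteredGaussian μ T) (x y : H) : ∫ z, ⟪x, z⟫ * ⟪y, z⟫ ∂μ = ⟪T x, y⟫ := by
  have := h.isGaussian
  rw [← h.covariance, covarianceOperator_inner IsGaussian.memLp_two_id]

theorem IsCenteredGaussian.charFun {μ : Measure H} {T : H → H} (h : IsCenteredGaussian μ T)
    (t : H) : charFun μ t = Complex.exp (-((⟪T t, t⟫ : ℝ) : ℂ) / 2) := by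
  have := h.isGaussian
  have hL2 : MemLp id 2 μ := IsGaussian.memLp_two_id
  rw [IsGaussian.charFun_eq', covarianceBilin_apply hL2]
  have e : ∫ z, ⟪t, z⟫ * ⟪t, z⟫ ∂μ = (⟪T t, t⟫ : ℝ) := h.integral_inner_mul_inner t t
  simp only [id_eq, h.mean_zero, sub_zero, e]
  congr 1
  simp
  ring

section Series

variable {κ : Type*}

/-- The law of a family, indexed by `κ`, of independent standard Gaussian variables. -/
noncomputable def whiteNoise (κ : Type*) : Measure (κ → ℝ) :=
  Measure.infinitePi fun _ => gaussianReal 0 1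

instance : IsProbabilityMeasure (whiteNoise κ) := by
  unfold whiteNoise
  infer_instance

theorem map_eval_whiteNoise (k : κ) : (whiteNoise κ).map (fun w => w k) = gaussianReal 0 1 :=
  Measure.infinitePi_map_eval _ k

theorem memLp_eval_whiteNoise (k : κ) : MemLp (fun w : κ → ℝ => w k) 2 (whiteNoise κ) := by
  have h : MemLp (id : ℝ → ℝ) 2 ((whiteNoise κ).map fun w => w k) := by
    rw [map_eval_whiteNoise]
    exact IsGaussian.memLp_two_id
  exact h.comp_of_map (measurable_pi_apply k).aemeasurable

theorem integral_eval_mul_eval_whiteNoise [DecidableEq κ] (j k : κ) :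
    ∫ w, w j * w k ∂(whiteNoise κ) = if j = k then 1 else 0 := by
  have hmean : ∀ i : κ, ∫ w, w i ∂(whiteNoise κ) = 0 := fun i => by
    have := integral_map (μ := whiteNoise κ) (measurable_pi_apply i).aemeasurable
      (f := (id : ℝ → ℝ)) (by fun_prop)
    rw [map_eval_whiteNoise] at this
    simp only [id_eq, integral_id_gaussianReal] at this
    exact this.symm
  split_ifs with h
  · subst h
    have := integral_map (μ := whiteNoise κ) (measurable_pi_apply j).aemeasurable
      (f := fun x : ℝ => x * x) (by fun_prop)
    rw [map_eval_whiteNoise] at this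
    rw [← this]
    have hv := variance_id_gaussianReal (μ := 0) (v := 1)
    rw [variance_of_integral_eq_zero (by fun_prop) (by simp)] at hv
    simpa [sq] using hv
  · have hind : iIndepFun (fun i (w : κ → ℝ) => w i) (whiteNoise κ) :=
      iIndepFun_infinitePi (X := fun _ x => x) fun _ => measurable_id
    have := (hind.indepFun h).integral_mul_eq_mul_integral
      (measurable_pi_apply j).aestronglyMeasurable (measurable_pi_apply k).aestronglyMeasurable
    simp only [Pi.mul_apply, hmean, mul_zero] at this
    exact this

theorem integral_exp_sum_whiteNoise (F : Finset κ) (c : κ → ℝ) :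
    ∫ w, Complex.exp (((∑ k ∈ F, c k * w k : ℝ) : ℂ) * Complex.I) ∂(whiteNoise κ) =
      Complex.exp (-((∑ k ∈ F, c k ^ 2 : ℝ) : ℂ) / 2) := by
  have hind : iIndepFun (fun i (w : κ → ℝ) => c i * w i) (whiteNoise κ) :=
    iIndepFun_infinitePi (X := fun i x => c i * x) fun i => by fun_prop
  have hm : ∀ k, Measurable fun w : κ → ℝ => c k * w k := fun k =>
    Measurable.const_mul (f := fun w : κ → ℝ => w k) (measurable_pi_apply k) (c k)
  have h1 := (hind.restrict F).charFun_map_fun_finsetSum_eq_prod fun k _ => (hm k).aemeasurable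
  have h2 := congrFun h1 1
  have hsum : Measurable fun w : κ → ℝ => ∑ k ∈ F, c k * w k :=
    Finset.measurable_fun_sum F fun k _ => hm k
  rw [charFun_apply_real, integral_map hsum.aemeasurable (by fun_prop)] at h2
  simp only [Complex.ofReal_one, one_mul, Finset.prod_apply] at h2
  rw [h2]
  have h3 : ∀ k, charFun ((whiteNoise κ).map fun w => c k * w k) 1 =
      Complex.exp (-((c k ^ 2 : ℝ) : ℂ) / 2) := by
    intro k
    rw [charFun_map_mul_comp (measurable_pi_apply k).aemeasurable, map_eval_whiteNoise, charFun_gaussianReal]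
    congr 1
    push_cast
    ring_nf
  simp only [h3, ← Complex.exp_sum]
  congr 1
  push_cast
  rw [← Finset.sum_div, Finset.sum_neg_distrib]

theorem norm_integral_exp_sub_le {Ω : Type*} [MeasurableSpace Ω] {P : Measure Ω}
    [IsProbabilityMeasure P] (Y Z : Lp ℝ 2 P) :
    ‖∫ w, Complex.exp ((Y w : ℂ) * Complex.I) ∂P - ∫ w, Complex.exp ((Z w : ℂ) * Complex.I) ∂P‖
      ≤ ‖Y - Z‖ := by
  have hint : ∀ X : Lp ℝ 2 P, Integrable (fun w => Complex.exp ((X w : ℂ) * Complex.I)) P := by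
    intro X
    refine Integrable.of_bound (C := 1) ?_ (Eventually.of_forall fun w => ?_)
    · have := (Lp.aestronglyMeasurable X)
      have hc : Continuous fun x : ℝ => Complex.exp ((x : ℂ) * Complex.I) := by fun_prop
      exact hc.comp_aestronglyMeasurable this
    · rw [Complex.norm_exp_ofReal_mul_I]
  rw [← integral_sub (hint Y) (hint Z)]
  have hL1 : Integrable (fun w => (Y - Z : Lp ℝ 2 P) w) P := (Lp.memLp (Y - Z)).integrable (by norm_num)
  calc _ ≤ ∫ w, ‖(Y - Z : Lp ℝ 2 P) w‖ ∂P := by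
        refine norm_integral_le_of_norm_le hL1.norm ?_
        filter_upwards [Lp.coeFn_sub Y Z] with w hw
        rw [hw, Pi.sub_apply]
        have e : Complex.exp ((Y w : ℂ) * Complex.I) - Complex.exp ((Z w : ℂ) * Complex.I) =
            Complex.exp ((Z w : ℂ) * Complex.I) *
              (Complex.exp (Complex.I * ((Y w - Z w : ℝ) : ℂ)) - 1) := by
          rw [mul_sub, ← Complex.exp_add, mul_one]
          congr 2
          push_cast
          ring
        rw [e, norm_mul, Complex.norm_exp_ofReal_mul_I, one_mul]
        exact Real.norm_exp_I_mul_ofReal_sub_one_le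
    _ ≤ ‖Y - Z‖ := by
        rw [integral_norm_eq_lintegral_enorm hL1.1, ← eLpNorm_one_eq_lintegral_enorm, Lp.norm_def]
        refine ENNReal.toReal_mono (Lp.eLpNorm_ne_top _) ?_
        exact eLpNorm_le_eLpNorm_of_exponent_le (by norm_num) hL1.1

theorem memLp_eval_smul (k : κ) (v : H) : MemLp (fun w : κ → ℝ => w k • v) 2 (whiteNoise κ) := by
  refine (memLp_eval_whiteNoise k).of_le_mul (c := ‖v‖)
    ((measurable_pi_apply k).smul_const v).aestronglyMeasurable (Eventually.of_forall fun w => ?_)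
  rw [norm_smul, mul_comm]

theorem inner_toLp_eval_smul [DecidableEq κ] (j k : κ) (v v' : H) :
    (⟪(memLp_eval_smul j v).toLp _, (memLp_eval_smul k v').toLp _⟫ : ℝ) =
      if j = k then ⟪v, v'⟫ else 0 := by
  rw [L2.inner_def]
  have e : ∫ w, (⟪(memLp_eval_smul j v).toLp _ w, (memLp_eval_smul k v').toLp _ w⟫ : ℝ)
      ∂(whiteNoise κ) = ∫ w, w j * w k * ⟪v, v'⟫ ∂(whiteNoise κ) := by
    refine integral_congr_ae ?_
    filter_upwards [(memLp_eval_smul j v).coeFn_toLp, (memLp_eval_smul k v').coeFn_toLp]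
      with w h1 h2
    rw [h1, h2, inner_smul_left, inner_smul_right]
    simp only [conj_trivial]
    ring
  rw [e, integral_mul_const, integral_eval_mul_eval_whiteNoise]
  split_ifs <;> simp

/-- The isometric embedding `v ↦ ξₖ v` of `H` in `L²`, where `ξₖ` is the `k`-th coordinate. -/
noncomputable def noiseEmbedding (k : κ) : H →ₗᵢ[ℝ] Lp H 2 (whiteNoise κ) where
  toFun v := (memLp_eval_smul k v).toLp _
  map_add' v v' := by
    rw [← MemLp.toLp_add]
    congr 1
    ext w
    simp
  map_smul' c v := by
    rw [RingHom.id_apply, ← MemLp.toLp_const_smul]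
    congr 1
    ext w
    simp [smul_comm c]
  norm_map' v := by
    classical
    have h := inner_toLp_eval_smul k k v v
    rw [if_pos rfl, real_inner_self_eq_norm_sq, real_inner_self_eq_norm_sq] at h
    exact (sq_eq_sq₀ (norm_nonneg _) (norm_nonneg _)).1 h

theorem orthogonalFamily_noiseEmbedding :
    OrthogonalFamily ℝ (fun _ : κ => H) fun k => noiseEmbedding k := by
  classical
  intro j k hjk v v'
  exact (inner_toLp_eval_smul j k v v').trans (if_neg hjk)

/-- The series `∑ₖ ξₖ vₖ` with independent standard Gaussian coefficients converges in `L²` as soon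
as `∑ₖ ‖vₖ‖² < ∞`, and its law is the centred Gaussian measure of covariance `∑ₖ ⟪vₖ, ·⟫ vₖ`. -/
theorem exists_isCenteredGaussian_of_rank_one_decomposition {T : H →L[ℝ] H} (hT : T.IsPositive)
    {v : κ → H} (hv : Summable fun k => ‖v k‖ ^ 2)
    (hTv : ∀ x, HasSum (fun k => ⟪v k, x⟫ ^ 2) ⟪T x, x⟫) :
    ∃ μ : Measure H, IsCenteredGaussian μ T := by
  have hsum : Summable fun k => noiseEmbedding k (v k) :=
    (orthogonalFamily_noiseEmbedding.summable_iff_norm_sq_summable v).2 hv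
  obtain ⟨X, hX⟩ := hsum
  have hXm : AEMeasurable X (whiteNoise κ) := (Lp.aestronglyMeasurable X).aemeasurable
  have : IsProbabilityMeasure ((whiteNoise κ).map X) := Measure.isProbabilityMeasure_map hXm
  refine ⟨(whiteNoise κ).map X, isCenteredGaussian_of_charFun hT fun t => ?_⟩
  -- the coordinate `⟪t, X⟫` as the `L²`-limit of `∑ₖ ⟪t, vₖ⟫ ξₖ`
  let Y : Lp H 2 (whiteNoise κ) → Lp ℝ 2 (whiteNoise κ) := (innerSL ℝ t).compLpL 2 (whiteNoise κ)
  have hY : ∀ Z : Lp H 2 (whiteNoise κ), Y Z =ᵐ[whiteNoise κ] fun w => ⟪t, Z w⟫ := fun Z =>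
    (innerSL ℝ t).coeFn_compLpL Z
  have hYlim : Tendsto (fun F : Finset κ => Y (∑ k ∈ F, noiseEmbedding k (v k))) atTop
      (𝓝 (Y X)) :=
    (((innerSL ℝ t).compLpL 2 (whiteNoise κ)).continuous.tendsto X).comp hX
  let ψ : Lp ℝ 2 (whiteNoise κ) → ℂ := fun Z =>
    ∫ w, Complex.exp ((Z w : ℂ) * Complex.I) ∂(whiteNoise κ)
  have hψ : Continuous ψ :=
    (LipschitzWith.of_dist_le_mul (K := 1) fun Z Z' => by
      rw [dist_eq_norm, dist_eq_norm, NNReal.coe_one, one_mul]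
      exact norm_integral_exp_sub_le Z Z').continuous
  have hpart : ∀ F : Finset κ, ψ (Y (∑ k ∈ F, noiseEmbedding k (v k))) =
      Complex.exp (-((∑ k ∈ F, ⟪v k, t⟫ ^ 2 : ℝ) : ℂ) / 2) := by
    intro F
    rw [← integral_exp_sum_whiteNoise]
    refine integral_congr_ae ?_
    have h1 : ∀ᵐ w ∂(whiteNoise κ), ∀ k ∈ F, noiseEmbedding k (v k) w = w k • v k :=
      (Finset.eventually_all F).2 fun k _ => (memLp_eval_smul k (v k)).coeFn_toLp
    filter_upwards [hY (∑ k ∈ F, noiseEmbedding k (v k)),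
      Lp.coeFn_finsetSum F fun k => noiseEmbedding k (v k), h1] with w h2 h3 h4
    rw [h2, h3, Finset.sum_apply, inner_sum]
    congr 3
    refine Finset.sum_congr rfl fun k hk => ?_
    rw [h4 k hk, inner_smul_right, real_inner_comm, mul_comm]
  have hlim1 := (hψ.tendsto (Y X)).comp hYlim
  have hlim2 : Tendsto (fun F : Finset κ =>
      Complex.exp (-((∑ k ∈ F, ⟪v k, t⟫ ^ 2 : ℝ) : ℂ) / 2)) atTop
      (𝓝 (Complex.exp (-((⟪T t, t⟫ : ℝ) : ℂ) / 2))) := by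
    have hc : Continuous fun r : ℝ => Complex.exp (-(r : ℂ) / 2) := by fun_prop
    exact (hc.tendsto _).comp (hTv t)
  have hval : ψ (Y X) = Complex.exp (-((⟪T t, t⟫ : ℝ) : ℂ) / 2) :=
    tendsto_nhds_unique hlim1 (hlim2.congr fun F => (hpart F).symm)
  rw [← hval, charFun_apply, integral_map hXm (by fun_prop)]
  refine integral_congr_ae ?_
  filter_upwards [hY X] with w hw
  rw [hw, real_inner_comm]

end Series

/-- A positive operator of finite trace is the covariance operator of a Gaussian measure. -/
theorem exists_isCenteredGaussian {T : H →L[ℝ] H} (hT : T.IsPositive) {ι : Type*}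
    (b : HilbertBasis ι ℝ H) (htr : Summable fun i => ⟪T (b i), b i⟫) :
    ∃ μ : Measure H, IsCenteredGaussian μ T := by
  obtain ⟨κ, v, hv, hTv⟩ := exists_rank_one_decomposition T hT b htr
  exact exists_isCenteredGaussian_of_rank_one_decomposition hT hv hTv

theorem IsCenteredGaussian.integrable_norm_sq {μ : Measure H} {T : H → H}
    (h : IsCenteredGaussian μ T) : Integrable (fun y => ‖y‖ ^ 2) μ := by
  have := h.isGaussian
  have hL2 : MemLp id 2 μ := IsGaussian.memLp_two_id
  simpa using (memLp_two_iff_integrable_sq_norm hL2.1).1 hL2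

/-- The second moment of a centred Gaussian measure is the trace of its covariance operator. -/
theorem IsCenteredGaussian.hasSum_integral_norm_sq {μ : Measure H} {T : H → H}
    (h : IsCenteredGaussian μ T) {ι : Type*} [Countable ι] (b : HilbertBasis ι ℝ H) :
    HasSum (fun i => ⟪T (b i), b i⟫) (∫ y, ‖y‖ ^ 2 ∂μ) := by
  have hb : ∀ y : H, HasSum (fun i => (⟪b i, y⟫ : ℝ) * ⟪b i, y⟫) (‖y‖ ^ 2) := fun y => by
    have := b.hasSum_inner_mul_inner y y
    rw [real_inner_self_eq_norm_sq] at this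
    refine this.congr_fun fun i => ?_
    rw [real_inner_comm]
  simp only [← h.integral_inner_mul_inner]
  refine hasSum_integral_of_dominated_convergence (fun i y => ⟪b i, y⟫ * ⟪b i, y⟫)
    (fun i => by fun_prop) (fun i => Eventually.of_forall fun y => ?_)
    (Eventually.of_forall fun y => (hb y).summable) ?_ (Eventually.of_forall hb)
  · rw [Real.norm_of_nonneg (mul_self_nonneg _)]
  · simp only [(hb _).tsum_eq]
    exact h.integrable_norm_sq

end Gaussian

/-! ### The covariance operators `Q_t` and the Gaussian measures `N_{Q_t}` -/

section Weak

variable {H : Type*} [NormedAddCommGroup H] [InnerProductSpace ℝ H]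
  [SecondCountableTopology H]

theorem HilbertBasis.countable {ι : Type*} (b : HilbertBasis ι ℝ H) : Countable ι := by
  refine Pairwise.countable_of_isOpen_disjoint (s := fun i => Metric.ball (b i) (1 / 2)) ?_
    (fun i => Metric.isOpen_ball) fun i => ⟨b i, Metric.mem_ball_self (by norm_num)⟩
  intro i j hij
  refine Metric.ball_disjoint_ball ?_
  have h : ‖b i - b j‖ ^ 2 = 2 := by
    rw [norm_sub_sq_real, b.orthonormal.1 i, b.orthonormal.1 j, b.orthonormal.2 hij]
    norm_num
  rw [dist_eq_norm]
  nlinarith [norm_nonneg (b i - b j)]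

/-- Weak measurability implies strong measurability in a separable Hilbert space. -/
theorem aestronglyMeasurable_of_inner [CompleteSpace H] {Ω : Type*} [MeasurableSpace Ω]
    {μ : Measure Ω} {g : Ω → H}
    (hg : ∀ y, AEStronglyMeasurable (fun w => (⟪y, g w⟫ : ℝ)) μ) : AEStronglyMeasurable g μ := by
  obtain ⟨w, b, -⟩ := exists_hilbertBasis ℝ H
  have := HilbertBasis.countable b
  refine aestronglyMeasurable_of_tendsto_ae (atTop : Filter (Finset w))
    (f := fun F w => ∑ i ∈ F, b.repr (g w) i • b i) (fun F => ?_)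
    (Eventually.of_forall fun w => b.hasSum_repr (g w))
  refine Finset.aestronglyMeasurable_fun_sum F fun i _ => ?_
  simp only [b.repr_apply_apply]
  exact (hg (b i)).smul_const _

end Weak

section TraceClass

variable {H : Type*} [NormedAddCommGroup H] [InnerProductSpace ℝ H]

theorem IsTraceClass.summable_inner {T : H → H} (hT : IsTraceClass T)
    (hpos : ∀ x, 0 ≤ (⟪T x, x⟫ : ℝ)) {ι : Type*} (b : HilbertBasis ι ℝ H) :
    Summable fun i => (⟪T (b i), b i⟫ : ℝ) := by
  obtain ⟨u, v, huv, hsum⟩ := hT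
  refine summable_of_sum_le (c := ∑' n, ‖u n‖ * ‖v n‖) (fun i => hpos _) fun F => ?_
  have h1 : ∀ i, HasSum (fun n => (⟪u n, b i⟫ : ℝ) * ⟪v n, b i⟫) ⟪T (b i), b i⟫ := fun i => by
    have := (hsum (b i)).mapL (innerSL ℝ (b i))
    simp only [innerSL_apply_apply, inner_smul_right] at this
    rw [real_inner_comm] at this
    refine this.congr_fun fun n => ?_
    rw [real_inner_comm (b i) (v n)]
  refine hasSum_le (fun n => ?_) (hasSum_sum fun i (_ : i ∈ F) => h1 i) huv.hasSum
  have hu := b.orthonormal.sum_inner_products_le (u n) (s := F)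
  have hv := b.orthonormal.sum_inner_products_le (v n) (s := F)
  simp only [Real.norm_eq_abs, sq_abs, real_inner_comm (u n), real_inner_comm (v n)] at hu hv
  refine le_of_sq_le_sq ((Finset.sum_mul_sq_le_sq_mul_sq F _ _).trans ?_) (by positivity)
  rw [mul_pow]
  exact mul_le_mul hu hv (Finset.sum_nonneg fun i _ => sq_nonneg _) (by positivity)

end TraceClass

section CovOp

variable {H : Type*} [NormedAddCommGroup H] [InnerProductSpace ℝ H] [CompleteSpace H]
  [SecondCountableTopology H] {S : ℝ → H →L[ℝ] H} {ω : ℝ} {Q : H →L[ℝ] H}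

open ContinuousLinearMap (adjoint)

theorem norm_covOp_integrand_le (hω₀ : 0 ≤ ω) (hω : ∀ t : ℝ, 0 ≤ t → ‖S t‖ ≤ Real.exp (ω * t))
    (x : H) {s t : ℝ} (hs : 0 ≤ s) (hst : s ≤ t) :
    ‖S s (Q (adjoint (S s) x))‖ ≤ Real.exp (ω * t) ^ 2 * ‖Q‖ * ‖x‖ := by
  have h1 : ‖S s‖ ≤ Real.exp (ω * t) := (hω s hs).trans (by gcongr)
  have h2 : ‖adjoint (S s)‖ ≤ Real.exp (ω * t) := by rwa [LinearIsometryEquiv.norm_map]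
  calc _ ≤ ‖S s‖ * (‖Q‖ * (‖adjoint (S s)‖ * ‖x‖)) :=
        (S s).le_opNorm_of_le (Q.le_opNorm_of_le ((adjoint (S s)).le_opNorm x))
    _ ≤ Real.exp (ω * t) * (‖Q‖ * (Real.exp (ω * t) * ‖x‖)) := by gcongr
    _ = _ := by ring

theorem intervalIntegrable_covOp_integrand (hS : IsStronglyContinuousSemigroup S) (hω₀ : 0 ≤ ω)
    (hω : ∀ t : ℝ, 0 ≤ t → ‖S t‖ ≤ Real.exp (ω * t)) (x : H) {t : ℝ} (ht : 0 ≤ t) :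
    IntervalIntegrable (fun s => S s (Q (adjoint (S s) x))) volume 0 t := by
  have hadj : ∀ y, AEStronglyMeasurable (fun s => adjoint (S s) y)
      (volume.restrict (Ici (0 : ℝ))) := fun y => by
    refine aestronglyMeasurable_of_inner fun z => ?_
    simp only [ContinuousLinearMap.adjoint_inner_right]
    refine ContinuousOn.aestronglyMeasurable ?_ measurableSet_Ici
    exact (hS.continuousOn z).inner continuousOn_const
  have hmeas : AEStronglyMeasurable (fun s => S s (Q (adjoint (S s) x)))
      (volume.restrict (Ici (0 : ℝ))) := by
    refine aestronglyMeasurable_of_inner fun z => ?_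
    have e : (fun s => (⟪z, S s (Q (adjoint (S s) x))⟫ : ℝ)) =
        fun s => ⟪adjoint (S s) z, Q (adjoint (S s) x)⟫ :=
      funext fun s => (ContinuousLinearMap.adjoint_inner_left (S s) _ z).symm
    rw [e]
    exact AEStronglyMeasurable.inner (𝕜 := ℝ) (hadj z) (Q.continuous.comp_aestronglyMeasurable (hadj x))
  rw [intervalIntegrable_iff_integrableOn_Ioc_of_le ht]
  refine Integrable.of_bound (C := Real.exp (ω * t) ^ 2 * ‖Q‖ * ‖x‖) ?_ ?_
  · exact hmeas.mono_measure
      (Measure.restrict_mono (Ioc_subset_Icc_self.trans Icc_subset_Ici_self) le_rfl)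
  · exact (ae_restrict_iff' measurableSet_Ioc).2
      (Eventually.of_forall fun s hs => norm_covOp_integrand_le hω₀ hω x hs.1.le hs.2)

theorem norm_covOp_le (hω₀ : 0 ≤ ω) (hω : ∀ t : ℝ, 0 ≤ t → ‖S t‖ ≤ Real.exp (ω * t))
    (x : H) {t : ℝ} (ht : 0 ≤ t) :
    ‖covOp S Q t x‖ ≤ Real.exp (ω * t) ^ 2 * ‖Q‖ * ‖x‖ * t := by
  have := intervalIntegral.norm_integral_le_of_norm_le_const (a := 0) (b := t)
    (f := fun s => S s (Q (adjoint (S s) x))) (C := Real.exp (ω * t) ^ 2 * ‖Q‖ * ‖x‖)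
    fun s hs => by
      rw [uIoc_of_le ht] at hs
      exact norm_covOp_integrand_le hω₀ hω x hs.1.le hs.2
  rwa [sub_zero, abs_of_nonneg ht] at this

theorem covOp_inner (hS : IsStronglyContinuousSemigroup S) (hω₀ : 0 ≤ ω)
    (hω : ∀ t : ℝ, 0 ≤ t → ‖S t‖ ≤ Real.exp (ω * t)) {t : ℝ} (ht : 0 ≤ t) (x y : H) :
    (⟪covOp S Q t x, y⟫ : ℝ) = ∫ s in (0 : ℝ)..t, ⟪Q (adjoint (S s) x), adjoint (S s) y⟫ := by
  have := (innerSL ℝ y).intervalIntegral_comp_comm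
    (intervalIntegrable_covOp_integrand (Q := Q) hS hω₀ hω x ht)
  simp only [innerSL_apply_apply] at this
  rw [real_inner_comm, covOp, ← this]
  refine intervalIntegral.integral_congr fun s _ => ?_
  rw [real_inner_comm, ContinuousLinearMap.adjoint_inner_right]

/-- The covariance operators as positive bounded operators. -/
theorem exists_isPositive_eq_covOp (hS : IsStronglyContinuousSemigroup S) (hω₀ : 0 ≤ ω)
    (hω : ∀ t : ℝ, 0 ≤ t → ‖S t‖ ≤ Real.exp (ω * t)) (hQ : Q.IsPositive) {t : ℝ} (ht : 0 ≤ t) :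
    ∃ T : H →L[ℝ] H, T.IsPositive ∧ ⇑T = covOp S Q t := by
  have hi := fun x => intervalIntegrable_covOp_integrand (Q := Q) hS hω₀ hω x ht
  let T₀ : H →ₗ[ℝ] H :=
    { toFun := covOp S Q t
      map_add' := fun x y => by
        simp only [covOp, map_add]
        exact intervalIntegral.integral_add (hi x) (hi y)
      map_smul' := fun c x => by
        simp only [covOp, map_smul]
        exact intervalIntegral.integral_smul c _ }
  refine ⟨T₀.mkContinuous (Real.exp (ω * t) ^ 2 * ‖Q‖ * t) fun x => ?_, ⟨fun x y => ?_, fun x => ?_⟩,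
    rfl⟩
  · exact (norm_covOp_le hω₀ hω x ht).trans (le_of_eq (by ring))
  · change (⟪covOp S Q t x, y⟫ : ℝ) = ⟪x, covOp S Q t y⟫
    rw [real_inner_comm _ x, covOp_inner hS hω₀ hω ht, covOp_inner hS hω₀ hω ht]
    refine intervalIntegral.integral_congr fun s _ => ?_
    exact (hQ.1 _ _).trans (real_inner_comm _ _)
  · change (0 : ℝ) ≤ ⟪covOp S Q t x, x⟫
    rw [covOp_inner hS hω₀ hω ht]
    exact intervalIntegral.integral_nonneg ht fun s _ => hQ.2 _

theorem covOp_add (hS : IsStronglyContinuousSemigroup S) (hω₀ : 0 ≤ ω)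
    (hω : ∀ t : ℝ, 0 ≤ t → ‖S t‖ ≤ Real.exp (ω * t)) {s t : ℝ} (hs : 0 ≤ s) (ht : 0 ≤ t) (x : H) :
    covOp S Q (s + t) x = covOp S Q s x + S s (covOp S Q t (adjoint (S s) x)) := by
  have hst : 0 ≤ s + t := add_nonneg hs ht
  have h1 := intervalIntegrable_covOp_integrand (Q := Q) hS hω₀ hω x hs
  have h2 := intervalIntegrable_covOp_integrand (Q := Q) hS hω₀ hω x hst
  rw [covOp, ← intervalIntegral.integral_add_adjacent_intervals h1 (h1.symm.trans h2)]
  congr 1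
  have h3 := intervalIntegral.integral_comp_add_left (a := 0) (b := t)
    (fun r => S r (Q (adjoint (S r) x))) s
  rw [add_zero] at h3
  rw [← h3, covOp, ← (S s).intervalIntegral_comp_comm
    (intervalIntegrable_covOp_integrand (Q := Q) hS hω₀ hω _ ht)]
  refine intervalIntegral.integral_congr fun r hr => ?_
  rw [uIcc_of_le ht] at hr
  rw [hS.add s r hs hr.1, ContinuousLinearMap.adjoint_comp]
  rfl

theorem covOp_inner_self_le (hS : IsStronglyContinuousSemigroup S) (hω₀ : 0 ≤ ω)
    (hω : ∀ t : ℝ, 0 ≤ t → ‖S t‖ ≤ Real.exp (ω * t)) (hQ : Q.IsPositive) {s t : ℝ} (hs : 0 ≤ s)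
    (hst : s ≤ t) (x : H) : (⟪covOp S Q s x, x⟫ : ℝ) ≤ ⟪covOp S Q t x, x⟫ := by
  obtain ⟨r, rfl⟩ := exists_add_of_le hst
  have hr : 0 ≤ r := by linarith
  rw [covOp_add hS hω₀ hω hs hr, inner_add_left, ← ContinuousLinearMap.adjoint_inner_right]
  obtain ⟨T, hT, hTe⟩ := exists_isPositive_eq_covOp hS hω₀ hω hQ hr
  rw [← hTe]
  exact le_add_of_nonneg_right (hT.2 _)

end CovOp

section Family

variable {H : Type*} [NormedAddCommGroup H] [InnerProductSpace ℝ H] [CompleteSpace H]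
  [MeasurableSpace H] [BorelSpace H]

/-- The properties of a semigroup `S` and of a family `N` of probability measures
that make `R_t φ(x) = ∫ φ(S_t x + y) N_t(dy)` a semigroup which is continuous in time: the skew-convolution
identity `N_{s+t} = N_s ∗ (S_s)_# N_t`, and second moments that vanish as `t → 0`. -/
structure IsMehlerFamily (S : ℝ → H →L[ℝ] H) (ω : ℝ) (N : ℝ → Measure H) : Prop where
  semigroup : IsStronglyContinuousSemigroup S
  omega_nonneg : 0 ≤ ω
  norm_le : ∀ t : ℝ, 0 ≤ t → ‖S t‖ ≤ Real.exp (ω * t)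
  zero : N 0 = Measure.dirac 0
  conv : ∀ s t, 0 ≤ s → 0 ≤ t → N (s + t) = N s ∗ (N t).map (S s)
  integrable_sq : ∀ t, 0 ≤ t → Integrable (fun y => ‖y‖ ^ 2) (N t)
  tendsto_sq : Tendsto (fun t => ∫ y, ‖y‖ ^ 2 ∂(N t)) (𝓝[>] 0) (𝓝 0)

variable [SecondCountableTopology H] {S : ℝ → H →L[ℝ] H} {ω : ℝ} {Q : H →L[ℝ] H}

theorem isCenteredGaussian_gaussianMeasure_covOp (hS : IsStronglyContinuousSemigroup S)
    (hω₀ : 0 ≤ ω) (hω : ∀ t : ℝ, 0 ≤ t → ‖S t‖ ≤ Real.exp (ω * t)) (hQ : Q.IsPositive)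
    (hQt : ∀ t : ℝ, 0 < t → IsTraceClass (covOp S Q t)) {t : ℝ} (ht : 0 ≤ t) :
    IsCenteredGaussian (gaussianMeasure (covOp S Q t)) (covOp S Q t) := by
  refine gaussianMeasure_spec ?_
  obtain ⟨T, hT, hTe⟩ := exists_isPositive_eq_covOp hS hω₀ hω hQ ht
  obtain ⟨w, b, -⟩ := exists_hilbertBasis ℝ H
  rw [← hTe]
  refine exists_isCenteredGaussian hT b ?_
  rcases ht.eq_or_lt with rfl | h0
  · rw [hTe]
    simp only [covOp, intervalIntegral.integral_same, inner_zero_left]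
    exact summable_zero
  · rw [hTe]
    exact (hQt t h0).summable_inner (fun x => by rw [← hTe]; exact hT.2 x) b

theorem isMehlerFamily_gaussianMeasure (hS : IsStronglyContinuousSemigroup S)
    (hω₀ : 0 ≤ ω) (hω : ∀ t : ℝ, 0 ≤ t → ‖S t‖ ≤ Real.exp (ω * t)) (hQ : Q.IsPositive)
    (hQt : ∀ t : ℝ, 0 < t → IsTraceClass (covOp S Q t)) :
    IsMehlerFamily S ω fun t => gaussianMeasure (covOp S Q t) where
  semigroup := hS
  omega_nonneg := hω₀
  norm_le := hω
  zero := by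
    have h := isCenteredGaussian_gaussianMeasure_covOp hS hω₀ hω hQ hQt le_rfl
    refine Measure.ext_of_charFun ?_
    ext x
    rw [h.charFun]
    simp [covOp, charFun_dirac]
  conv s t hs ht := by
    have hs' := isCenteredGaussian_gaussianMeasure_covOp hS hω₀ hω hQ hQt hs
    have ht' := isCenteredGaussian_gaussianMeasure_covOp hS hω₀ hω hQ hQt ht
    have hst' := isCenteredGaussian_gaussianMeasure_covOp hS hω₀ hω hQ hQt (add_nonneg hs ht)
    have := Measure.isProbabilityMeasure_map (μ := gaussianMeasure (covOp S Q t))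
      (f := S s) (by fun_prop)
    refine Measure.ext_of_charFun ?_
    ext x
    have hmap : charFun ((gaussianMeasure (covOp S Q t)).map (S s)) x =
        charFun (gaussianMeasure (covOp S Q t)) (ContinuousLinearMap.adjoint (S s) x) := by
      rw [charFun_apply, charFun_apply, integral_map (by fun_prop) (by fun_prop)]
      simp only [ContinuousLinearMap.adjoint_inner_right]
    rw [charFun_conv, hmap, hs'.charFun, ht'.charFun, hst'.charFun, ← Complex.exp_add,
      covOp_add hS hω₀ hω hs ht, inner_add_left, ← ContinuousLinearMap.adjoint_inner_right]
    congr 1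
    push_cast
    ring
  integrable_sq t ht :=
    (isCenteredGaussian_gaussianMeasure_covOp hS hω₀ hω hQ hQt ht).integrable_norm_sq
  tendsto_sq := by
    obtain ⟨w, b, -⟩ := exists_hilbertBasis ℝ H
    have := HilbertBasis.countable b
    have hsum := fun t (ht : 0 ≤ t) =>
      (isCenteredGaussian_gaussianMeasure_covOp hS hω₀ hω hQ hQt ht).hasSum_integral_norm_sq b
    have hnonneg : ∀ t, 0 ≤ t → ∀ x, 0 ≤ (⟪covOp S Q t x, x⟫ : ℝ) := fun t ht x => by
      obtain ⟨T, hT, hTe⟩ := exists_isPositive_eq_covOp hS hω₀ hω hQ ht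
      rw [← hTe]
      exact hT.2 x
    have hmem : Ioo (0 : ℝ) 1 ∈ 𝓝[>] (0 : ℝ) := Ioo_mem_nhdsGT one_pos
    have key : Tendsto (fun t => ∑' i, (⟪covOp S Q t (b i), b i⟫ : ℝ)) (𝓝[>] 0)
        (𝓝 (∑' _ : w, (0 : ℝ))) := by
      refine tendsto_tsum_of_dominated_convergence
        (bound := fun i => (⟪covOp S Q 1 (b i), b i⟫ : ℝ)) (hsum 1 zero_le_one).summable
        (fun i => ?_) ?_
      · have hlim : Tendsto (fun t : ℝ => Real.exp (ω * t) ^ 2 * ‖Q‖ * ‖b i‖ * t * ‖b i‖) (𝓝[>] 0)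
            (𝓝 0) := by
          have hc : Continuous fun t : ℝ => Real.exp (ω * t) ^ 2 * ‖Q‖ * ‖b i‖ * t * ‖b i‖ := by
            fun_prop
          simpa using (hc.tendsto 0).mono_left nhdsWithin_le_nhds
        refine squeeze_zero' ?_ ?_ hlim
        · filter_upwards [hmem] with t ht using hnonneg t ht.1.le _
        · filter_upwards [hmem] with t ht
          exact (real_inner_le_norm _ _).trans
            (mul_le_mul_of_nonneg_right (norm_covOp_le hω₀ hω _ ht.1.le) (norm_nonneg _))
      · filter_upwards [hmem] with t ht i
        rw [Real.norm_of_nonneg (hnonneg t ht.1.le _)]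
        exact covOp_inner_self_le hS hω₀ hω hQ ht.1.le ht.2.le _
    rw [tsum_zero] at key
    refine key.congr' ?_
    filter_upwards [hmem] with t ht using (hsum t ht.1.le).tsum_eq

end Family

/-! ### Functions of class `C_b^1` with a prescribed modulus of continuity of the differential -/

section COneBound

variable {E : Type*} [NormedAddCommGroup E] [NormedSpace ℝ E]

/-- A bounded uniformly continuous function has a family of affine moduli of continuity
`r ↦ ε + K(ε) r`. -/
theorem exists_affine_modulus {V : Type*} [NormedAddCommGroup V] {g : E → V} {B : ℝ}
    (hB : ∀ x, ‖g x‖ ≤ B) (hg : UniformContinuous g) :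
    ∃ K : ℝ → ℝ, (∀ ε, 0 ≤ K ε) ∧ ∀ ε, 0 < ε → ∀ x y, ‖g x - g y‖ ≤ ε + K ε * ‖x - y‖ := by
  have hB0 : 0 ≤ B := (norm_nonneg _).trans (hB 0)
  have key : ∀ ε : ℝ, ∃ k, 0 ≤ k ∧ (0 < ε → ∀ x y, ‖g x - g y‖ ≤ ε + k * ‖x - y‖) := by
    intro ε
    by_cases hε : 0 < ε
    · obtain ⟨δ, hδ, hgδ⟩ := Metric.uniformContinuous_iff.1 hg ε hε
      refine ⟨2 * B / δ, by positivity, fun _ x y => ?_⟩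
      have h0 : 0 ≤ 2 * B / δ * ‖x - y‖ := by positivity
      rcases lt_or_ge ‖x - y‖ δ with h | h
      · have := hgδ (a := x) (b := y) (by rwa [dist_eq_norm])
        rw [dist_eq_norm] at this
        linarith
      · have h1 : 2 * B / δ * δ ≤ 2 * B / δ * ‖x - y‖ := by gcongr
        rw [div_mul_cancel₀ _ hδ.ne'] at h1
        linarith [norm_sub_le (g x) (g y), hB x, hB y]
    · exact ⟨0, le_rfl, fun h => absurd h hε⟩
  choose K hK0 hK using key
  exact ⟨K, hK0, hK⟩

/-- `u` is differentiable, `B` bounds its differential, and `C (ε + K(ε) r)` is, for each `ε > 0`,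
a modulus of continuity of its differential. Affine moduli of this kind are stable, up to the
constant `C`, under composition with Lipschitz maps. -/
structure HasCOneBound (K : ℝ → ℝ) (u : E → ℝ) (B C : ℝ) : Prop where
  differentiable : Differentiable ℝ u
  norm_le : ∀ x, ‖fderiv ℝ u x‖ ≤ B
  modulus : ∀ ε, 0 < ε → ∀ x y, ‖fderiv ℝ u x - fderiv ℝ u y‖ ≤ C * (ε + K ε * ‖x - y‖)

variable {K : ℝ → ℝ} {u : E → ℝ} {B C : ℝ}

theorem HasCOneBound.nonneg (h : HasCOneBound K u B C) : 0 ≤ B :=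
  (norm_nonneg _).trans (h.norm_le 0)

theorem HasCOneBound.nonneg_right (h : HasCOneBound K u B C) : 0 ≤ C := by
  have := (norm_nonneg _).trans (h.modulus 1 one_pos 0 0)
  simpa using this

theorem HasCOneBound.mono (h : HasCOneBound K u B C) (hK : ∀ ε, 0 ≤ K ε) {B' C' : ℝ} (hB : B ≤ B')
    (hC : C ≤ C') : HasCOneBound K u B' C' where
  differentiable := h.differentiable
  norm_le x := (h.norm_le x).trans hB
  modulus ε hε x y := (h.modulus ε hε x y).trans (by have := hK ε; gcongr)

theorem HasCOneBound.uniformContinuous_fderiv (h : HasCOneBound K u B C) (hK : ∀ ε, 0 ≤ K ε) :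
    UniformContinuous (fderiv ℝ u) := by
  have hC := h.nonneg_right
  rw [Metric.uniformContinuous_iff]
  intro ε hε
  set η := ε / (2 * (C + 1)) with hη
  have hη0 : 0 < η := by positivity
  have hKη := hK η
  refine ⟨η / (K η + 1), by positivity, fun {x y} hxy => ?_⟩
  rw [dist_eq_norm] at hxy ⊢
  have h1 : ‖x - y‖ * (K η + 1) < η := (lt_div_iff₀ (by positivity)).1 hxy
  have h2 : K η * ‖x - y‖ ≤ η := by nlinarith [norm_nonneg (x - y)]
  calc _ ≤ C * (η + K η * ‖x - y‖) := h.modulus η hη0 x y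
    _ ≤ C * (η + η) := by gcongr
    _ < (C + 1) * (η + η) := by nlinarith
    _ = ε := by rw [hη]; field_simp; ring

theorem HasCOneBound.taylor (h : HasCOneBound K u B C) (hK : ∀ ε, 0 ≤ K ε) {ε : ℝ} (hε : 0 < ε)
    (x k : E) : |u (x + k) - u x - fderiv ℝ u x k| ≤ C * (ε + K ε * ‖k‖) * ‖k‖ := by
  have hC := h.nonneg_right
  have hKε := hK ε
  have := (convex_closedBall x ‖k‖).norm_image_sub_le_of_norm_fderiv_le' (𝕜 := ℝ) (f := u)
    (φ := fderiv ℝ u x) (C := C * (ε + K ε * ‖k‖)) (x := x) (y := x + k)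
    (fun z _ => h.differentiable z) (fun z hz => ?_) (Metric.mem_closedBall_self (norm_nonneg _))
    (by simp)
  · simpa using this
  · rw [mem_closedBall_iff_norm] at hz
    exact (h.modulus ε hε z x).trans (by gcongr)

theorem hasFDerivAt_of_taylor {D : E →L[ℝ] ℝ} {x : E} {A : ℝ} (hA : 0 ≤ A) (hK : ∀ ε, 0 ≤ K ε)
    (h : ∀ ε, 0 < ε → ∀ k, |u (x + k) - u x - D k| ≤ A * (ε + K ε * ‖k‖) * ‖k‖) :
    HasFDerivAt u D x := by
  rw [hasFDerivAt_iff_isLittleO_nhds_zero, Asymptotics.isLittleO_iff]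
  intro c hc
  set η := c / (2 * (A + 1)) with hη
  have hη0 : 0 < η := by positivity
  have hKη := hK η
  filter_upwards [Metric.ball_mem_nhds (0 : E) (show 0 < η / (K η + 1) by positivity)] with k hk
  rw [mem_ball_zero_iff] at hk
  have h1 : ‖k‖ * (K η + 1) < η := (lt_div_iff₀ (by positivity)).1 hk
  have h2 : K η * ‖k‖ ≤ η := by nlinarith [norm_nonneg k]
  refine (h η hη0 k).trans (mul_le_mul_of_nonneg_right ?_ (norm_nonneg k))
  calc _ ≤ A * (η + η) := by gcongr
    _ ≤ (A + 1) * (η + η) := by nlinarith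
    _ = c := by rw [hη]; field_simp; ring

/-- Differentiation under the integral sign: the constants are integrated. Only scalar integrals of
the directional derivatives are used, so no measurability of the differentials as operators is
needed. -/
theorem HasCOneBound.integral {Ω : Type*} [MeasurableSpace Ω] {ν : Measure Ω} {G : Ω → E → ℝ}
    {w : Ω → ℝ} (hK : ∀ ε, 0 ≤ K ε) (hw : Integrable w ν) (hB : 0 ≤ B) (hC : 0 ≤ C)
    (hw₀ : ∀ᵐ p ∂ν, 0 ≤ w p)
    (hG : ∀ᵐ p ∂ν, HasCOneBound K (G p) (B * w p) (C * w p))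
    (hint : ∀ x, Integrable (fun p => G p x) ν) :
    HasCOneBound K (fun x => ∫ p, G p x ∂ν) (B * ∫ p, w p ∂ν) (C * ∫ p, w p ∂ν) := by
  have hW : 0 ≤ ∫ p, w p ∂ν := integral_nonneg_of_ae hw₀
  have hmeas : ∀ x k, AEStronglyMeasurable (fun p => fderiv ℝ (G p) x k) ν := by
    intro x k
    refine aestronglyMeasurable_of_tendsto_ae (atTop : Filter ℕ)
      (f := fun (n : ℕ) p => (n : ℝ) • (G p (x + (n : ℝ)⁻¹ • k) - G p x)) (fun n => ?_) ?_
    · exact (((hint _).sub (hint _)).const_mul (n : ℝ)).1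
    · filter_upwards [hG] with p hp
      refine (hp.differentiable x).hasFDerivAt.lim k (c := fun n : ℕ => (n : ℝ)) ?_
      simpa using tendsto_natCast_atTop_atTop (R := ℝ)
  have hbd : ∀ x k, ∀ᵐ p ∂ν, ‖fderiv ℝ (G p) x k‖ ≤ B * w p * ‖k‖ := by
    intro x k
    filter_upwards [hG] with p hp
    exact (fderiv ℝ (G p) x).le_of_opNorm_le (hp.norm_le x) k
  have hdint : ∀ x k, Integrable (fun p => fderiv ℝ (G p) x k) ν := fun x k =>
    ((hw.const_mul B).mul_const ‖k‖).mono' (hmeas x k) (hbd x k)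
  have hle : ∀ x k, ‖∫ p, fderiv ℝ (G p) x k ∂ν‖ ≤ (B * ∫ p, w p ∂ν) * ‖k‖ := by
    intro x k
    refine (norm_integral_le_of_norm_le ((hw.const_mul B).mul_const ‖k‖) (hbd x k)).trans
      (le_of_eq ?_)
    rw [integral_mul_const, integral_const_mul]
  let D : E → E →L[ℝ] ℝ := fun x => LinearMap.mkContinuous
    { toFun := fun k => ∫ p, fderiv ℝ (G p) x k ∂ν
      map_add' := fun k l => by
        simp only [map_add]
        exact integral_add (hdint x k) (hdint x l)
      map_smul' := fun c k => by
        simp only [map_smul]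
        exact integral_smul c _ } (B * ∫ p, w p ∂ν) (hle x)
  have hD : ∀ x k, D x k = ∫ p, fderiv ℝ (G p) x k ∂ν := fun x k => rfl
  have hder : ∀ x, HasFDerivAt (fun x => ∫ p, G p x ∂ν) (D x) x := by
    intro x
    refine hasFDerivAt_of_taylor (K := K) (A := C * ∫ p, w p ∂ν) (by positivity) hK
      fun ε hε k => ?_
    have h12 : Integrable (fun p => G p (x + k) - G p x) ν := (hint _).sub (hint _)
    rw [hD, ← integral_sub (hint _) (hint _), ← integral_sub h12 (hdint x k)]
    have h1 : ∀ᵐ p ∂ν, ‖G p (x + k) - G p x - fderiv ℝ (G p) x k‖ ≤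
        C * w p * (ε + K ε * ‖k‖) * ‖k‖ := by
      filter_upwards [hG] with p hp using hp.taylor hK hε x k
    refine (norm_integral_le_of_norm_le
      (((hw.const_mul C).mul_const (ε + K ε * ‖k‖)).mul_const ‖k‖) h1).trans (le_of_eq ?_)
    rw [integral_mul_const, integral_mul_const, integral_const_mul]
  have hfd : fderiv ℝ (fun x => ∫ p, G p x ∂ν) = D := funext fun x => (hder x).fderiv
  refine ⟨fun x => (hder x).differentiableAt, fun x => ?_, fun ε hε x y => ?_⟩
  · rw [hfd]
    exact LinearMap.mkContinuous_norm_le _ (by positivity) _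
  · have hKε := hK ε
    rw [hfd]
    refine ContinuousLinearMap.opNorm_le_bound _ (by positivity) fun k => ?_
    rw [sub_apply, hD, hD, ← integral_sub (hdint x k) (hdint y k)]
    have h1 : ∀ᵐ p ∂ν, ‖fderiv ℝ (G p) x k - fderiv ℝ (G p) y k‖ ≤
        C * w p * (ε + K ε * ‖x - y‖) * ‖k‖ := by
      filter_upwards [hG] with p hp
      exact (fderiv ℝ (G p) x - fderiv ℝ (G p) y).le_of_opNorm_le (hp.modulus ε hε x y) k
    refine (norm_integral_le_of_norm_le
      (((hw.const_mul C).mul_const (ε + K ε * ‖x - y‖)).mul_const ‖k‖) h1).trans (le_of_eq ?_)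
    rw [integral_mul_const, integral_mul_const, integral_const_mul]

/-- Composition with the affine map `x ↦ L x + y`. -/
theorem HasCOneBound.comp_affine (h : HasCOneBound K u B C) (hK : ∀ ε, 0 ≤ K ε) (L : E →L[ℝ] E)
    (y : E) {a : ℝ} (ha : 1 ≤ a) (hL : ‖L‖ ≤ a) :
    HasCOneBound K (fun x => u (L x + y)) (B * a ^ 2) (C * a ^ 2) := by
  have hB := h.nonneg
  have hC := h.nonneg_right
  have hder : ∀ x, HasFDerivAt (fun x => u (L x + y)) ((fderiv ℝ u (L x + y)).comp L) x :=
    fun x => (h.differentiable (L x + y)).hasFDerivAt.comp x (L.hasFDerivAt.add_const y)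
  have hfd : ∀ x, fderiv ℝ (fun x => u (L x + y)) x = (fderiv ℝ u (L x + y)).comp L :=
    fun x => (hder x).fderiv
  refine ⟨fun x => (hder x).differentiableAt, fun x => ?_, fun ε hε x z => ?_⟩
  · rw [hfd]
    calc _ ≤ ‖fderiv ℝ u (L x + y)‖ * ‖L‖ := ContinuousLinearMap.opNorm_comp_le _ _
      _ ≤ B * a := by gcongr; exact h.norm_le _
      _ ≤ B * a ^ 2 := by gcongr; nlinarith
  · have hKε := hK ε
    rw [hfd, hfd, ← ContinuousLinearMap.sub_comp]
    have h1 : ‖L x + y - (L z + y)‖ ≤ a * ‖x - z‖ := by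
      rw [add_sub_add_right_eq_sub, ← map_sub]
      exact L.le_of_opNorm_le hL _
    calc _ ≤ ‖fderiv ℝ u (L x + y) - fderiv ℝ u (L z + y)‖ * ‖L‖ :=
          ContinuousLinearMap.opNorm_comp_le _ _
      _ ≤ (C * (ε + K ε * (a * ‖x - z‖))) * a := by
          gcongr
          exact (h.modulus ε hε _ _).trans (by gcongr)
      _ ≤ (C * (a * ε + K ε * (a * ‖x - z‖))) * a := by
          gcongr
          nlinarith
      _ = _ := by ring

/-- Composition with the Euler step `x ↦ x + h F(x)` of the vector field `F`. -/
theorem HasCOneBound.comp_euler {F : E → E} {M h : ℝ} (hu : HasCOneBound K u B C)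
    (hK : ∀ ε, 0 ≤ K ε) (hF : Differentiable ℝ F) (hM : ∀ x, ‖fderiv ℝ F x‖ ≤ M)
    (hFK : ∀ ε, 0 < ε → ∀ x y, ‖fderiv ℝ F x - fderiv ℝ F y‖ ≤ ε + K ε * ‖x - y‖) (hh : 0 ≤ h) :
    HasCOneBound K (fun x => u (x + h • F x)) (B * (1 + h * M) ^ 2)
      (C * (1 + h * M) ^ 2 + h * B) := by
  have hB := hu.nonneg
  have hC := hu.nonneg_right
  have hM0 : 0 ≤ M := (norm_nonneg _).trans (hM 0)
  have hstep : ∀ x, HasFDerivAt (fun x => x + h • F x)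
      (ContinuousLinearMap.id ℝ E + h • fderiv ℝ F x) x := fun x =>
    (hasFDerivAt_id x).add ((hF x).hasFDerivAt.const_smul h)
  have hder : ∀ x, HasFDerivAt (fun x => u (x + h • F x))
      ((fderiv ℝ u (x + h • F x)).comp (ContinuousLinearMap.id ℝ E + h • fderiv ℝ F x)) x :=
    fun x => (hu.differentiable (x + h • F x)).hasFDerivAt.comp x (hstep x)
  have hfd : ∀ x, fderiv ℝ (fun x => u (x + h • F x)) x =
      (fderiv ℝ u (x + h • F x)).comp (ContinuousLinearMap.id ℝ E + h • fderiv ℝ F x) :=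
    fun x => (hder x).fderiv
  have hA : ∀ x, ‖ContinuousLinearMap.id ℝ E + h • fderiv ℝ F x‖ ≤ 1 + h * M := fun x => by
    refine (norm_add_le _ _).trans (add_le_add ContinuousLinearMap.norm_id_le ?_)
    rw [norm_smul, Real.norm_of_nonneg hh]
    exact mul_le_mul_of_nonneg_left (hM x) hh
  have hlip : ∀ x y, ‖(x + h • F x) - (y + h • F y)‖ ≤ (1 + h * M) * ‖x - y‖ := fun x y =>
    convex_univ.norm_image_sub_le_of_norm_hasFDerivWithin_le (𝕜 := ℝ)
      (fun z _ => (hstep z).hasFDerivWithinAt) (fun z _ => hA z) (mem_univ y) (mem_univ x)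
  have h1 : 1 ≤ 1 + h * M := by nlinarith [mul_nonneg hh hM0]
  refine ⟨fun x => (hder x).differentiableAt, fun x => ?_, fun ε hε x y => ?_⟩
  · rw [hfd]
    calc _ ≤ ‖fderiv ℝ u (x + h • F x)‖ * ‖ContinuousLinearMap.id ℝ E + h • fderiv ℝ F x‖ :=
          ContinuousLinearMap.opNorm_comp_le _ _
      _ ≤ B * (1 + h * M) := by
          gcongr
          exacts [hu.norm_le _, hA x]
      _ ≤ B * (1 + h * M) ^ 2 := by gcongr; nlinarith
  · have hKε := hK ε
    rw [hfd, hfd]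
    set P := fderiv ℝ u (x + h • F x)
    set R := fderiv ℝ u (y + h • F y)
    set Ax := ContinuousLinearMap.id ℝ E + h • fderiv ℝ F x with hAx
    set Ay := ContinuousLinearMap.id ℝ E + h • fderiv ℝ F y with hAy
    have e : P.comp Ax - R.comp Ay = (P - R).comp Ax + R.comp (Ax - Ay) := by
      ext k
      simp
    have hAxy : ‖Ax - Ay‖ ≤ h * (ε + K ε * ‖x - y‖) := by
      rw [hAx, hAy, add_sub_add_left_eq_sub, ← smul_sub, norm_smul, Real.norm_of_nonneg hh]
      exact mul_le_mul_of_nonneg_left (hFK ε hε x y) hh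
    have hPR : ‖P - R‖ ≤ C * ((1 + h * M) * (ε + K ε * ‖x - y‖)) := by
      refine (hu.modulus ε hε _ _).trans (mul_le_mul_of_nonneg_left ?_ hC)
      calc _ ≤ ε + K ε * ((1 + h * M) * ‖x - y‖) := by gcongr; exact hlip x y
        _ ≤ (1 + h * M) * ε + K ε * ((1 + h * M) * ‖x - y‖) := by gcongr; nlinarith
        _ = _ := by ring
    rw [e]
    calc _ ≤ ‖P - R‖ * ‖Ax‖ + ‖R‖ * ‖Ax - Ay‖ := (norm_add_le _ _).trans
          (add_le_add (ContinuousLinearMap.opNorm_comp_le _ _)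
            (ContinuousLinearMap.opNorm_comp_le _ _))
      _ ≤ C * ((1 + h * M) * (ε + K ε * ‖x - y‖)) * (1 + h * M) +
          B * (h * (ε + K ε * ‖x - y‖)) := by
          gcongr
          exacts [hA x, hu.norm_le _]
      _ = _ := by ring

theorem HasCOneBound.add {v : E → ℝ} {B' C' : ℝ} (hu : HasCOneBound K u B C)
    (hv : HasCOneBound K v B' C') : HasCOneBound K (fun x => u x + v x) (B + B') (C + C') := by
  have hfd : ∀ x, fderiv ℝ (fun x => u x + v x) x = fderiv ℝ u x + fderiv ℝ v x := fun x =>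
    fderiv_fun_add (hu.differentiable x) (hv.differentiable x)
  refine ⟨hu.differentiable.add hv.differentiable, fun x => ?_, fun ε hε x y => ?_⟩
  · rw [hfd]
    exact norm_add_le_of_le (hu.norm_le x) (hv.norm_le x)
  · rw [hfd, hfd, add_sub_add_comm, add_mul]
    exact norm_add_le_of_le (hu.modulus ε hε x y) (hv.modulus ε hε x y)

theorem HasCOneBound.const_mul {c : ℝ} (hc : 0 ≤ c) (hu : HasCOneBound K u B C) :
    HasCOneBound K (fun x => c * u x) (c * B) (c * C) := by
  have hfd : ∀ x, fderiv ℝ (fun x => c * u x) x = c • fderiv ℝ u x := fun x =>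
    fderiv_const_mul (hu.differentiable x) c
  refine ⟨hu.differentiable.const_mul c, fun x => ?_, fun ε hε x y => ?_⟩
  · rw [hfd, norm_smul, Real.norm_of_nonneg hc]
    exact mul_le_mul_of_nonneg_left (hu.norm_le x) hc
  · rw [hfd, hfd, ← smul_sub, norm_smul, Real.norm_of_nonneg hc, mul_assoc]
    exact mul_le_mul_of_nonneg_left (hu.modulus ε hε x y) hc

end COneBound

/-! ### The transition semigroup of a Mehler family -/

section Mehler

variable {H : Type*} [NormedAddCommGroup H] [InnerProductSpace ℝ H] [MeasurableSpace H]

/-- The operator `φ ↦ ∫ φ(S_t · + y) N_t(dy)`. -/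
noncomputable def mehler (S : ℝ → H →L[ℝ] H) (N : ℝ → Measure H) (t : ℝ) (φ : H → ℝ) (x : H) : ℝ :=
  ∫ y, φ (S t x + y) ∂(N t)

variable [BorelSpace H] [SecondCountableTopology H] {S : ℝ → H →L[ℝ] H} {ω : ℝ}
  {N : ℝ → Measure H} [∀ t, IsProbabilityMeasure (N t)]

theorem integrable_of_bounded_continuous {μ : Measure H} [IsFiniteMeasure μ] {f : H → ℝ} {C : ℝ}
    (hf : Continuous f) (hC : ∀ x, |f x| ≤ C) : Integrable f μ :=
  Integrable.of_bound (hf.aestronglyMeasurable) C (Eventually.of_forall hC)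

theorem abs_integral_le_of_forall {μ : Measure H} [IsProbabilityMeasure μ] {f : H → ℝ} {C : ℝ}
    (hC : ∀ x, |f x| ≤ C) : |∫ x, f x ∂μ| ≤ C := by
  have := norm_integral_le_of_norm_le_const (μ := μ) (f := f) (Eventually.of_forall hC)
  simpa using this

theorem Cb.continuous (φ : Cb H) : Continuous (φ : H →ᵇ ℝ) := (φ : H →ᵇ ℝ).continuous

theorem mehler_integrable (t : ℝ) (φ : Cb H) (x : H) :
    Integrable (fun y => (φ : H →ᵇ ℝ) (S t x + y)) (N t) :=
  integrable_of_bounded_continuous ((Cb.continuous φ).comp (by fun_prop))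
    fun _ => abs_apply_le_norm φ _

theorem abs_mehler_le (t : ℝ) (φ : Cb H) (x : H) : |mehler S N t (φ : H →ᵇ ℝ) x| ≤ ‖φ‖ :=
  abs_integral_le_of_forall fun _ => abs_apply_le_norm φ _

theorem abs_mehler_sub_le (t : ℝ) (φ : Cb H) {x x' : H} {C : ℝ}
    (h : ∀ y, |(φ : H →ᵇ ℝ) (S t x + y) - (φ : H →ᵇ ℝ) (S t x' + y)| ≤ C) :
    |mehler S N t (φ : H →ᵇ ℝ) x - mehler S N t (φ : H →ᵇ ℝ) x'| ≤ C := by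
  rw [mehler, mehler, ← integral_sub (mehler_integrable t φ x) (mehler_integrable t φ x')]
  exact abs_integral_le_of_forall h

theorem uniformContinuous_mehler (t : ℝ) (φ : Cb H) :
    UniformContinuous (mehler S N t (φ : H →ᵇ ℝ)) := by
  have hS : UniformContinuous (S t) := (S t).uniformContinuous
  rw [Metric.uniformContinuous_iff]
  intro ε hε
  obtain ⟨δ, hδ, hφ⟩ := Metric.uniformContinuous_iff.1 φ.2 (ε / 2) (by positivity)
  obtain ⟨η, hη, hSη⟩ := Metric.uniformContinuous_iff.1 hS δ hδ
  refine ⟨η, hη, fun {x x'} hx => ?_⟩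
  have h1 : dist (S t x) (S t x') < δ := hSη hx
  have h2 := abs_mehler_sub_le (S := S) (N := N) t φ (x := x) (x' := x') (C := ε / 2) fun y =>
    (hφ (a := S t x + y) (b := S t x' + y) (by rwa [dist_add_right])).le
  rw [Real.dist_eq]
  linarith

variable (S N) in
/-- The transition operator on `C_b(H)`. -/
noncomputable def mehlerCb (t : ℝ) (φ : Cb H) : Cb H :=
  Cb.mk (mehler S N t (φ : H →ᵇ ℝ)) (uniformContinuous_mehler t φ) ‖φ‖ (abs_mehler_le t φ)

theorem mehlerCb_coe (t : ℝ) (φ : Cb H) :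
    ⇑((mehlerCb S N t φ : Cb H) : H →ᵇ ℝ) = mehler S N t (φ : H →ᵇ ℝ) := rfl

theorem IsMehlerFamily.mehler_zero [CompleteSpace H] (hN : IsMehlerFamily S ω N) (φ : H → ℝ)
    (x : H) : mehler S N 0 φ x = φ x := by
  rw [mehler, hN.zero, integral_dirac, add_zero, hN.semigroup.zero]
  rfl

theorem IsMehlerFamily.mehler_add [CompleteSpace H] (hN : IsMehlerFamily S ω N) {s t : ℝ}
    (hs : 0 ≤ s) (ht : 0 ≤ t) (φ : Cb H) (x : H) :
    mehler S N (s + t) (φ : H →ᵇ ℝ) x = mehler S N t (mehler S N s (φ : H →ᵇ ℝ)) x := by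
  have := Measure.isProbabilityMeasure_map (μ := N t) (f := S s) (by fun_prop)
  have hc : Continuous fun y => (φ : H →ᵇ ℝ) (S (s + t) x + y) := (Cb.continuous φ).comp (by fun_prop)
  rw [mehler, hN.conv s t hs ht, Measure.conv_comm, integral_conv, integral_map (by fun_prop)]
  · simp only [mehler]
    refine integral_congr_ae (Eventually.of_forall fun y => integral_congr_ae
      (Eventually.of_forall fun z => ?_))
    simp only
    rw [hN.semigroup.add s t hs ht, ContinuousLinearMap.comp_apply, (S s).map_add, add_assoc]
  · have h1 : Continuous fun p : H × H => (φ : H →ᵇ ℝ) (S (s + t) x + (p.1 + p.2)) :=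
      (Cb.continuous φ).comp (by fun_prop)
    exact (h1.stronglyMeasurable.integral_prod_right (ν := N s)).aestronglyMeasurable
  · exact integrable_of_bounded_continuous hc fun _ => abs_apply_le_norm φ _

/-- Continuity in time, quantitatively: the transition operators move a function with modulus
`ε + K r²` by a quantity governed by `‖S_r x - x‖²` and the second moment of `N_r`. -/
theorem IsMehlerFamily.abs_mehler_add_sub_le [CompleteSpace H] (hN : IsMehlerFamily S ω N)
    {φ : Cb H} {ε K : ℝ} (hK : 0 ≤ K)
    (hφ : ∀ x y, |(φ : H →ᵇ ℝ) x - (φ : H →ᵇ ℝ) y| ≤ ε + K * ‖x - y‖ ^ 2) {s r : ℝ} (hs : 0 ≤ s)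
    (hr : 0 ≤ r) (x : H) :
    |mehler S N (s + r) (φ : H →ᵇ ℝ) x - mehler S N s (φ : H →ᵇ ℝ) x| ≤
      ε + K * Real.exp (ω * s) ^ 2 * (2 * (‖S r x - x‖ ^ 2 + ∫ y, ‖y‖ ^ 2 ∂(N r))) := by
  set ψ := mehlerCb S N s φ with hψ
  set K' := K * Real.exp (ω * s) ^ 2 with hK'
  have hK'0 : 0 ≤ K' := by positivity
  have hmod : ∀ x y, |(ψ : H →ᵇ ℝ) x - (ψ : H →ᵇ ℝ) y| ≤ ε + K' * ‖x - y‖ ^ 2 := by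
    intro x y
    refine abs_mehler_sub_le s φ fun z => (hφ _ _).trans ?_
    rw [add_sub_add_right_eq_sub, ← map_sub, hK', mul_assoc, ← mul_pow]
    have := (S s).le_of_opNorm_le (hN.norm_le s hs) (x - y)
    gcongr
  have hint := (mehler_integrable (S := S) (N := N) r ψ x).sub (integrable_const ((ψ : H →ᵇ ℝ) x))
  have e : mehler S N (s + r) (φ : H →ᵇ ℝ) x - mehler S N s (φ : H →ᵇ ℝ) x =
      ∫ y, ((ψ : H →ᵇ ℝ) (S r x + y) - (ψ : H →ᵇ ℝ) x) ∂(N r) := by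
    rw [hN.mehler_add hs hr, integral_sub (mehler_integrable r ψ x) (integrable_const _)]
    simp [mehler, hψ, mehlerCb_coe]
  have hsq := hN.integrable_sq r hr
  rw [e]
  have hb : ∀ y, ‖(ψ : H →ᵇ ℝ) (S r x + y) - (ψ : H →ᵇ ℝ) x‖ ≤
      ε + K' * (2 * (‖S r x - x‖ ^ 2 + ‖y‖ ^ 2)) := by
    intro y
    refine (hmod _ _).trans ?_
    have h1 : ‖S r x + y - x‖ ≤ ‖S r x - x‖ + ‖y‖ := by
      rw [add_sub_right_comm]
      exact norm_add_le _ _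
    have h2 : ‖S r x + y - x‖ ^ 2 ≤ 2 * (‖S r x - x‖ ^ 2 + ‖y‖ ^ 2) := by
      have : ‖S r x + y - x‖ ^ 2 ≤ (‖S r x - x‖ + ‖y‖) ^ 2 := by gcongr
      nlinarith [sq_nonneg (‖S r x - x‖ - ‖y‖)]
    gcongr
  have hbi₀ : Integrable (fun y => ‖S r x - x‖ ^ 2 + ‖y‖ ^ 2) (N r) := (integrable_const _).add hsq
  have hbi₁ : Integrable (fun y => K' * (2 * (‖S r x - x‖ ^ 2 + ‖y‖ ^ 2))) (N r) :=
    (hbi₀.const_mul 2).const_mul K'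
  have hbi : Integrable (fun y => ε + K' * (2 * (‖S r x - x‖ ^ 2 + ‖y‖ ^ 2))) (N r) :=
    (integrable_const _).add hbi₁
  refine (norm_integral_le_of_norm_le hbi (Eventually.of_forall hb)).trans (le_of_eq ?_)
  rw [integral_add (integrable_const _) hbi₁, integral_const_mul, integral_const_mul, integral_add (integrable_const _) hsq]
  simp

theorem IsMehlerFamily.tendsto_displacement [CompleteSpace H] (hN : IsMehlerFamily S ω N) (x : H) :
    Tendsto (fun r => ‖S r x - x‖ ^ 2 + ∫ y, ‖y‖ ^ 2 ∂(N r)) (𝓝[≥] 0) (𝓝 0) := by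
  have h1 : Tendsto (fun r => ‖S r x - x‖ ^ 2) (𝓝[≥] 0) (𝓝 0) := by
    have h := ((hN.semigroup.continuousOn x 0 self_mem_Ici).tendsto.sub_const x).norm.pow 2
    simpa [hN.semigroup.zero] using h
  have h2 : Tendsto (fun r => ∫ y, ‖y‖ ^ 2 ∂(N r)) (𝓝[≥] 0) (𝓝 0) := by
    have h0 : ∫ y, ‖y‖ ^ 2 ∂(N 0) = 0 := by
      rw [hN.zero, integral_dirac]
      simp
    have : ContinuousWithinAt (fun r => ∫ y, ‖y‖ ^ 2 ∂(N r)) (Ici 0) 0 := by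
      rw [← continuousWithinAt_Ioi_iff_Ici, ContinuousWithinAt, h0]
      exact hN.tendsto_sq
    rw [ContinuousWithinAt, h0] at this
    exact this
  simpa using h1.add h2

/-- `t ↦ R_t φ(x)` is continuous on `[0, ∞)`. -/
theorem IsMehlerFamily.continuousOn_mehler [CompleteSpace H] (hN : IsMehlerFamily S ω N) (φ : Cb H)
    (x : H) : ContinuousOn (fun t => mehler S N t (φ : H →ᵇ ℝ) x) (Ici 0) := by
  intro t₀ ht₀
  rw [mem_Ici] at ht₀
  rw [Metric.continuousWithinAt_iff]
  intro ε hε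
  obtain ⟨K, hK, hφ⟩ := exists_quadratic_modulus (abs_apply_le_norm φ) φ.2
    (show 0 < ε / 2 by positivity)
  set A := K * Real.exp (ω * (t₀ + 1)) ^ 2 * 2 with hA
  have hlim := (hN.tendsto_displacement x).const_mul A
  rw [mul_zero] at hlim
  have hev := hlim.eventually (gt_mem_nhds (show 0 < ε / 2 by positivity))
  obtain ⟨δ, hδ, hsub⟩ := Metric.mem_nhdsWithin_iff.1 hev
  have hω := hN.omega_nonneg
  have key : ∀ s r, 0 ≤ s → 0 ≤ r → s ≤ t₀ + 1 → r < δ →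
      |mehler S N (s + r) (φ : H →ᵇ ℝ) x - mehler S N s (φ : H →ᵇ ℝ) x| < ε := by
    intro s r hs hr hsT hrδ
    have h1 := hN.abs_mehler_add_sub_le hK hφ hs hr x
    have h2 : A * (‖S r x - x‖ ^ 2 + ∫ y, ‖y‖ ^ 2 ∂(N r)) < ε / 2 :=
      hsub ⟨by rwa [mem_ball_zero_iff, Real.norm_of_nonneg hr], hr⟩
    have h0 : 0 ≤ ∫ y, ‖y‖ ^ 2 ∂(N r) := integral_nonneg fun y => by positivity
    have h3 : K * Real.exp (ω * s) ^ 2 * (2 * (‖S r x - x‖ ^ 2 + ∫ y, ‖y‖ ^ 2 ∂(N r))) ≤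
        A * (‖S r x - x‖ ^ 2 + ∫ y, ‖y‖ ^ 2 ∂(N r)) := by
      rw [hA, ← mul_assoc]
      gcongr
    linarith
  refine ⟨min δ 1, by positivity, fun t ht htd => ?_⟩
  rw [mem_Ici] at ht
  rw [Real.dist_eq] at htd ⊢
  have hd1 := htd.trans_le (min_le_left _ _)
  have hd2 := htd.trans_le (min_le_right _ _)
  rw [abs_lt] at hd1 hd2
  rcases le_total t₀ t with h | h
  · have := key t₀ (t - t₀) ht₀ (by linarith) (by linarith) (by linarith)
    rwa [add_sub_cancel] at this
  · have := key t (t₀ - t) ht (by linarith) (by linarith) (by linarith)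
    rwa [add_sub_cancel, abs_sub_comm] at this

/-- The transition operators preserve the `C_b^1` bounds up to the factor `e^{2ωt}`. -/
theorem IsMehlerFamily.hasCOneBound_mehler [CompleteSpace H] (hN : IsMehlerFamily S ω N)
    {K : ℝ → ℝ} (hK : ∀ ε, 0 ≤ K ε) {φ : Cb H} {B C : ℝ} (hφ : HasCOneBound K (φ : H →ᵇ ℝ) B C)
    {t : ℝ} (ht : 0 ≤ t) :
    HasCOneBound K (mehler S N t (φ : H →ᵇ ℝ)) (B * Real.exp (ω * t) ^ 2)
      (C * Real.exp (ω * t) ^ 2) := by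
  have hB := hφ.nonneg
  have hC := hφ.nonneg_right
  have ha : 1 ≤ Real.exp (ω * t) := Real.one_le_exp (mul_nonneg hN.omega_nonneg ht)
  have := HasCOneBound.integral (ν := N t) (K := K) (w := fun _ => 1)
    (G := fun y x => (φ : H →ᵇ ℝ) (S t x + y)) (B := B * Real.exp (ω * t) ^ 2)
    (C := C * Real.exp (ω * t) ^ 2) hK (integrable_const _) (by positivity) (by positivity)
    (Eventually.of_forall fun _ => zero_le_one)
    (Eventually.of_forall fun y => by
      rw [mul_one, mul_one]
      exact hφ.comp_affine hK (S t) y ha (hN.norm_le t ht))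
    (fun x => mehler_integrable t φ x)
  change HasCOneBound K (fun x => ∫ y, (φ : H →ᵇ ℝ) (S t x + y) ∂(N t)) _ _
  simpa using this

end Mehler

/-! ### The generator of a Mehler semigroup: dissipativity -/

section Generator

variable {H : Type*} [NormedAddCommGroup H] [InnerProductSpace ℝ H] [MeasurableSpace H]

/-- `g` is the generator of the transition semigroup applied to `φ`: the difference quotients
converge pointwise to `g` and are uniformly bounded. -/
def IsGeneratorValue (S : ℝ → H →L[ℝ] H) (N : ℝ → Measure H) (φ g : Cb H) : Prop :=
  (∀ x, Tendsto (fun t : ℝ => (mehler S N t (φ : H →ᵇ ℝ) x - (φ : H →ᵇ ℝ) x) / t)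
    (𝓝[>] 0) (𝓝 ((g : H →ᵇ ℝ) x))) ∧
  ∃ C : ℝ, ∀ t ∈ Ioo (0 : ℝ) 1, ∀ x,
    |(mehler S N t (φ : H →ᵇ ℝ) x - (φ : H →ᵇ ℝ) x) / t| ≤ C

theorem hasDerivWithinAt_Ici_of_tendsto_slope {u : ℝ → ℝ} {u' t : ℝ}
    (h : Tendsto (fun r => (u (t + r) - u t) / r) (𝓝[>] 0) (𝓝 u')) :
    HasDerivWithinAt u u' (Ici t) t := by
  rw [← hasDerivWithinAt_Ioi_iff_Ici, hasDerivWithinAt_iff_tendsto_slope' self_notMem_Ioi]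
  have h1 : Tendsto (fun s => s - t) (𝓝[>] t) (𝓝[>] 0) := by
    refine tendsto_nhdsWithin_iff.2 ⟨?_, ?_⟩
    · have : Tendsto (fun s => s - t) (𝓝 t) (𝓝 (t - t)) := tendsto_id.sub_const t
      rw [sub_self] at this
      exact this.mono_left nhdsWithin_le_nhds
    · filter_upwards [self_mem_nhdsWithin] with s (hs : t < s)
      exact sub_pos.2 hs
  refine (h.comp h1).congr fun s => ?_
  simp only [Function.comp_apply, add_sub_cancel, slope_def_field]

variable [BorelSpace H] [SecondCountableTopology H] [CompleteSpace H] {S : ℝ → H →L[ℝ] H} {ω : ℝ}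
  {N : ℝ → Measure H} [∀ t, IsProbabilityMeasure (N t)]

/-- For `φ` in the domain of the generator `L`, the map `t ↦ R_t φ(x)` has right derivative
`R_t L φ(x)`. -/
theorem IsMehlerFamily.hasDerivWithinAt_mehler (hN : IsMehlerFamily S ω N) {φ g : Cb H}
    (hφ : IsGeneratorValue S N φ g) {t : ℝ} (ht : 0 ≤ t) (x : H) :
    HasDerivWithinAt (fun t => mehler S N t (φ : H →ᵇ ℝ) x) (mehler S N t (g : H →ᵇ ℝ) x)
      (Ici t) t := by
  obtain ⟨hlim, C, hC⟩ := hφ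
  refine hasDerivWithinAt_Ici_of_tendsto_slope ?_
  have hmeas : ∀ r, Continuous fun y => (mehler S N r (φ : H →ᵇ ℝ) (S t x + y) -
      (φ : H →ᵇ ℝ) (S t x + y)) / r := fun r =>
    (((uniformContinuous_mehler r φ).continuous.comp (by fun_prop)).sub
      ((Cb.continuous φ).comp (by fun_prop))).div_const r
  have hdct : Tendsto (fun r => ∫ y, (mehler S N r (φ : H →ᵇ ℝ) (S t x + y) -
      (φ : H →ᵇ ℝ) (S t x + y)) / r ∂(N t)) (𝓝[>] 0) (𝓝 (mehler S N t (g : H →ᵇ ℝ) x)) := by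
    refine tendsto_integral_filter_of_dominated_convergence (fun _ => C)
      (Eventually.of_forall fun r => (hmeas r).aestronglyMeasurable) ?_ (integrable_const _)
      (Eventually.of_forall fun y => hlim _)
    filter_upwards [Ioo_mem_nhdsGT (zero_lt_one (α := ℝ))] with r hr
    exact Eventually.of_forall fun y => hC r hr _
  refine hdct.congr' ?_
  filter_upwards [self_mem_nhdsWithin] with r (hr : 0 < r)
  have hsub := integral_sub (mehler_integrable (S := S) (N := N) t (mehlerCb S N r φ) x)
    (mehler_integrable (S := S) (N := N) t φ x)
  rw [mehlerCb_coe] at hsub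
  rw [integral_div, add_comm t r, hN.mehler_add hr.le ht, hsub]
  rfl

/-- The generator is dissipative. -/
theorem IsGeneratorValue.le (hN : IsMehlerFamily S ω N) {φ g : Cb H}
    (hφ : IsGeneratorValue S N φ g) {l : ℝ} (hl : 0 < l) : l * ‖φ‖ ≤ ‖l • φ - g‖ := by
  set c := ‖l • φ - g‖ with hc
  have hc0 : 0 ≤ c := norm_nonneg (l • φ - g)
  have key : ∀ x, ∀ T, 0 ≤ T →
      |Real.exp (-l * T) * mehler S N T (φ : H →ᵇ ℝ) x - (φ : H →ᵇ ℝ) x| ≤ c / l := by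
    intro x T hT
    have hexp : ∀ t : ℝ, HasDerivAt (fun t => Real.exp (-l * t)) (Real.exp (-l * t) * -l) t :=
      fun t => by simpa using ((hasDerivAt_id t).const_mul (-l)).exp
    have hB : ∀ t : ℝ, HasDerivAt (fun t => c / l * (1 - Real.exp (-l * t)))
        (c * Real.exp (-l * t)) t := fun t => by
      have := ((hexp t).const_sub 1).const_mul (c / l)
      exact this.congr_deriv (by field_simp)
    have hderiv : ∀ t ∈ Ico (0 : ℝ) T, HasDerivWithinAt
        (fun t => Real.exp (-l * t) * mehler S N t (φ : H →ᵇ ℝ) x - (φ : H →ᵇ ℝ) x)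
        (Real.exp (-l * t) * -l * mehler S N t (φ : H →ᵇ ℝ) x +
          Real.exp (-l * t) * mehler S N t (g : H →ᵇ ℝ) x) (Ici t) t := fun t ht =>
      ((hexp t).hasDerivWithinAt.mul (hN.hasDerivWithinAt_mehler hφ ht.1 x)).sub_const _
    have hcont : ContinuousOn
        (fun t => Real.exp (-l * t) * mehler S N t (φ : H →ᵇ ℝ) x - (φ : H →ᵇ ℝ) x) (Icc 0 T) :=
      ((by fun_prop : Continuous fun t : ℝ => Real.exp (-l * t)).continuousOn.mul
        ((hN.continuousOn_mehler φ x).mono Icc_subset_Ici_self)).sub continuousOn_const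
    have := image_norm_le_of_norm_deriv_right_le_deriv_boundary' hcont hderiv
      (B := fun t => c / l * (1 - Real.exp (-l * t))) (B' := fun t => c * Real.exp (-l * t))
      (by simp [hN.mehler_zero _ x])
      (fun t _ => (hB t).continuousAt.continuousWithinAt) (fun t _ => (hB t).hasDerivWithinAt)
      (fun t _ => ?_) (right_mem_Icc.2 hT)
    · refine this.trans ?_
      have h1 := Real.exp_pos (-l * T)
      have h2 : 0 ≤ c / l := by positivity
      nlinarith
    · have e : Real.exp (-l * t) * -l * mehler S N t (φ : H →ᵇ ℝ) x +
          Real.exp (-l * t) * mehler S N t (g : H →ᵇ ℝ) x =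
          -(Real.exp (-l * t) * mehler S N t ((l • φ - g : Cb H) : H →ᵇ ℝ) x) := by
        have : mehler S N t ((l • φ - g : Cb H) : H →ᵇ ℝ) x =
            l * mehler S N t (φ : H →ᵇ ℝ) x - mehler S N t (g : H →ᵇ ℝ) x := by
          rw [mehler, mehler, mehler, ← integral_const_mul, ← integral_sub
            ((mehler_integrable t φ x).const_mul l) (mehler_integrable t g x)]
          rfl
        rw [this]
        ring
      rw [e, norm_neg, norm_mul, Real.norm_of_nonneg (Real.exp_pos _).le, mul_comm]
      exact mul_le_mul_of_nonneg_right (abs_mehler_le t _ x) (Real.exp_pos _).le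
  have hpt : ∀ x, |(φ : H →ᵇ ℝ) x| ≤ c / l := by
    intro x
    have he : Tendsto (fun T : ℝ => Real.exp (-l * T)) atTop (𝓝 0) := by
      have : Tendsto (fun T : ℝ => l * T) atTop atTop := tendsto_id.const_mul_atTop hl
      refine (Real.tendsto_exp_neg_atTop_nhds_zero.comp this).congr fun T => ?_
      simp
    have h0 : Tendsto (fun T : ℝ => Real.exp (-l * T) * mehler S N T (φ : H →ᵇ ℝ) x) atTop
        (𝓝 0) := by
      refine squeeze_zero_norm (fun T => ?_) (by simpa only [zero_mul] using he.mul_const ‖φ‖)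
      rw [norm_mul, Real.norm_of_nonneg (Real.exp_pos _).le]
      exact mul_le_mul_of_nonneg_left (abs_mehler_le T φ x) (Real.exp_pos _).le
    have h1 := (h0.sub_const ((φ : H →ᵇ ℝ) x)).abs
    rw [zero_sub, abs_neg] at h1
    exact le_of_tendsto h1 ((eventually_ge_atTop 0).mono fun T hT => key x T hT)
  have := norm_le_of_forall_abs_le (φ := φ) (by positivity) hpt
  rwa [le_div_iff₀ hl, mul_comm] at this

/-! ### The resolvent of the generator -/

variable (S N) in
/-- The Laplace transform `∫₀^∞ e^{-μt} R_t f(x) dt` of the transition semigroup. -/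
noncomputable def mehlerResolvent (μ : ℝ) (f : H → ℝ) (x : H) : ℝ :=
  ∫ t in Ioi (0 : ℝ), Real.exp (-μ * t) * mehler S N t f x

theorem IsMehlerFamily.continuous_mehler_max (hN : IsMehlerFamily S ω N) (φ : Cb H) (x : H) :
    Continuous fun t => mehler S N (max t 0) (φ : H →ᵇ ℝ) x :=
  (hN.continuousOn_mehler φ x).comp_continuous (by fun_prop) fun t => mem_Ici.2 (le_max_right t 0)

theorem IsMehlerFamily.integrableOn_exp_mul_mehler (hN : IsMehlerFamily S ω N) {μ : ℝ} (hμ : 0 < μ)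
    (φ : Cb H) (x : H) :
    IntegrableOn (fun t => Real.exp (-μ * t) * mehler S N t (φ : H →ᵇ ℝ) x) (Ioi 0) := by
  have h0 := (integrableOn_exp_mul_Ioi (neg_lt_zero.2 hμ) 0).mul_const ‖φ‖
  refine Integrable.mono' h0 ?_ (Eventually.of_forall fun t => ?_)
  · refine ContinuousOn.aestronglyMeasurable ?_ measurableSet_Ioi
    exact (by fun_prop : Continuous fun t : ℝ => Real.exp (-μ * t)).continuousOn.mul
        ((hN.continuousOn_mehler φ x).mono Ioi_subset_Ici_self)
  · rw [norm_mul, Real.norm_of_nonneg (Real.exp_pos _).le]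
    exact mul_le_mul_of_nonneg_left (abs_mehler_le t φ x) (Real.exp_pos _).le

theorem integral_exp_neg_mul_Ioi_zero {μ : ℝ} (hμ : 0 < μ) :
    ∫ t in Ioi (0 : ℝ), Real.exp (-μ * t) = 1 / μ := by
  rw [integral_exp_mul_Ioi (neg_lt_zero.2 hμ)]
  simp [neg_div_neg_eq]

theorem abs_mehlerResolvent_le {μ : ℝ} (hμ : 0 < μ)
    (φ : Cb H) (x : H) : |mehlerResolvent S N μ (φ : H →ᵇ ℝ) x| ≤ ‖φ‖ / μ := by
  have h0 := (integrableOn_exp_mul_Ioi (neg_lt_zero.2 hμ) 0).mul_const ‖φ‖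
  rw [mehlerResolvent, ← Real.norm_eq_abs]
  refine (norm_integral_le_of_norm_le h0 (Eventually.of_forall fun t => ?_)).trans (le_of_eq ?_)
  · rw [norm_mul, Real.norm_of_nonneg (Real.exp_pos _).le]
    exact mul_le_mul_of_nonneg_left (abs_mehler_le t φ x) (Real.exp_pos _).le
  · rw [integral_mul_const, integral_exp_neg_mul_Ioi_zero hμ]
    ring

theorem IsMehlerFamily.hasCOneBound_mehlerResolvent (hN : IsMehlerFamily S ω N) {K : ℝ → ℝ}
    (hK : ∀ ε, 0 ≤ K ε) {f : Cb H} {B C μ : ℝ} (hf : HasCOneBound K (f : H →ᵇ ℝ) B C)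
    (hμ : 2 * ω < μ) :
    HasCOneBound K (mehlerResolvent S N μ (f : H →ᵇ ℝ)) (B / (μ - 2 * ω)) (C / (μ - 2 * ω)) := by
  have hμ0 : 0 < μ := by linarith [hN.omega_nonneg]
  have hμω : 0 < μ - 2 * ω := by linarith
  have hw : ∫ t in Ioi (0 : ℝ), Real.exp (-(μ - 2 * ω) * t) = 1 / (μ - 2 * ω) :=
    integral_exp_neg_mul_Ioi_zero hμω
  have := HasCOneBound.integral (ν := volume.restrict (Ioi (0 : ℝ))) (K := K)
    (w := fun t => Real.exp (-(μ - 2 * ω) * t))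
    (G := fun t x => Real.exp (-μ * t) * mehler S N t (f : H →ᵇ ℝ) x) (B := B) (C := C) hK
    (integrableOn_exp_mul_Ioi (neg_lt_zero.2 hμω) 0) hf.nonneg hf.nonneg_right
    (Eventually.of_forall fun _ => (Real.exp_pos _).le)
    ((ae_restrict_mem measurableSet_Ioi).mono fun t ht => by
      have e : Real.exp (-(μ - 2 * ω) * t) = Real.exp (-μ * t) * Real.exp (ω * t) ^ 2 := by
        rw [← Real.exp_nat_mul, ← Real.exp_add]
        congr 1
        push_cast
        ring
      have := (hN.hasCOneBound_mehler hK hf (le_of_lt ht)).const_mul (Real.exp_pos (-μ * t)).le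
      rw [e]
      convert this using 1 <;> ring)
    (fun x => hN.integrableOn_exp_mul_mehler hμ0 f x)
  rw [hw, mul_one_div, mul_one_div] at this
  exact this

/-- `R_h G_μ f(x) = e^{μh} (G_μ f(x) - ∫₀ʰ e^{-μt} R_t f(x) dt)`, where `G_μ` is the resolvent. -/
theorem IsMehlerFamily.mehler_mehlerResolvent (hN : IsMehlerFamily S ω N) {μ : ℝ} (hμ : 0 < μ)
    (f : Cb H) {h : ℝ} (hh : 0 ≤ h) (x : H) :
    mehler S N h (mehlerResolvent S N μ (f : H →ᵇ ℝ)) x =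
      Real.exp (μ * h) * (mehlerResolvent S N μ (f : H →ᵇ ℝ) x -
        ∫ t in (0 : ℝ)..h, Real.exp (-μ * t) * mehler S N t (f : H →ᵇ ℝ) x) := by
  set a : ℝ → ℝ := fun t => Real.exp (-μ * t) * mehler S N t (f : H →ᵇ ℝ) x with ha
  have hai : IntegrableOn a (Ioi 0) := hN.integrableOn_exp_mul_mehler hμ f x
  have hswap : mehler S N h (mehlerResolvent S N μ (f : H →ᵇ ℝ)) x =
      ∫ t in Ioi (0 : ℝ), ∫ y, Real.exp (-μ * t) * mehler S N t (f : H →ᵇ ℝ) (S h x + y) ∂(N h) := by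
    have hsm : StronglyMeasurable (Function.uncurry fun (t : ℝ) (y : H) =>
        Real.exp (-μ * t) * mehler S N (max t 0) (f : H →ᵇ ℝ) (S h x + y)) := by
      refine stronglyMeasurable_uncurry_of_continuous_of_stronglyMeasurable (fun y => ?_)
        fun t => ?_
      · exact (by fun_prop : Continuous fun t : ℝ => Real.exp (-μ * t)).mul
          (hN.continuous_mehler_max f _)
      · exact (continuous_const.mul ((uniformContinuous_mehler (max t 0) f).continuous.comp
          (by fun_prop))).stronglyMeasurable
    have hint : Integrable (Function.uncurry fun (t : ℝ) (y : H) =>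
        Real.exp (-μ * t) * mehler S N (max t 0) (f : H →ᵇ ℝ) (S h x + y))
        ((volume.restrict (Ioi (0 : ℝ))).prod (N h)) := by
      have h0 := ((integrableOn_exp_mul_Ioi (neg_lt_zero.2 hμ) 0).mul_const ‖f‖).comp_fst (N h)
      refine h0.mono' hsm.aestronglyMeasurable (Eventually.of_forall fun p => ?_)
      rw [Function.uncurry, norm_mul, Real.norm_of_nonneg (Real.exp_pos _).le]
      exact mul_le_mul_of_nonneg_left (abs_mehler_le _ f _) (Real.exp_pos _).le
    have e := integral_integral_swap hint
    have e1 : ∀ y, mehlerResolvent S N μ (f : H →ᵇ ℝ) (S h x + y) =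
        ∫ t in Ioi (0 : ℝ), Real.exp (-μ * t) * mehler S N (max t 0) (f : H →ᵇ ℝ) (S h x + y) :=
      fun y => setIntegral_congr_fun measurableSet_Ioi fun t (ht : 0 < t) => by
        simp only [max_eq_left ht.le]
    simp only [mehler] at e1 e ⊢
    simp only [e1, ← e]
    exact setIntegral_congr_fun measurableSet_Ioi fun t (ht : 0 < t) => by
      simp only [max_eq_left ht.le]
  have hshift : ∀ g : ℝ → ℝ, ∫ t in Ioi (0 : ℝ), g (t + h) = ∫ t in Ioi h, g t := by
    intro g
    have := (measurePreserving_add_right (volume : Measure ℝ) h).setIntegral_preimage_emb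
      (measurableEmbedding_addRight h) g (Ioi h)
    rwa [preimage_add_const_Ioi, sub_self] at this
  have hsplit : (∫ t in Ioi (0 : ℝ), a t) - ∫ t in (0 : ℝ)..h, a t = ∫ t in Ioi h, a t := by
    rw [sub_eq_iff_eq_add', intervalIntegral.integral_of_le hh,
      ← setIntegral_union (Ioc_disjoint_Ioi le_rfl) measurableSet_Ioi
        (hai.mono_set Ioc_subset_Ioi_self) (hai.mono_set (Ioi_subset_Ioi hh)),
      Ioc_union_Ioi_eq_Ioi hh]
  rw [hswap, mehlerResolvent, hsplit, ← hshift, ← integral_const_mul]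
  refine setIntegral_congr_fun measurableSet_Ioi fun t (ht : 0 < t) => ?_
  simp only [ha]
  rw [integral_const_mul, hN.mehler_add ht.le hh, ← mul_assoc, ← Real.exp_add]
  congr 2
  ring

/-- The resolvent inverts `μ - L`. -/
theorem IsMehlerFamily.isGeneratorValue_mehlerResolvent (hN : IsMehlerFamily S ω N) {μ : ℝ}
    (hμ : 0 < μ) {f ψ : Cb H} (hψ : ⇑(ψ : H →ᵇ ℝ) = mehlerResolvent S N μ (f : H →ᵇ ℝ)) :
    IsGeneratorValue S N ψ (μ • ψ - f) := by
  set a : H → ℝ → ℝ := fun x t => Real.exp (-μ * t) * mehler S N (max t 0) (f : H →ᵇ ℝ) x with ha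
  have hac : ∀ x, Continuous (a x) := fun x =>
    (by fun_prop : Continuous fun t : ℝ => Real.exp (-μ * t)).mul (hN.continuous_mehler_max f _)
  have hR : ∀ h, 0 < h → ∀ x, mehler S N h (ψ : H →ᵇ ℝ) x =
      Real.exp (μ * h) * ((ψ : H →ᵇ ℝ) x - ∫ t in (0 : ℝ)..h, a x t) := by
    intro h hh x
    rw [hψ, hN.mehler_mehlerResolvent hμ f hh.le x]
    congr 2
    refine intervalIntegral.integral_congr fun t ht => ?_
    rw [uIcc_of_le hh.le] at ht
    simp only [ha, max_eq_left ht.1]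
  have hexp : ∀ t : ℝ, HasDerivAt (fun t => Real.exp (μ * t)) (Real.exp (μ * t) * μ) t :=
    fun t => by simpa using ((hasDerivAt_id t).const_mul μ).exp
  refine ⟨fun x => ?_, μ * Real.exp μ * ‖ψ‖ + Real.exp μ * ‖f‖, fun h hh x => ?_⟩
  · have hd : HasDerivAt (fun h => Real.exp (μ * h) * ((ψ : H →ᵇ ℝ) x - ∫ t in (0 : ℝ)..h, a x t))
        (μ * (ψ : H →ᵇ ℝ) x - (f : H →ᵇ ℝ) x) 0 := by
      have h1 := (hexp 0).mul (((hac x).integral_hasStrictDerivAt 0 0).hasDerivAt.const_sub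
        ((ψ : H →ᵇ ℝ) x))
      refine h1.congr_deriv ?_
      simp [ha, hN.mehler_zero _ x]
      ring
    have := hd.tendsto_slope_zero_right
    refine this.congr' ?_
    filter_upwards [self_mem_nhdsWithin] with h (hh : 0 < h)
    rw [hR h hh]
    simp [div_eq_inv_mul]
  · obtain ⟨h0, h1⟩ := hh
    rw [hR h h0, abs_div, abs_of_pos h0, div_le_iff₀ h0]
    have hE : Real.exp (μ * h) ≤ Real.exp μ := Real.exp_le_exp.2 (by nlinarith)
    have hE1 : 1 ≤ Real.exp (μ * h) := Real.one_le_exp (by positivity)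
    have hE2 : Real.exp (μ * h) - 1 ≤ μ * h * Real.exp (μ * h) := by
      have := Real.add_one_le_exp (-(μ * h))
      have h3 : Real.exp (-(μ * h)) * Real.exp (μ * h) = 1 := by rw [← Real.exp_add]; simp
      nlinarith
    have hI : |∫ t in (0 : ℝ)..h, a x t| ≤ ‖f‖ * h := by
      have := intervalIntegral.norm_integral_le_of_norm_le_const (a := 0) (b := h) (f := a x)
        (C := ‖f‖) fun t ht => by
          rw [uIoc_of_le h0.le] at ht
          have hle : Real.exp (-μ * t) ≤ 1 := Real.exp_le_one_iff.2 (by nlinarith [ht.1])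
          rw [ha]
          simp only [norm_mul, Real.norm_of_nonneg (Real.exp_pos _).le]
          calc _ ≤ 1 * ‖f‖ := mul_le_mul hle (abs_mehler_le _ f _) (abs_nonneg _) zero_le_one
            _ = ‖f‖ := one_mul _
      simpa [abs_of_pos h0] using this
    have hx := abs_apply_le_norm ψ x
    have e : Real.exp (μ * h) * ((ψ : H →ᵇ ℝ) x - ∫ t in (0 : ℝ)..h, a x t) - (ψ : H →ᵇ ℝ) x =
      (Real.exp (μ * h) - 1) * (ψ : H →ᵇ ℝ) x - Real.exp (μ * h) * ∫ t in (0 : ℝ)..h, a x t := by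
      ring
    rw [e]
    refine (abs_sub _ _).trans ?_
    rw [abs_mul, abs_mul, abs_of_nonneg (sub_nonneg.2 hE1), abs_of_pos (Real.exp_pos _)]
    calc _ ≤ (μ * h * Real.exp μ) * ‖ψ‖ + Real.exp μ * (‖f‖ * h) := by
          gcongr
          exact hE2.trans (by gcongr)
      _ = _ := by ring

/-- Existence of the resolvent on `C_b^1`, with its `C_b^1` bounds. -/
theorem IsMehlerFamily.exists_resolvent (hN : IsMehlerFamily S ω N) {K : ℝ → ℝ}
    (hK : ∀ ε, 0 ≤ K ε) {f : Cb H} {B C μ : ℝ} (hf : HasCOneBound K (f : H →ᵇ ℝ) B C)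
    (hμ : 2 * ω < μ) :
    ∃ ψ : Cb H, ⇑(ψ : H →ᵇ ℝ) = mehlerResolvent S N μ (f : H →ᵇ ℝ) ∧
      HasCOneBound K (ψ : H →ᵇ ℝ) (B / (μ - 2 * ω)) (C / (μ - 2 * ω)) ∧
      IsGeneratorValue S N ψ (μ • ψ - f) := by
  have hμ0 : 0 < μ := by linarith [hN.omega_nonneg]
  have h1 := hN.hasCOneBound_mehlerResolvent hK hf hμ
  have hu : UniformContinuous (mehlerResolvent S N μ (f : H →ᵇ ℝ)) :=
    uniformContinuous_of_fderiv_bound h1.differentiable h1.norm_le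
  let ψ : Cb H := Cb.mk _ hu (‖f‖ / μ) (abs_mehlerResolvent_le hμ0 f)
  exact ⟨ψ, rfl, h1, hN.isGeneratorValue_mehlerResolvent hμ0 rfl⟩

/-- `μ G_μ f → f` pointwise as `μ → ∞`. -/
theorem IsMehlerFamily.tendsto_mul_mehlerResolvent (hN : IsMehlerFamily S ω N) (f : Cb H) (x : H) :
    Tendsto (fun μ => μ * mehlerResolvent S N μ (f : H →ᵇ ℝ) x) atTop
      (𝓝 ((f : H →ᵇ ℝ) x)) := by
  have hscale : ∀ μ : ℝ, 0 < μ → ∫ s in Ioi (0 : ℝ), Real.exp (-s) *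
      mehler S N (max (μ⁻¹ * s) 0) (f : H →ᵇ ℝ) x = μ * mehlerResolvent S N μ (f : H →ᵇ ℝ) x := by
    intro μ hμ
    have := integral_comp_mul_left_Ioi (fun t => Real.exp (-μ * t) *
      mehler S N (max t 0) (f : H →ᵇ ℝ) x) 0 (inv_pos.2 hμ)
    simp only [neg_mul, mul_inv_cancel_left₀ hμ.ne', mul_zero, inv_inv, smul_eq_mul] at this
    rw [this, mehlerResolvent]
    congr 1
    exact setIntegral_congr_fun measurableSet_Ioi fun t (ht : 0 < t) => by
      simp only [max_eq_left ht.le, neg_mul]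
  have hlim : Tendsto (fun μ : ℝ => ∫ s in Ioi (0 : ℝ), Real.exp (-s) *
      mehler S N (max (μ⁻¹ * s) 0) (f : H →ᵇ ℝ) x) atTop
      (𝓝 (∫ s in Ioi (0 : ℝ), Real.exp (-s) * (f : H →ᵇ ℝ) x)) := by
    refine tendsto_integral_filter_of_dominated_convergence (fun s => Real.exp (-s) * ‖f‖)
      (Eventually.of_forall fun μ => ?_) (Eventually.of_forall fun μ => ?_)
      ((integrableOn_exp_neg_Ioi 0).mul_const _) (Eventually.of_forall fun s => ?_)
    · exact ((by fun_prop : Continuous fun s : ℝ => Real.exp (-s)).mul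
        ((hN.continuous_mehler_max f x).comp (by fun_prop))).aestronglyMeasurable
    · refine Eventually.of_forall fun s => ?_
      rw [norm_mul, Real.norm_of_nonneg (Real.exp_pos _).le]
      exact mul_le_mul_of_nonneg_left (abs_mehler_le _ f x) (Real.exp_pos _).le
    · have h1 : Tendsto (fun μ : ℝ => μ⁻¹ * s) atTop (𝓝 0) := by
        simpa using tendsto_inv_atTop_zero.mul_const s
      have h2 := ((hN.continuous_mehler_max f x).tendsto 0).comp h1
      simp only [max_self, hN.mehler_zero _ x] at h2
      exact h2.const_mul _
  rw [integral_mul_const, integral_exp_neg_Ioi_zero, one_mul] at hlim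
  exact hlim.congr' ((eventually_gt_atTop 0).mono hscale)

end Generator

/-! ### Euler steps along the drift -/

section Euler

variable {H : Type*} [NormedAddCommGroup H] [InnerProductSpace ℝ H] {F : H → H}

/-- The operator `φ ↦ φ(· + h F(·))` on `C_b(H)`: one Euler step of length `h` along `F`. -/
noncomputable def eulerCb (hF : UniformContinuous F) (h : ℝ) (φ : Cb H) : Cb H :=
  Cb.mk (fun x => (φ : H →ᵇ ℝ) (x + h • F x))
    (UniformContinuous.comp φ.2 (uniformContinuous_id.add (hF.const_smul h))) ‖φ‖
    fun _ => abs_apply_le_norm φ _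

theorem eulerCb_sub (hF : UniformContinuous F) (h : ℝ) (φ ψ : Cb H) :
    eulerCb hF h (φ - ψ) = eulerCb hF h φ - eulerCb hF h ψ := rfl

theorem norm_eulerCb_le (hF : UniformContinuous F) (h : ℝ) (φ : Cb H) : ‖eulerCb hF h φ‖ ≤ ‖φ‖ :=
  norm_le_of_forall_abs_le (norm_nonneg φ) fun _ => abs_apply_le_norm φ _

theorem norm_smul_of_nonneg {c : ℝ} (hc : 0 ≤ c) (φ : Cb H) : ‖c • φ‖ = c * ‖φ‖ := by
  have := norm_smul c (φ : H →ᵇ ℝ)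
  rwa [Real.norm_of_nonneg hc] at this

/-- The iterates of a contraction are approximate fixed points. -/
theorem exists_norm_apply_sub_le {X E : Type*} [NormedAddCommGroup E] (i : X → E) (Φ : X → X)
    (x₀ : X) {q : ℝ} (hq0 : 0 ≤ q) (hq1 : q < 1)
    (hΦ : ∀ x y, ‖i (Φ x) - i (Φ y)‖ ≤ q * ‖i x - i y‖) {η : ℝ} (hη : 0 < η) :
    ∃ x, ‖i (Φ x) - i x‖ ≤ η := by
  have hgeom : ∀ n, ‖i (Φ (Φ^[n] x₀)) - i (Φ^[n] x₀)‖ ≤ q ^ n * ‖i (Φ x₀) - i x₀‖ := by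
    intro n
    induction n with
    | zero => simp
    | succ n ih =>
      rw [Function.iterate_succ_apply', pow_succ', mul_assoc]
      exact (hΦ _ _).trans (mul_le_mul_of_nonneg_left ih hq0)
  have hlim : Tendsto (fun n : ℕ => q ^ n * ‖i (Φ x₀) - i x₀‖) atTop (𝓝 0) := by
    simpa using (tendsto_pow_atTop_nhds_zero_of_lt_one hq0 hq1).mul_const ‖i (Φ x₀) - i x₀‖
  obtain ⟨n, hn⟩ := (hlim.eventually (gt_mem_nhds hη)).exists
  exact ⟨_, (hgeom n).trans hn.le⟩

variable {K : ℝ → ℝ} {B C M₀ : ℝ}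

/-- The Euler difference quotient approximates the derivative along `F`, uniformly. -/
theorem HasCOneBound.abs_euler_sub_le {u : H → ℝ} (hu : HasCOneBound K u B C) (hK : ∀ ε, 0 ≤ K ε)
    (hM₀ : ∀ x, ‖F x‖ ≤ M₀) {ε h : ℝ} (hε : 0 < ε) (hh : 0 < h) (x : H) :
    |(u (x + h • F x) - u x) / h - fderiv ℝ u x (F x)| ≤ C * (ε + K ε * (h * M₀)) * M₀ := by
  have hC := hu.nonneg_right
  have hKε := hK ε
  have hM₀' : 0 ≤ M₀ := (norm_nonneg _).trans (hM₀ x)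
  have e : (u (x + h • F x) - u x) / h - fderiv ℝ u x (F x) =
      (u (x + h • F x) - u x - fderiv ℝ u x (h • F x)) / h := by
    rw [map_smul, smul_eq_mul]
    field_simp
  have hn : ‖h • F x‖ ≤ h * M₀ := by
    rw [norm_smul, Real.norm_of_nonneg hh.le]
    exact mul_le_mul_of_nonneg_left (hM₀ x) hh.le
  rw [e, abs_div, abs_of_pos hh, div_le_iff₀ hh]
  calc _ ≤ C * (ε + K ε * ‖h • F x‖) * ‖h • F x‖ := hu.taylor hK hε x _
    _ ≤ C * (ε + K ε * (h * M₀)) * (h * M₀) := by gcongr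
    _ = _ := by ring

theorem HasCOneBound.mono_modulus {K' : ℝ → ℝ} {u : H → ℝ} (hu : HasCOneBound K u B C)
    (hKK' : ∀ ε, K ε ≤ K' ε) : HasCOneBound K' u B C where
  differentiable := hu.differentiable
  norm_le := hu.norm_le
  modulus ε hε x y := (hu.modulus ε hε x y).trans
    (mul_le_mul_of_nonneg_left (by gcongr; exact hKK' ε) hu.nonneg_right)

theorem HasCOneBound.mem_cbOne {φ : Cb H} (hφ : HasCOneBound K (φ : H →ᵇ ℝ) B C)
    (hK : ∀ ε, 0 ≤ K ε) : φ ∈ CbOne H :=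
  ⟨hφ.differentiable, hφ.uniformContinuous_fderiv hK, B, hφ.norm_le⟩

theorem exists_hasCOneBound {φ : Cb H} (hφ : φ ∈ CbOne H) :
    ∃ K : ℝ → ℝ, (∀ ε, 0 ≤ K ε) ∧ ∃ B, HasCOneBound K (φ : H →ᵇ ℝ) B 1 := by
  obtain ⟨hd, hu, B, hB⟩ := hφ
  obtain ⟨K, hK, h⟩ := exists_affine_modulus hB hu
  exact ⟨K, hK, B, hd, hB, fun ε hε x y => by rw [one_mul]; exact h ε hε x y⟩

/-- The error of the Euler difference quotient can be made small. -/
theorem exists_step_error_le (hC : 0 ≤ C) (hM₀ : 0 ≤ M₀) (hK : ∀ ε, 0 ≤ K ε) {δ : ℝ} (hδ : 0 < δ) :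
    ∃ ε h : ℝ, 0 < ε ∧ 0 < h ∧ h ≤ 1 ∧ C * (ε + K ε * (h * M₀)) * M₀ ≤ δ := by
  set ε := δ / (2 * (C * M₀ + 1)) with hε
  have hε0 : 0 < ε := by positivity
  have hKε := hK ε
  set h := min 1 (ε / (K ε * M₀ + 1)) with hh
  have hh0 : 0 < h := by positivity
  have h1 : h * (K ε * M₀ + 1) ≤ ε := by
    have := min_le_right 1 (ε / (K ε * M₀ + 1))
    rwa [le_div_iff₀ (by positivity)] at this
  refine ⟨ε, h, hε0, hh0, min_le_left _ _, ?_⟩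
  have h2 : K ε * (h * M₀) ≤ ε := by nlinarith
  calc _ ≤ C * (ε + ε) * M₀ := by gcongr
    _ = 2 * ε * (C * M₀) := by ring
    _ ≤ 2 * ε * (C * M₀ + 1) := by gcongr; linarith
    _ = δ := by rw [hε]; field_simp

end Euler

/-! ### Approximate solutions of the perturbed resolvent equation -/

section Perturbation

variable {H : Type*} [NormedAddCommGroup H] [InnerProductSpace ℝ H] [MeasurableSpace H]
  [BorelSpace H] [SecondCountableTopology H] [CompleteSpace H] {S : ℝ → H →L[ℝ] H} {ω : ℝ}
  {N : ℝ → Measure H} [∀ t, IsProbabilityMeasure (N t)] {F : H → H}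

theorem IsGeneratorValue.sub {φ ψ g k : Cb H} (hφ : IsGeneratorValue S N φ g)
    (hψ : IsGeneratorValue S N ψ k) : IsGeneratorValue S N (φ - ψ) (g - k) := by
  obtain ⟨h₁, C, hC⟩ := hφ
  obtain ⟨h₂, D, hD⟩ := hψ
  have key : ∀ t x, (mehler S N t ((φ - ψ : Cb H) : H →ᵇ ℝ) x - ((φ - ψ : Cb H) : H →ᵇ ℝ) x) / t =
      (mehler S N t (φ : H →ᵇ ℝ) x - (φ : H →ᵇ ℝ) x) / t -
        (mehler S N t (ψ : H →ᵇ ℝ) x - (ψ : H →ᵇ ℝ) x) / t := by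
    intro t x
    have e : mehler S N t ((φ - ψ : Cb H) : H →ᵇ ℝ) x =
        mehler S N t (φ : H →ᵇ ℝ) x - mehler S N t (ψ : H →ᵇ ℝ) x :=
      integral_sub (mehler_integrable t φ x) (mehler_integrable t ψ x)
    have e' : ((φ - ψ : Cb H) : H →ᵇ ℝ) x = (φ : H →ᵇ ℝ) x - (ψ : H →ᵇ ℝ) x := rfl
    rw [e, e']
    ring
  refine ⟨fun x => ((h₁ x).sub (h₂ x)).congr fun t => (key t x).symm, C + D, fun t ht x => ?_⟩
  rw [key]
  exact (abs_sub _ _).trans (add_le_add (hC t ht x) (hD t ht x))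

/-- The perturbed operator `L + ⟨D·, F⟩` is dissipative: its resolvent equation is the limit of
those of the dissipative operators `L + (T_h - 1) / h`, where `T_h` is an Euler step. -/
theorem IsGeneratorValue.le_perturbed (hN : IsMehlerFamily S ω N) (hF : IsCbOneField F)
    {φ g k : Cb H} (hφ : IsGeneratorValue S N φ g) (hφ₁ : φ ∈ CbOne H)
    (hk : ∀ x, (k : H →ᵇ ℝ) x = fderiv ℝ (φ : H →ᵇ ℝ) x (F x)) {l : ℝ} (hl : 0 < l) :
    l * ‖φ‖ ≤ ‖l • φ - (g + k)‖ := by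
  obtain ⟨K, hK, B, hb⟩ := exists_hasCOneBound hφ₁
  obtain ⟨M₀, hM₀⟩ := hF.bounded
  refine le_of_forall_pos_le_add fun δ hδ => ?_
  obtain ⟨ε, h, hε, hh, -, herr⟩ := exists_step_error_le (C := 1) (M₀ := M₀) zero_le_one
    ((norm_nonneg _).trans (hM₀ 0)) hK hδ
  set r : Cb H := h⁻¹ • (eulerCb hF.uniformContinuous h φ - φ) - k with hr
  have hrδ : ‖r‖ ≤ δ := by
    refine norm_le_of_forall_abs_le hδ.le fun x => ?_
    have e : (r : H →ᵇ ℝ) x = ((φ : H →ᵇ ℝ) (x + h • F x) - (φ : H →ᵇ ℝ) x) / h -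
        fderiv ℝ (φ : H →ᵇ ℝ) x (F x) := by
      rw [← hk x, div_eq_inv_mul]
      rfl
    rw [e]
    exact (hb.abs_euler_sub_le hK hM₀ hε hh x).trans herr
  have h1 := hφ.le hN (show 0 < l + h⁻¹ by positivity)
  have e : (l + h⁻¹) • φ - g = (l • φ - (g + k)) + h⁻¹ • eulerCb hF.uniformContinuous h φ - r := by
    rw [hr]
    module
  rw [e] at h1
  have h2 : ‖h⁻¹ • eulerCb hF.uniformContinuous h φ‖ ≤ h⁻¹ * ‖φ‖ := by
    rw [norm_smul_of_nonneg (by positivity)]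
    exact mul_le_mul_of_nonneg_left (norm_eulerCb_le _ _ _) (by positivity)
  have h3 := norm_sub_le (l • φ - (g + k) + h⁻¹ • eulerCb hF.uniformContinuous h φ) r
  have h4 := norm_add_le (l • φ - (g + k)) (h⁻¹ • eulerCb hF.uniformContinuous h φ)
  linarith

/-- Approximate solvability of `l φ - L φ - ⟨Dφ, F⟩ = f` for `f ∈ C_b^1(H)` and large `l`. One
iterates `φ ↦ (l + 1/h - L)⁻¹ (f + T_h φ / h)`, where `T_h` is the Euler step of length `h`: this map
is a contraction of the supremum norm that preserves explicit `C_b^1` bounds independent of `h`, and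
such bounds control the difference between `(T_h φ - φ) / h` and `⟨Dφ, F⟩`. -/
theorem IsMehlerFamily.exists_approx_solution (hN : IsMehlerFamily S ω N) (hF : IsCbOneField F)
    {K : ℝ → ℝ} (hK : ∀ ε, 0 ≤ K ε) {M : ℝ} (hM : ∀ x, ‖fderiv ℝ F x‖ ≤ M)
    (hFK : ∀ ε, 0 < ε → ∀ x y, ‖fderiv ℝ F x - fderiv ℝ F y‖ ≤ ε + K ε * ‖x - y‖)
    {f : Cb H} {B C : ℝ} (hf : HasCOneBound K (f : H →ᵇ ℝ) B C) {l : ℝ}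
    (hl : 2 * ω + (2 * M + M ^ 2) < l) {δ : ℝ} (hδ : 0 < δ) :
    ∃ φ g : Cb H, IsGeneratorValue S N φ g ∧ φ ∈ CbOne H ∧
      (∀ x, ‖fderiv ℝ (φ : H →ᵇ ℝ) x‖ ≤ B / (l - (2 * ω + (2 * M + M ^ 2)))) ∧
      ∀ x, |l * (φ : H →ᵇ ℝ) x - ((g : H →ᵇ ℝ) x + fderiv ℝ (φ : H →ᵇ ℝ) x (F x)) -
        (f : H →ᵇ ℝ) x| ≤ δ := by
  have hω := hN.omega_nonneg
  have hM' : 0 ≤ M := (norm_nonneg _).trans (hM 0)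
  have hB := hf.nonneg
  have hC := hf.nonneg_right
  obtain ⟨M₀, hM₀⟩ := hF.bounded
  set d := l - (2 * ω + (2 * M + M ^ 2)) with hd
  have hd0 : 0 < d := by linarith
  have hl0 : 0 < l := by nlinarith
  set B₁ := B / d with hB₁
  set C₁ := (C + B₁) / d with hC₁
  have hB₁0 : 0 ≤ B₁ := by positivity
  have hC₁0 : 0 ≤ C₁ := by positivity
  have hB₁d : B₁ * d = B := div_mul_cancel₀ _ hd0.ne'
  have hC₁d : C₁ * d = C + B₁ := div_mul_cancel₀ _ hd0.ne'
  obtain ⟨ε, h, hε, hh, hh1, herr⟩ := exists_step_error_le (C := C₁) (M₀ := M₀) hC₁0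
    ((norm_nonneg _).trans (hM₀ 0)) hK (half_pos hδ)
  set T := eulerCb hF.uniformContinuous h with hT
  set μ := l + h⁻¹ with hμ
  have hhi : 0 < h⁻¹ := inv_pos.2 hh
  have hhh : h⁻¹ * h = 1 := inv_mul_cancel₀ hh.ne'
  have hμ0 : 0 < μ := by positivity
  have hμω : 2 * ω < μ := by nlinarith
  -- `(1 + h M)² / h ≤ 1 / h + 2 M + M²` because `h ≤ 1`
  have hfac : h⁻¹ * (1 + h * M) ^ 2 ≤ h⁻¹ + (2 * M + M ^ 2) := by
    have e : h⁻¹ * (1 + h * M) ^ 2 = h⁻¹ + (h⁻¹ * h) * (2 * M) + (h⁻¹ * h) * (h * M ^ 2) := by ring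
    rw [e, hhh]
    nlinarith [sq_nonneg M]
  have hstep : ∀ φ : {φ : Cb H // HasCOneBound K (φ : H →ᵇ ℝ) B₁ C₁},
      ∃ ψ : {φ : Cb H // HasCOneBound K (φ : H →ᵇ ℝ) B₁ C₁},
        IsGeneratorValue S N ψ (μ • (ψ : Cb H) - (f + h⁻¹ • T φ)) := by
    rintro ⟨φ, hφ⟩
    have h1 : HasCOneBound K ((f + h⁻¹ • T φ : Cb H) : H →ᵇ ℝ)
        (B + h⁻¹ * (B₁ * (1 + h * M) ^ 2)) (C + h⁻¹ * (C₁ * (1 + h * M) ^ 2 + h * B₁)) :=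
      hf.add ((hφ.comp_euler hK hF.differentiable hM hFK hh.le).const_mul hhi.le)
    obtain ⟨ψ, -, hψ, hg⟩ := hN.exists_resolvent hK h1 hμω
    refine ⟨⟨ψ, hψ.mono hK ?_ ?_⟩, hg⟩
    · rw [div_le_iff₀ (by linarith)]
      have := mul_le_mul_of_nonneg_left hfac hB₁0
      rw [hd] at hB₁d
      rw [hμ]
      nlinarith
    · rw [div_le_iff₀ (by linarith)]
      have := mul_le_mul_of_nonneg_left hfac hC₁0
      have e : h⁻¹ * (C₁ * (1 + h * M) ^ 2 + h * B₁) =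
          C₁ * (h⁻¹ * (1 + h * M) ^ 2) + (h⁻¹ * h) * B₁ := by ring
      rw [e, hhh]
      rw [hd] at hC₁d
      rw [hμ]
      nlinarith
  choose Φ hΦ using hstep
  have hzero : HasCOneBound K ((0 : Cb H) : H →ᵇ ℝ) B₁ C₁ := by
    have hfd : ∀ x, fderiv ℝ ((0 : Cb H) : H →ᵇ ℝ) x = 0 := fun x =>
      (hasFDerivAt_const (0 : ℝ) x).fderiv
    refine ⟨differentiable_const (0 : ℝ), fun x => ?_, fun ε hε x y => ?_⟩
    · rw [hfd, norm_zero]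
      exact hB₁0
    · rw [hfd, hfd, sub_zero, norm_zero]
      have := hK ε
      positivity
  set q := h⁻¹ / μ with hq
  have hq0 : 0 ≤ q := by positivity
  have hq1 : q < 1 := by
    rw [hq, div_lt_one hμ0]
    linarith
  -- the iteration contracts the supremum norm by the factor `q`
  have hcontr : ∀ φ ψ, ‖(Φ φ : Cb H) - Φ ψ‖ ≤ q * ‖(φ : Cb H) - ψ‖ := by
    intro φ ψ
    have h1 := ((hΦ φ).sub (hΦ ψ)).le hN hμ0
    have e : μ • ((Φ φ : Cb H) - Φ ψ) -
        (μ • (Φ φ : Cb H) - (f + h⁻¹ • T φ) - (μ • (Φ ψ : Cb H) - (f + h⁻¹ • T ψ))) =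
        h⁻¹ • T ((φ : Cb H) - ψ) := by
      rw [hT, eulerCb_sub]
      module
    rw [e, norm_smul_of_nonneg hhi.le] at h1
    have h2 := norm_eulerCb_le hF.uniformContinuous h ((φ : Cb H) - ψ)
    rw [hq, div_mul_eq_mul_div, le_div_iff₀ hμ0, mul_comm]
    exact h1.trans (mul_le_mul_of_nonneg_left h2 hhi.le)
  obtain ⟨χ, hχ⟩ := exists_norm_apply_sub_le Subtype.val Φ ⟨0, hzero⟩ hq0 hq1 hcontr
    (show 0 < h * (δ / 2) by positivity)
  have hval := hΦ χ
  set φ : Cb H := (Φ χ).1 with hφ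
  have hφb : HasCOneBound K (φ : H →ᵇ ℝ) B₁ C₁ := (Φ χ).2
  refine ⟨φ, _, hval, hφb.mem_cbOne hK, hφb.norm_le, fun x => ?_⟩
  have h1 : |h⁻¹ * (T ((χ : Cb H) - φ) : H →ᵇ ℝ) x| ≤ δ / 2 := by
    rw [abs_mul, abs_of_pos hhi]
    rw [inv_mul_le_iff₀ hh]
    refine (abs_apply_le_norm _ x).trans ((norm_eulerCb_le _ _ _).trans ?_)
    exact (norm_sub_rev (χ : Cb H) φ).trans_le hχ
  have h2 := (hφb.abs_euler_sub_le hK hM₀ hε hh x).trans herr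
  have e : l * (φ : H →ᵇ ℝ) x - (((μ • φ - (f + h⁻¹ • T χ) : Cb H) : H →ᵇ ℝ) x +
      fderiv ℝ (φ : H →ᵇ ℝ) x (F x)) - (f : H →ᵇ ℝ) x =
      h⁻¹ * (T ((χ : Cb H) - φ) : H →ᵇ ℝ) x +
        (((φ : H →ᵇ ℝ) (x + h • F x) - (φ : H →ᵇ ℝ) x) / h - fderiv ℝ (φ : H →ᵇ ℝ) x (F x)) := by
    have e1 : ((μ • φ - (f + h⁻¹ • T χ) : Cb H) : H →ᵇ ℝ) x = μ * (φ : H →ᵇ ℝ) x -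
      ((f : H →ᵇ ℝ) x + h⁻¹ * ((χ : Cb H) : H →ᵇ ℝ) (x + h • F x)) := rfl
    have e2 : (T ((χ : Cb H) - φ) : H →ᵇ ℝ) x =
      ((χ : Cb H) : H →ᵇ ℝ) (x + h • F x) - (φ : H →ᵇ ℝ) (x + h • F x) := rfl
    rw [e1, e2, hμ, div_eq_inv_mul]
    ring
  rw [e]
  exact (abs_add_le _ _).trans (by linarith)

end Perturbation

/-! ### The operator `N₀` -/

section Main

variable {H : Type*} [NormedAddCommGroup H] [InnerProductSpace ℝ H] [CompleteSpace H]
  [MeasurableSpace H] [BorelSpace H] {S : ℝ → H →L[ℝ] H} {Q : H →L[ℝ] H} {F : H → H}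

theorem mem_ouGraph_iff {φ g : Cb H} : (φ, g) ∈ ouGraph S Q ↔
    IsGeneratorValue S (fun t => gaussianMeasure (covOp S Q t)) φ g := Iff.rfl

theorem mem_graph_N₀_iff {hF : IsCbOneField F} {φ w : Cb H} : (φ, w) ∈ (N₀ S Q F hF).graph ↔
    ∃ g, ∃ hφ : φ ∈ CbOne H, IsGeneratorValue S (fun t => gaussianMeasure (covOp S Q t)) φ g ∧
      w = g + drift F hF ⟨φ, hφ⟩ := by
  constructor
  · intro h
    obtain ⟨y, hy1, hy2⟩ := (LinearPMap.mem_graph_iff _).1 h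
    obtain ⟨y, hyL, hyF⟩ := y
    obtain rfl : y = φ := hy1
    have hL := LinearPMap.mem_graph (ouGenerator S Q) ⟨y, hyL⟩
    rw [ouGenerator_graph] at hL
    exact ⟨_, hyF, mem_ouGraph_iff.1 hL, hy2.symm⟩
  · rintro ⟨g, hφ, hg, rfl⟩
    have hL : (φ, g) ∈ (ouGenerator S Q).graph := by
      rw [ouGenerator_graph]
      exact mem_ouGraph_iff.2 hg
    obtain ⟨y, hy1, hy2⟩ := (LinearPMap.mem_graph_iff _).1 hL
    obtain ⟨y, hyL⟩ := y
    obtain rfl : y = φ := hy1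
    obtain rfl : ouGenerator S Q ⟨y, hyL⟩ = g := hy2
    exact (LinearPMap.mem_graph_iff _).2 ⟨⟨y, hyL, hφ⟩, rfl, rfl⟩

variable [SecondCountableTopology H] {ω : ℝ}

theorem IsMehlerFamily.isDissipative_N₀
    (hN : IsMehlerFamily S ω fun t => gaussianMeasure (covOp S Q t)) (hF : IsCbOneField F) :
    IsDissipative (E := Cb H) (N₀ S Q F hF) := by
  intro l hl u
  obtain ⟨g, hφ, hg, hw⟩ := mem_graph_N₀_iff.1 (LinearPMap.mem_graph (N₀ S Q F hF) u)
  rw [hw]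
  exact hg.le_perturbed hN hF hφ (drift_apply F hF ⟨_, hφ⟩) hl

/-- Approximate solutions of `l φ - N₀ φ = f`, together with the size of the drift term, which is
of order `1 / l`. -/
theorem IsMehlerFamily.exists_approx_N₀
    (hN : IsMehlerFamily S ω fun t => gaussianMeasure (covOp S Q t)) (hF : IsCbOneField F) :
    ∃ c, 2 * ω ≤ c ∧ ∀ f ∈ CbOne H, ∃ D, ∀ l, c < l → ∀ δ, 0 < δ →
      ∃ φ g w : Cb H, (φ, w) ∈ (N₀ S Q F hF).graph ∧
        IsGeneratorValue S (fun t => gaussianMeasure (covOp S Q t)) φ g ∧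
        ‖l • φ - w - f‖ ≤ δ ∧ ‖l • φ - g - f‖ ≤ δ + D / (l - c) := by
  obtain ⟨M, hM⟩ := hF.bounded_fderiv
  obtain ⟨M₀, hM₀⟩ := hF.bounded
  have hM' : 0 ≤ M := (norm_nonneg _).trans (hM 0)
  have hM₀' : 0 ≤ M₀ := (norm_nonneg _).trans (hM₀ 0)
  obtain ⟨K, hK, hFK⟩ := exists_affine_modulus hM hF.uniformContinuous_fderiv
  refine ⟨2 * ω + (2 * M + M ^ 2), by nlinarith, fun f hf => ?_⟩
  obtain ⟨K', hK', B, hfB⟩ := exists_hasCOneBound hf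
  refine ⟨B * M₀, fun l hl δ hδ => ?_⟩
  -- a common family of moduli for the differentials of `F` and of `f`
  obtain ⟨φ, g, hg, hφ, hφB, herr⟩ := hN.exists_approx_solution hF
    (K := fun ε => K ε + K' ε) (fun ε => add_nonneg (hK ε) (hK' ε)) hM
    (fun ε hε x y => (hFK ε hε x y).trans (by gcongr; exact le_add_of_nonneg_right (hK' ε)))
    (hfB.mono_modulus fun ε => le_add_of_nonneg_left (hK ε)) hl hδ
  have hld : 0 < l - (2 * ω + (2 * M + M ^ 2)) := sub_pos.2 hl
  have hB := hfB.nonneg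
  have h1 : ‖l • φ - (g + drift F hF ⟨φ, hφ⟩) - f‖ ≤ δ := norm_le_of_forall_abs_le hδ.le herr
  have h2 : ‖drift F hF ⟨φ, hφ⟩‖ ≤ B * M₀ / (l - (2 * ω + (2 * M + M ^ 2))) := by
    refine norm_le_of_forall_abs_le (by positivity) fun x => ?_
    rw [mul_div_right_comm]
    exact (ContinuousLinearMap.le_opNorm _ _).trans
      (mul_le_mul (hφB x) (hM₀ x) (norm_nonneg _) (by positivity))
  refine ⟨φ, g, _, mem_graph_N₀_iff.2 ⟨g, hφ, hg, rfl⟩, hg, h1, ?_⟩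
  have e : l • φ - g - f = (l • φ - (g + drift F hF ⟨φ, hφ⟩) - f) + drift F hF ⟨φ, hφ⟩ := by abel
  have h3 := norm_add_le (l • φ - (g + drift F hF ⟨φ, hφ⟩) - f) (drift F hF ⟨φ, hφ⟩)
  rw [e]
  linarith

/-- For large `l` the range of `l - N₀` is dense. -/
theorem IsMehlerFamily.exists_dense_range_N₀
    (hN : IsMehlerFamily S ω fun t => gaussianMeasure (covOp S Q t)) (hF : IsCbOneField F) :
    ∃ l : ℝ, 0 < l ∧
      Dense (range fun u : (N₀ S Q F hF).domain => l • (u : Cb H) - N₀ S Q F hF u) := by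
  obtain ⟨c, hc, h⟩ := hN.exists_approx_N₀ hF
  have hω := hN.omega_nonneg
  refine ⟨c + 1, by linarith, dense_range_of_forall_approx (E := Cb H) fun g ε hε => ?_⟩
  obtain ⟨f, hf, hfg⟩ := exists_cbOne_close g (show 0 < ε / 3 by positivity)
  obtain ⟨D, hD⟩ := h f hf
  obtain ⟨φ, -, w, hw, -, h1, -⟩ := hD (c + 1) (lt_add_one c) (ε / 3) (by positivity)
  refine ⟨φ, w, hw, ?_⟩
  have h2 : ‖(c + 1) • φ - w - g‖ ≤ ‖(c + 1) • φ - w - f‖ + ‖f - g‖ :=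
    norm_sub_le_norm_sub_add_norm_sub ((c + 1) • φ - w) f g
  linarith

/-- If `φₙ → 0` and `N₀ φₙ → g`, dissipativity forces the approximate solutions `φ` of
`l φ - N₀ φ = f` with `f ∈ C_b^1(H)` close to `g` to have `l ‖φ‖` small. On the other hand, for large
`l`, `l φ` is close to `l (l - L)⁻¹ f`, which converges pointwise to `f`. Hence `f` and `g` are
small. -/
theorem IsMehlerFamily.isClosable_N₀
    (hN : IsMehlerFamily S ω fun t => gaussianMeasure (covOp S Q t)) (hF : IsCbOneField F) :
    (N₀ S Q F hF).IsClosable := by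
  have hω := hN.omega_nonneg
  refine isClosable_of_forall_closure (E := Cb H) fun g hg => ?_
  obtain ⟨c, hc, h⟩ := hN.exists_approx_N₀ hF
  have key : ∀ ε, 0 < ε → ‖g‖ ≤ 4 * ε := by
    intro ε hε
    obtain ⟨f, hf, hfg⟩ := exists_cbOne_close g hε
    obtain ⟨D, hD⟩ := h f hf
    obtain ⟨K, hK, B, hfB⟩ := exists_hasCOneBound hf
    have hres : ∀ l, c < l → ∀ x, |l * mehlerResolvent S
        (fun t => gaussianMeasure (covOp S Q t)) l (f : H →ᵇ ℝ) x| ≤ 3 * ε + D / (l - c) := by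
      intro l hl x
      have hl0 : 0 < l := by linarith
      obtain ⟨φ, k, w, hw, hk, h1, h2⟩ := hD l hl ε hε
      obtain ⟨ψ, hψ, -, hψL⟩ := hN.exists_resolvent hK hfB (hc.trans_lt hl)
      have h6 := (hN.isDissipative_N₀ hF).mul_norm_le_of_zero_mem_closure hl0 (f := f) hw hg
      have h8 := (hψL.sub hk).le hN hl0
      have e8 : l • (ψ - φ) - (l • ψ - f - k) = -(l • φ - k - f) := by
        module
      have h8' : ‖-(l • φ - k - f)‖ = ‖l • φ - k - f‖ := norm_neg (l • φ - k - f)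
      rw [e8, h8'] at h8
      have h9 : ‖ψ‖ ≤ ‖ψ - φ‖ + ‖φ‖ := norm_le_norm_sub_add ψ φ
      rw [← hψ, abs_mul, abs_of_pos hl0]
      have h10 := mul_le_mul_of_nonneg_left ((abs_apply_le_norm ψ x).trans h9) hl0.le
      linarith
    have hlim : Tendsto (fun l => 3 * ε + D / (l - c)) atTop (𝓝 (3 * ε + 0)) :=
      tendsto_const_nhds.add
        (tendsto_const_nhds.div_atTop (tendsto_atTop_add_const_right _ (-c) tendsto_id))
    rw [add_zero] at hlim
    have hfx : ‖f‖ ≤ 3 * ε := norm_le_of_forall_abs_le (by positivity) fun x =>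
      le_of_tendsto_of_tendsto (hN.tendsto_mul_mehlerResolvent f x).abs hlim
        ((eventually_gt_atTop c).mono fun l hl => hres l hl x)
    have h1 : ‖g‖ ≤ ‖g - f‖ + ‖f‖ := norm_le_norm_sub_add g f
    have h2 : ‖g - f‖ = ‖f - g‖ := norm_sub_rev g f
    linarith
  have hg0 : ‖(g : H →ᵇ ℝ)‖ ≤ 0 := le_of_forall_pos_le_add fun ε hε =>
    (key (ε / 4) (by positivity)).trans (by linarith)
  exact Subtype.ext (norm_le_zero_iff.1 hg0)

end Main

end OUPerturbation

theorem theorem3p9 {H : Type*} [NormedAddCommGroup H] [InnerProductSpace ℝ H] [CompleteSpace H]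
    [TopologicalSpace.SeparableSpace H] [MeasurableSpace H] [BorelSpace H]
    (A : H →ₗ.[ℝ] H) (S : ℝ → H →L[ℝ] H)
    (hS : OUPerturbation.IsStronglyContinuousSemigroup S)
    (hA : OUPerturbation.IsInfinitesimalGenerator A S)
    (ω : ℝ) (hω : ∀ t : ℝ, 0 ≤ t → ‖S t‖ ≤ Real.exp (ω * t))
    (Q : H →L[ℝ] H) (hQ : Q.IsPositive)
    (hQt : ∀ t : ℝ, 0 < t → OUPerturbation.IsTraceClass (OUPerturbation.covOp S Q t))
    (F : H → H) (hF : OUPerturbation.IsCbOneField F) :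
    OUPerturbation.IsDissipative (E := OUPerturbation.Cb H) (OUPerturbation.N₀ S Q F hF) ∧
    (∀ l : ℝ, 0 < l →
      Dense (Set.range fun φ : (OUPerturbation.N₀ S Q F hF).domain =>
        l • (φ : OUPerturbation.Cb H) - OUPerturbation.N₀ S Q F hF φ)) ∧
    (OUPerturbation.N₀ S Q F hF).IsClosable ∧
    OUPerturbation.IsMDissipative (E := OUPerturbation.Cb H) (OUPerturbation.N₀ S Q F hF).closure := by
  have : SecondCountableTopology H := UniformSpace.secondCountable_of_separable H
  have hN : OUPerturbation.IsMehlerFamily S |ω| _ :=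
    OUPerturbation.isMehlerFamily_gaussianMeasure hS (abs_nonneg ω)
      (fun t ht => (hω t ht).trans (Real.exp_le_exp.2
        (mul_le_mul_of_nonneg_right (le_abs_self ω) ht))) hQ hQt
  have hd := hN.isDissipative_N₀ hF
  have hc := hN.isClosable_N₀ hF
  obtain ⟨l, hl, hdense⟩ := hN.exists_dense_range_N₀ hF
  obtain ⟨hm, hr⟩ := hd.isMDissipative_closure hc hl hdense
  exact ⟨hd, hr, hc, hm⟩
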